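/- **Setting.** Let $p$ be a prime, $q=p^{e}$, and let $V$ be a Noetherian irreducible regular scheme of characteristic $p$ that is $F$-finite (i.e. $\mathcal O_V$ is a finite $\mathcal O_V^{p}$-module). Ideals and $\mathcal O^{q}$-submodules are quasi-coherent. For an invertible ideal $\mathcal L$ let $F^{e}\mathcal L=\{t^{q}:t\in\mathcal L\}$; colons $(\,\cdot:\cdot\,)$ denote the largest submodule (resp. ideal) whose product with the second entry lies in the first. $\nu_x$ is the order of an ideal at $x$ (with $\nu_x(0)=\infty$). For an $\mathcal O_V^{q}$-submodule $\mathcal M\subseteq\mathcal O_V$ let $\mathrm{Diff}^{i}_{V,+}(\mathcal M)$ be the ideal generated by the elements $D(m)$, where $m$ is a section of $\mathcal M$ and $D$ an absolute differential operator of order $\le i$ with $D(1)=0$. Put $\mathcal G(\mathcal M)=(\mathrm{Diff}^{1}_{V,+}(\mathcal M),\dots,\mathrm{Diff}^{q-1}_{V,+}(\mathcal M))$ and let $\mathrm{Sing}(\mathcal M,1)$ be the closed set defined by $\mathrm{Diff}^{q-1}_{V,+}(\mathcal M)$. For a collection of ideals $\mathcal G=(\mathcal I_1,\dots,\mathcal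 I_{q-1})$ put $\eta_x(\mathcal G)=\min\{\nu_x(\mathcal I_i)+i:1\le i\le q-1\}$, and $\eta_x(\mathcal M)=\eta_x(\mathcal G(\mathcal M))$. Let $Z\subset V$ be a regular closed subscheme, $\pi:V_1\to V$ the blowup along $Z$, and $H_1\subset V_1$ the exceptional divisor, with ideal $\mathcal I(H_1)$. For $a\ge 1$ the $a$-transforms of $\mathcal M$ and of $\mathcal G$ are $$\mathcal M_1^{(a)}=\big((\mathcal M\mathcal O_{V_1}^{q}+\mathcal O_{V_1}^{q}):F^{e}(\mathcal I(H_1)^{a})\big)\subseteq\mathcal O_{V_1},\qquad \mathcal G_1^{(a)}=\big((\mathcal I_i\mathcal O_{V_1}:\mathcal I(H_1)^{qa})\big)_{1\le i\le q-1},$$ where $\mathcal M\mathcal O_{V_1}^{q}$ is the $\mathcal O_{V_1}^{q}$-submodule of $\mathcal O_{V_1}$ generated by the sections of $\mathcal M$. **Theorem.** Let $\mathcal M\subseteq\mathcal O_V$ be an $\mathcal O_V^{q}$-submodule. 1. $\mathrm{Sing}(\mathcal M,1)=\{x\in V:\eta_x(\mathcal M)\ge q\}$. 2. Assume that $\mathrm{Sing}(\mathcal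 M,1)\ne\emptyset$, that $\eta_x(\mathcal M)$ has a finite maximum on $V$, written as $aq+b$ with $0\le b<q$, and that $Z$ is nonempty and $\eta_x(\mathcal M)=aq+b$ for all $x\in Z$. Then $a\ge1$ and: (a) $Z\subseteq\mathrm{Sing}(\mathcal M,1)$, so that $\mathcal M_1^{(1)}$ is the 1-transform of $\mathcal M$ by the blowup along the permissible center $Z$; (b) for each $1\le i<a$, $H_1\subseteq\mathrm{Sing}(\mathcal M_1^{(i)},1)$, the identity of $V_1$ is the blowup of $V_1$ along $H_1$, and $\mathcal M_1^{(i+1)}$ is the 1-transform of $\mathcal M_1^{(i)}$ by this blowup; (c) $H_1\not\subseteq\mathrm{Sing}(\mathcal M_1^{(a)},1)$. 3. For every regular closed subscheme $Z\subset V$ and every $a\ge1$ (in particular for those of part 2) there is a componentwise inclusion $\mathcal G(\mathcal M_1^{(a)})\subseteq(\mathcal G(\mathcal M))_1^{(a)}$. In particular $\eta_{x_1}(\mathcal M_1^{(a)})\ge\eta_{x_1}\big((\mathcal G(\mathcal M))_1^{(a)}\big)$ for all $x_1\in V_1$, whence $\{x_1\in V_1:\eta_{x_1}((\mathcal G(\mathcal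 M))_1^{(a)})\ge q\}\subseteq\mathrm{Sing}(\mathcal M_1^{(a)},1)$. -/

import Mathlib

open AlgebraicGeometry CategoryTheory TopologicalSpace
open scoped TensorProduct

universe u

noncomputable section

/-! ### Rings of `q`-th powers -/

/-- The subring `R^q` of `R` (generated by the `q`-th powers). If `R` has characteristic `p` and
`q = p ^ e`, it consists exactly of the `q`-th powers, see `mem_powSubring_iff`. -/
def powSubring (R : Type*) [CommRing R] (q : ℕ) : Subring R :=
  Subring.closure (Set.range fun x : R => x ^ q)

theorem pow_mem_powSubring {R : Type*} [CommRing R] (q : ℕ) (x : R) : x ^ q ∈ powSubring R q :=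
  Subring.subset_closure ⟨x, rfl⟩

theorem mem_powSubring_iff {R : Type*} [CommRing R] {p : ℕ} [hp : Fact p.Prime]
    (hR : (p : R) = 0) (e : ℕ) (r : R) : r ∈ powSubring R (p ^ e) ↔ ∃ x : R, x ^ p ^ e = r := by
  constructor
  · intro h
    rcases subsingleton_or_nontrivial R with _ | _
    · exact ⟨0, Subsingleton.elim _ _⟩
    have : CharP R p := (CharP.charP_iff_prime_eq_zero hp.out).mpr hR
    have : ExpChar R p := ExpChar.prime hp.out
    have hle : powSubring R (p ^ e) ≤ (iterateFrobenius R p e).range := by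
      refine Subring.closure_le.mpr ?_
      rintro _ ⟨x, rfl⟩
      exact ⟨x, rfl⟩
    obtain ⟨x, hx⟩ := hle h
    exact ⟨x, hx⟩
  · rintro ⟨x, rfl⟩
    exact pow_mem_powSubring _ x

theorem map_mem_powSubring {R S : Type*} [CommRing R] [CommRing S] (φ : R →+* S) (q : ℕ) {r : R}
    (hr : r ∈ powSubring R q) : φ r ∈ powSubring S q := by
  have hle : powSubring R q ≤ (powSubring S q).comap φ := by
    refine Subring.closure_le.mpr ?_
    rintro _ ⟨x, rfl⟩
    simpa using pow_mem_powSubring q (φ x)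
  exact hle hr

/-- The `S^q`-submodule `N S^q` of `S` spanned by the image of an `R^q`-submodule `N ⊆ R`. -/
def mapPow {R S : Type*} [CommRing R] [CommRing S] (φ : R →+* S) {q : ℕ}
    (N : Submodule (powSubring R q) R) : Submodule (powSubring S q) S :=
  Submodule.span (powSubring S q) (φ '' (N : Set R))

theorem mapPow_le_iff {R S : Type*} [CommRing R] [CommRing S] (φ : R →+* S) {q : ℕ}
    (N : Submodule (powSubring R q) R) (P : Submodule (powSubring S q) S) :
    mapPow φ N ≤ P ↔ ∀ r ∈ N, φ r ∈ P := by
  rw [mapPow, Submodule.span_le, Set.image_subset_iff]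
  rfl

theorem mapPow_span {R S : Type*} [CommRing R] [CommRing S] (φ : R →+* S) {q : ℕ} (s : Set R) :
    mapPow φ (Submodule.span (powSubring R q) s) = Submodule.span (powSubring S q) (φ '' s) := by
  apply le_antisymm
  · rw [mapPow_le_iff]
    intro r hr
    induction hr using Submodule.span_induction with
    | mem x hx => exact Submodule.subset_span ⟨x, hx, rfl⟩
    | zero => simp
    | add x y _ _ hx hy => rw [map_add]; exact add_mem hx hy
    | smul c x _ hx =>
      have h : φ (c • x) = (⟨φ c, map_mem_powSubring φ q c.2⟩ : powSubring S q) • φ x := by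
        simp [Subring.smul_def]
      rw [h]
      exact Submodule.smul_mem _ _ hx
  · exact Submodule.span_mono (Set.image_mono Submodule.subset_span)

theorem mapPow_iSup {R S : Type*} [CommRing R] [CommRing S] (φ : R →+* S) {q : ℕ} {ι : Type*}
    (N : ι → Submodule (powSubring R q) R) : mapPow φ (⨆ i, N i) = ⨆ i, mapPow φ (N i) := by
  rw [Submodule.iSup_eq_span, mapPow_span, Set.image_iUnion, Submodule.span_iUnion]
  rfl

/-! ### Differential operators of a ring -/

/-- `D ∈ Diff_{R/A}^i`: the `A`-linear map `D : R → R` is a differential operator of order at most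
`i`, i.e. its left `R`-linear extension `R ⊗ R → R`, `r₁ ⊗ r₂ ↦ r₁ * D r₂`, annihilates
`T_R ^ (i + 1)`, where `T_R = ⟨1 ⊗ r - r ⊗ 1 : r ∈ R⟩` is the kernel of the multiplication
`R ⊗ R → R` (tensor products over `A`). -/
def IsDiffOp (A : Type*) {R : Type*} [CommRing A] [CommRing R] [Algebra A R] (i : ℕ)
    (D : R →ₗ[A] R) : Prop :=
  ∀ t ∈ KaehlerDifferential.ideal A R ^ (i + 1),
    LinearMap.mul' A R (LinearMap.lTensor R D t) = 0

/-- The ideal of `R` generated by the `D m` with `m ∈ s` and `D ∈ Diff_{R/A,+}^i`, i.e.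
`D ∈ Diff_{R/A}^i` and `D 1 = 0`. -/
def diffPlusIdeal (A : Type*) {R : Type*} [CommRing A] [CommRing R] [Algebra A R] (i : ℕ)
    (s : Set R) : Ideal R :=
  Ideal.span {r | ∃ D : R →ₗ[A] R, IsDiffOp A i D ∧ D 1 = 0 ∧ ∃ m ∈ s, D m = r}

/-! ### Schemes -/

/-- A scheme is regular if all its local rings are regular. -/
class IsRegularScheme (X : Scheme.{u}) : Prop where
  stalk_regular : ∀ x : X, IsRegularLocalRing (X.presheaf.stalk x)

/-- `X` is a scheme of characteristic `p` (that is, `p = 0` on `X`) which is `F`-finite: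
`𝒪_X` is a finite `𝒪_X^p`-module. -/
class IsFFinite (X : Scheme.{u}) (p : ℕ) : Prop where
  char_eq_zero : (p : Γ(X, ⊤)) = 0
  finite : ∀ U : X.affineOpens, Module.Finite (powSubring Γ(X, U) p) Γ(X, U)

/-- A quasi-coherent `𝒪_X^q`-submodule of `𝒪_X`, given (in the same way as Mathlib's
`Scheme.IdealSheafData`) by a `Γ(X, U)^q`-submodule of `Γ(X, U)` for each affine open `U`, in a way
that is compatible with localization. -/
@[ext]
structure PowModule (X : Scheme.{u}) (q : ℕ) where
  /-- The sections over an affine open. -/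
  obj : ∀ U : X.affineOpens, Submodule (powSubring Γ(X, U) q) Γ(X, U)
  map_basicOpen : ∀ (U : X.affineOpens) (f : Γ(X, U)),
    mapPow (X.presheaf.map (homOfLE <| X.basicOpen_le f).op).hom (obj U) =
      obj (X.affineBasicOpen f)

namespace PowModule

variable {X : Scheme.{u}} {q : ℕ}

instance : PartialOrder (PowModule X q) := PartialOrder.lift obj fun _ _ h => PowModule.ext h

theorem le_def {M N : PowModule X q} : M ≤ N ↔ ∀ U, M.obj U ≤ N.obj U := Iff.rfl

instance : SupSet (PowModule X q) where
  sSup s :=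
    { obj := fun U => ⨆ M : s, M.1.obj U
      map_basicOpen := fun U f => by
        rw [mapPow_iSup]
        exact iSup_congr fun M => M.1.map_basicOpen U f }

/-- The quasi-coherent `𝒪_X^q`-submodules of `𝒪_X`, ordered by inclusion, form a complete lattice:
arbitrary suprema are computed on affine opens, and `sInf s` is the largest such submodule
contained in all members of `s`. -/
instance : CompleteLattice (PowModule X q) :=
  completeLatticeOfSup _ fun s =>
    ⟨fun M hM => le_def.mpr fun U => le_iSup (fun M : s => M.1.obj U) ⟨M, hM⟩,
      fun _ hN => le_def.mpr fun U => iSup_le fun M => le_def.mp (hN M.2) U⟩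

variable (X q) in
/-- The `𝒪_X^q`-submodule `𝒪_X^q` of `𝒪_X`. -/
def powers : PowModule X q where
  obj U := Submodule.span (powSubring Γ(X, U) q) {1}
  map_basicOpen U f := by
    rw [mapPow_span, Set.image_singleton, map_one]
    rfl

/-- The total transform `M 𝒪_Y^q` of `M` under `f : Y ⟶ X`: the (quasi-coherent)
`𝒪_Y^q`-submodule of `𝒪_Y` generated by the sections of `M`, viewed as sections on `Y`. -/
def totalTransform {Y : Scheme.{u}} (M : PowModule X q) (f : Y ⟶ X) : PowModule Y q :=
  sInf {N | ∀ (U : X.affineOpens) (W : Y.affineOpens) (h : W.1 ≤ f ⁻¹ᵁ U.1),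
    ∀ m ∈ M.obj U, (f.appLE U.1 W.1 h).hom m ∈ N.obj W}

/-- The conductor `(M : F^e L)`: the largest (quasi-coherent) `𝒪_X^q`-submodule `N ⊆ 𝒪_X` such that
`t ^ q * s ∈ M` for all local sections `t` of `L` and `s` of `N`. -/
def conductor (M : PowModule X q) (L : X.IdealSheafData) : PowModule X q :=
  sSup {N | ∀ U : X.affineOpens, ∀ t ∈ L.ideal U, ∀ s ∈ N.obj U, t ^ q * s ∈ M.obj U}

/-- For `f : Y ⟶ X` the blowup of `X` along the closed subscheme with ideal `I`, so that
`I.comap f = I 𝒪_Y` is the exceptional ideal: the `a`-transform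
`((M 𝒪_Y^q + 𝒪_Y^q) : F^e ((I 𝒪_Y) ^ a))` of `M`. -/
def transform {Y : Scheme.{u}} (M : PowModule X q) (f : Y ⟶ X) (I : X.IdealSheafData) (a : ℕ) :
    PowModule Y q :=
  (M.totalTransform f ⊔ powers Y q).conductor (I.comap f ^ a)

/-- The quasi-coherent ideal `Diff_{X,+}^i(M)` generated by the `D m`, with `m` a section of `M`
over an affine open `U` and `D ∈ Diff_{Γ(X, U),+}^i` (absolute differential operators, i.e. over
`ℤ`). -/
def diffPlus (M : PowModule X q) (i : ℕ) : X.IdealSheafData :=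
  sInf {J | ∀ U : X.affineOpens, diffPlusIdeal ℤ i (M.obj U : Set Γ(X, U)) ≤ J.ideal U}

/-- `Sing(M, 1)`, the closed set defined by the ideal `Diff_{X,+}^{q-1}(M)`. -/
def sing (M : PowModule X q) : Set X := (M.diffPlus (q - 1)).support

end PowModule

/-! ### Collections of ideals and their order functions -/

/-- The stalk at `x` of an ideal sheaf. -/
def stalkIdeal {X : Scheme.{u}} (I : X.IdealSheafData) (x : X) : Ideal (X.presheaf.stalk x) :=
  ⨆ (U : X.affineOpens) (hx : x ∈ U.1), (I.ideal U).map (X.presheaf.germ U.1 x hx).hom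

/-- The order `ν_x(I)` of an ideal sheaf at `x`: the largest `n` with `I_x ⊆ m_x ^ n` (or `∞`). -/
def idealOrder {X : Scheme.{u}} (I : X.IdealSheafData) (x : X) : ℕ∞ :=
  ⨆ (n : ℕ) (_ : stalkIdeal I x ≤ IsLocalRing.maximalIdeal (X.presheaf.stalk x) ^ n), (n : ℕ∞)

/-- For a collection `G = (G 1, …, G (q - 1))` of ideal sheaves (the other values of `G` play no
role), `η_x(G) = min {ν_x(G i) + i : 1 ≤ i ≤ q - 1}`. -/
def eta {X : Scheme.{u}} (q : ℕ) (G : ℕ → X.IdealSheafData) (x : X) : ℕ∞ :=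
  ⨅ i ∈ Finset.Ico 1 q, (idealOrder (G i) x + (i : ℕ∞))

/-- The conductor `(J : K)` of ideal sheaves: the largest (quasi-coherent) ideal sheaf `N` with
`N * K ⊆ J`. -/
def idealColon {X : Scheme.{u}} (J K : X.IdealSheafData) : X.IdealSheafData :=
  sSup {N | N * K ≤ J}

/-- For `f : Y ⟶ X` the blowup of `X` along the closed subscheme with ideal `I`: the `a`-transform
of a collection `G` of ideals, whose members are `(G i 𝒪_Y : (I 𝒪_Y) ^ (q a))`. -/
def collectionTransform {X Y : Scheme.{u}} (q : ℕ) (G : ℕ → X.IdealSheafData) (f : Y ⟶ X)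
    (I : X.IdealSheafData) (a : ℕ) : ℕ → Y.IdealSheafData :=
  fun i => idealColon ((G i).comap f) (I.comap f ^ (q * a))

/-! ### Blowups -/

/-- An ideal sheaf is invertible if it is locally generated by a nonzerodivisor. -/
def IsInvertibleIdeal {X : Scheme.{u}} (I : X.IdealSheafData) : Prop :=
  ∀ x : X, ∃ U : X.affineOpens, x ∈ U.1 ∧
    ∃ f ∈ nonZeroDivisors Γ(X, U), I.ideal U = Ideal.span {f}

/-- `f : Y ⟶ X` is the blowup of `X` along the closed subscheme with ideal `I`: the ideal `I 𝒪_Y` is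
invertible, and every `g : T ⟶ X` such that `I 𝒪_T` is invertible factors uniquely through `f`. -/
structure IsBlowup {X Y : Scheme.{u}} (f : Y ⟶ X) (I : X.IdealSheafData) : Prop where
  invertible : IsInvertibleIdeal (I.comap f)
  universal : ∀ {T : Scheme.{u}} (g : T ⟶ X), IsInvertibleIdeal (I.comap g) →
    ∃! h : T ⟶ Y, h ≫ f = g

end

/-!
The proof reduces everything to explicit differential calculus in coordinates. The local rings of an
`F`-finite regular scheme have finite `p`-bases, and for a regular closed subscheme `Z` such a basis
`w` can be chosen so that part of it generates the ideal of `Z`; it spreads out to an affine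
neighbourhood (`exists_isPowBasis_subscheme`). The monomials in `w` with exponents `< q` are then a
basis over the ring of `q`-th powers, and differential operators of order `< q`, being linear over
`q`-th powers, are combinations of the Hasse derivatives with respect to `w`. For such operators
extension to localizations and Taylor expansion modulo `q`-th powers are elementary
(`DiffLT.exists_localization`, `IsPowBasis.mem_span_pow_of_hasse`). In particular `Diff_+^i`, `i < q`,
is computed on affine opens (`PowModule.ideal_diffPlus`), and so are the transforms
(`PowModule.mem_transform_iff`).

The description of the singular locus (`PowModule.sing_eq`) follows since applying an operator of
order `q - 1 - i` to `Diff_+^i(M)` lands in `Diff_+^{q-1}(M)`: if the latter vanishes at `x`, then so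
do all derivatives of order `≤ q - 1 - i` of `Diff_+^i(M)`, which therefore has order `≥ q - i` at `x`
by Taylor expansion.

The inclusion of the differential ideals of the `a`-transform in the `a`-transforms of the
differential ideals (`diffPlus_transform_le`) holds since an operator `D` on the blowup, restricted to
sections of `V`, is an operator along the pullback `𝒪_V → 𝒪_{V₁}`. Being of order `< q`, it is an
`𝒪_{V₁}`-combination of the Hasse derivatives on `V`, so that it maps the sections of `M` into
`Diff_+^i(M) 𝒪_{V₁}` (`DiffLT.map_mem_map_diffPlusIdeal`); and `D` commutes with multiplication by
the `q`-th power of the equation of the exceptional divisor.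

If the order of `M` along `Z` is at least `N`, then `Diff_+^j(M) ⊆ I(Z)^(N - j)`
(`diffPlus_le_pow`). For `(i + 1) q ≤ N` this shows that the `i`-transform still has order `≥ q`
along the exceptional divisor (`le_eta_collectionTransform`), which makes it a permissible center
for a further, trivial, blowup; two successive conductors combine to one
(`PowModule.transform_succ`).

To see that this stops after `a` steps if `N = a q + b` with `b < q`, one works on the chart of the
blowup on which a basis element `t = w_j` generates the exceptional ideal. Its ring has the `p`-basis
consisting of `t`, of the `w_i / t` for the other generators `w_i` of the center, and of the remaining
basis elements (`IsPowBasis.blowupChart`); that it is an open subscheme of any scheme with the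
universal property of the blowup is `exists_affineOpens_chart`. An element whose `Diff_+^{q-1}` lies
in `(t)` is a `q`-th power modulo `t^q` (`IsPowBasis.exists_pow_add_of_diff_mem`). Hence, if the
`a`-transform were singular along the exceptional divisor, then each section `f` of `M` would be of the
form `G^q + t^((a+1)q) k` (`exists_eq_pow_add_of_le_sing`). Clearing denominators, `Diff_+^j f` would
lie in `I(Z)^((a+1)q - j)` for all `j`, that is, the order of `M` along `Z` would be at least
`(a + 1) q` (`not_le_sing_transform`).
-/

/-! ### Differential operators along a ring homomorphism -/

section DiffLT

variable {A B C : Type*} [CommRing A] [CommRing B] [CommRing C]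

/-- The commutator `b ↦ δ (a * b) - φ a * δ b` of an additive map `δ : A → B` with multiplication
by `a`, where `B` is an `A`-module via `φ`. -/
def diffComm (φ : A →+* B) (δ : A →+ B) (a : A) : A →+ B :=
  δ.comp (AddMonoidHom.mulLeft a) - (AddMonoidHom.mulLeft (φ a)).comp δ

@[simp]
theorem diffComm_apply (φ : A →+* B) (δ : A →+ B) (a b : A) :
    diffComm φ δ a b = δ (a * b) - φ a * δ b := rfl

/-- `δ : A → B` is an absolute differential operator of order `< n` along `φ : A → B`, in
Grothendieck's inductive sense. Counting with a strict inequality makes `0` the only operator at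
the bottom level, so that inductions on `n` start trivially. -/
def DiffLT (φ : A →+* B) : ℕ → (A →+ B) → Prop
  | 0, δ => δ = 0
  | n + 1, δ => ∀ a, DiffLT φ n (diffComm φ δ a)

variable {φ : A →+* B}

theorem DiffLT.zero (n : ℕ) : DiffLT φ n 0 := by
  induction n with
  | zero => rfl
  | succ n ih =>
    intro a
    have : diffComm φ 0 a = 0 := by ext; simp
    rwa [this]

theorem DiffLT.succ {n : ℕ} {δ : A →+ B} (h : DiffLT φ n δ) : DiffLT φ (n + 1) δ := by
  induction n generalizing δ with
  | zero =>
    rw [show δ = 0 from h]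
    exact DiffLT.zero 1
  | succ n ih => exact fun a => ih (h a)

theorem DiffLT.mono {n m : ℕ} (hnm : n ≤ m) {δ : A →+ B} (h : DiffLT φ n δ) : DiffLT φ m δ := by
  induction hnm with
  | refl => exact h
  | step _ ih => exact ih.succ

theorem DiffLT.add {n : ℕ} {δ δ' : A →+ B} (h : DiffLT φ n δ) (h' : DiffLT φ n δ') :
    DiffLT φ n (δ + δ') := by
  induction n generalizing δ δ' with
  | zero => rw [show δ = 0 from h, show δ' = 0 from h', add_zero]; exact DiffLT.zero 0
  | succ n ih =>
    intro a
    have : diffComm φ (δ + δ') a = diffComm φ δ a + diffComm φ δ' a := by ext; simp; ring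
    rw [this]
    exact ih (h a) (h' a)

theorem DiffLT.mul_left {n : ℕ} {δ : A →+ B} (h : DiffLT φ n δ) (b : B) :
    DiffLT φ n ((AddMonoidHom.mulLeft b).comp δ) := by
  induction n generalizing δ with
  | zero => rw [show δ = 0 from h, AddMonoidHom.comp_zero]; exact DiffLT.zero 0
  | succ n ih =>
    intro a
    have : diffComm φ ((AddMonoidHom.mulLeft b).comp δ) a =
        (AddMonoidHom.mulLeft b).comp (diffComm φ δ a) := by ext; simp; ring
    rw [this]
    exact ih (h a)

theorem DiffLT.neg {n : ℕ} {δ : A →+ B} (h : DiffLT φ n δ) : DiffLT φ n (-δ) := by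
  have : -δ = (AddMonoidHom.mulLeft (-1)).comp δ := by ext; simp
  rw [this]
  exact h.mul_left _

theorem DiffLT.sub {n : ℕ} {δ δ' : A →+ B} (h : DiffLT φ n δ) (h' : DiffLT φ n δ') :
    DiffLT φ n (δ - δ') := by
  rw [sub_eq_add_neg]
  exact h.add h'.neg

theorem DiffLT.sum {n : ℕ} {ι : Type*} (s : Finset ι) {δ : ι → A →+ B}
    (h : ∀ i ∈ s, DiffLT φ n (δ i)) : DiffLT φ n (∑ i ∈ s, δ i) :=
  Finset.sum_induction δ (DiffLT φ n) (fun _ _ => DiffLT.add) (DiffLT.zero n) h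

theorem DiffLT.mul_right {n : ℕ} {δ : A →+ B} (h : DiffLT φ n δ) (b : A) :
    DiffLT φ n (δ.comp (AddMonoidHom.mulLeft b)) := by
  induction n generalizing δ with
  | zero => rw [show δ = 0 from h, AddMonoidHom.zero_comp]; exact DiffLT.zero 0
  | succ n ih =>
    intro a
    have : diffComm φ (δ.comp (AddMonoidHom.mulLeft b)) a =
        (diffComm φ δ a).comp (AddMonoidHom.mulLeft b) := by
      ext c; simp only [diffComm_apply, AddMonoidHom.comp_apply, AddMonoidHom.coe_mulLeft]; ring_nf
    rw [this]
    exact ih (h a)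

theorem DiffLT.comp_ringHom {n : ℕ} {ψ : B →+* C} {δ : B →+ C} (h : DiffLT ψ n δ) :
    DiffLT (ψ.comp φ) n (δ.comp φ.toAddMonoidHom) := by
  induction n generalizing δ with
  | zero => rw [show δ = 0 from h, AddMonoidHom.zero_comp]; exact DiffLT.zero 0
  | succ n ih =>
    intro a
    have : diffComm (ψ.comp φ) (δ.comp φ.toAddMonoidHom) a =
        (diffComm ψ δ (φ a)).comp φ.toAddMonoidHom := by ext; simp
    rw [this]
    exact ih (h (φ a))

theorem DiffLT.ringHom_comp {n : ℕ} {ψ : B →+* C} {δ : A →+ B} (h : DiffLT φ n δ) :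
    DiffLT (ψ.comp φ) n (ψ.toAddMonoidHom.comp δ) := by
  induction n generalizing δ with
  | zero => rw [show δ = 0 from h, AddMonoidHom.comp_zero]; exact DiffLT.zero 0
  | succ n ih =>
    intro a
    have : diffComm (ψ.comp φ) (ψ.toAddMonoidHom.comp δ) a =
        ψ.toAddMonoidHom.comp (diffComm φ δ a) := by ext; simp
    rw [this]
    exact ih (h a)

theorem DiffLT.id : DiffLT (RingHom.id A) 1 (AddMonoidHom.id A) := by
  intro a
  refine AddMonoidHom.ext fun b => ?_
  simp

theorem DiffLT.comp {n m : ℕ} {δ : A →+ B} {D : B →+ B} (hD : DiffLT (RingHom.id B) (m + 1) D)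
    (h : DiffLT φ (n + 1) δ) : DiffLT φ (n + m + 1) (D.comp δ) := by
  have key : ∀ N n m : ℕ, n + m = N → ∀ (δ : A →+ B) (D : B →+ B),
      DiffLT (RingHom.id B) m D → DiffLT φ n δ → DiffLT φ (n + m - 1) (D.comp δ) := by
    intro N
    induction N with
    | zero =>
      intro n m hnm δ D hD h
      obtain ⟨rfl, rfl⟩ : n = 0 ∧ m = 0 := by omega
      rw [show D = 0 from hD, AddMonoidHom.zero_comp]
      exact DiffLT.zero _
    | succ N ih =>
      intro n m hnm δ D hD h
      rcases n with _ | n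
      · rw [show δ = 0 from h, AddMonoidHom.comp_zero]; exact DiffLT.zero _
      rcases m with _ | m
      · rw [show D = 0 from hD, AddMonoidHom.zero_comp]; exact DiffLT.zero _
      rw [show n + 1 + (m + 1) - 1 = (n + m) + 1 by omega]
      intro a
      have : diffComm φ (D.comp δ) a =
          D.comp (diffComm φ δ a) + (diffComm (RingHom.id B) D (φ a)).comp δ := by ext; simp
      rw [this]
      refine DiffLT.add ?_ ?_
      · exact (ih n (m + 1) (by omega) _ _ hD (h a)).mono (by omega)
      · exact (ih (n + 1) m (by omega) _ _ (hD (φ a)) h).mono (by omega)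
  exact (key _ _ _ rfl δ D hD h).mono (by omega)

/-- An operator has order `≤ n` as soon as its commutators with ring generators have order `< n`,
since `[δ, a * b] = [δ, a] ∘ b + a * [δ, b]`. -/
theorem DiffLT.of_closure {n : ℕ} {δ : A →+ B} {s : Set A} (hs : Subring.closure s = ⊤)
    (h : ∀ a ∈ s, DiffLT φ n (diffComm φ δ a)) : DiffLT φ (n + 1) δ := by
  intro a
  have ha : a ∈ Subring.closure s := hs ▸ Subring.mem_top a
  induction ha using Subring.closure_induction with
  | mem x hx => exact h x hx
  | zero =>
    have : diffComm φ δ 0 = 0 := by ext; simp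
    rw [this]; exact DiffLT.zero n
  | one =>
    have : diffComm φ δ 1 = 0 := by ext; simp
    rw [this]; exact DiffLT.zero n
  | add x y _ _ hx hy =>
    have : diffComm φ δ (x + y) = diffComm φ δ x + diffComm φ δ y := by
      ext; simp [add_mul]; ring
    rw [this]; exact hx.add hy
  | neg x _ hx =>
    have : diffComm φ δ (-x) = - diffComm φ δ x := by ext; simp; ring
    rw [this]; exact hx.neg
  | mul x y _ _ hx hy =>
    have : diffComm φ δ (x * y) = (diffComm φ δ x).comp (AddMonoidHom.mulLeft y) +
        (AddMonoidHom.mulLeft (φ x)).comp (diffComm φ δ y) := by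
      ext c
      simp only [diffComm_apply, AddMonoidHom.add_apply, AddMonoidHom.comp_apply,
        AddMonoidHom.coe_mulLeft, map_mul, mul_assoc]
      ring
    rw [this]; exact (hx.mul_right y).add (hy.mul_left _)

/-- Operators of order `< q = p ^ e` are linear over `q`-th powers: the `q`-fold commutator with
`a` is the commutator with `a ^ q` in characteristic `p`. -/
theorem DiffLT.map_pow_mul {p e : ℕ} [hp : Fact p.Prime] (hB : (p : B) = 0) {n : ℕ}
    (hn : n ≤ p ^ e) {δ : A →+ B} (h : DiffLT φ n δ) (a b : A) :
    δ (a ^ p ^ e * b) = φ a ^ p ^ e * δ b := by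
  let Ra : Module.End ℤ (A →+ B) := AddMonoidHom.toIntLinearMap
    { toFun := fun δ => δ.comp (AddMonoidHom.mulLeft a)
      map_zero' := by ext; simp
      map_add' := fun _ _ => by ext; simp }
  let La : Module.End ℤ (A →+ B) := AddMonoidHom.toIntLinearMap
    { toFun := fun δ => (AddMonoidHom.mulLeft (φ a)).comp δ
      map_zero' := by ext; simp
      map_add' := fun _ _ => by ext; simp [mul_add] }
  have hR : ∀ δ : A →+ B, Ra δ = δ.comp (AddMonoidHom.mulLeft a) := fun _ => rfl
  have hL : ∀ δ : A →+ B, La δ = (AddMonoidHom.mulLeft (φ a)).comp δ := fun _ => rfl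
  have hpS : (p : Module.End ℤ (A →+ B)) = 0 := by
    refine LinearMap.ext fun δ => AddMonoidHom.ext fun c => ?_
    have : ((p : Module.End ℤ (A →+ B)) δ) c = (p : B) * δ c := by
      simp [Module.End.natCast_apply]
    rw [this, hB, zero_mul]; rfl
  have hcomm : Commute Ra La := by
    refine LinearMap.ext fun δ => AddMonoidHom.ext fun c => ?_
    simp only [Module.End.mul_apply, hR, hL]
    simp
  have hzero : ∀ n, ∀ δ : A →+ B, DiffLT φ n δ → ((Ra - La) ^ n) δ = 0 := by
    intro n
    induction n with
    | zero =>
      intro δ h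
      rw [show δ = 0 from h, map_zero]
    | succ n ih =>
      intro δ h
      rw [pow_succ, Module.End.mul_apply]
      exact ih _ (h a)
  have hRp : ∀ n, ∀ δ : A →+ B, ∀ c, ((Ra ^ n) δ) c = δ (a ^ n * c) := by
    intro n
    induction n with
    | zero => intro δ c; simp [Module.End.one_apply]
    | succ n ih =>
      intro δ c
      rw [pow_succ, Module.End.mul_apply, ih, hR]
      simp [pow_succ', mul_assoc]
  have hLp : ∀ n, ∀ δ : A →+ B, ∀ c, ((La ^ n) δ) c = φ a ^ n * δ c := by
    intro n
    induction n with
    | zero => intro δ c; simp [Module.End.one_apply]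
    | succ n ih =>
      intro δ c
      rw [pow_succ, Module.End.mul_apply, ih, hL]
      simp [pow_succ, mul_assoc]
  have hfrob : (Ra - La) ^ p ^ e = Ra ^ p ^ e - La ^ p ^ e := by
    rcases subsingleton_or_nontrivial (Module.End ℤ (A →+ B)) with _ | _
    · exact Subsingleton.elim _ _
    have : CharP (Module.End ℤ (A →+ B)) p := (CharP.charP_iff_prime_eq_zero hp.out).mpr hpS
    exact sub_pow_char_pow_of_commute p e hcomm
  have h0 := hzero _ _ (h.mono hn)
  rw [hfrob] at h0
  have := DFunLike.congr_fun h0 b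
  rw [LinearMap.sub_apply, AddMonoidHom.sub_apply, hRp, hLp] at this
  exact sub_eq_zero.mp this

/-- An operator of order `≤ i` maps `I ^ (n + i)` into the `n`-th power of the extension of `I`. -/
theorem DiffLT.map_mem_pow {i : ℕ} {δ : A →+ B} (h : DiffLT φ (i + 1) δ) (I : Ideal A) {n : ℕ}
    {a : A} (ha : a ∈ I ^ (n + i)) : δ a ∈ I.map φ ^ n := by
  have key : ∀ N i n : ℕ, n + i = N → ∀ δ : A →+ B, DiffLT φ i δ → ∀ a ∈ I ^ (n + i - 1),
      δ a ∈ I.map φ ^ n := by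
    intro N
    induction N with
    | zero =>
      intro i n hN δ h a _
      obtain ⟨rfl, rfl⟩ : n = 0 ∧ i = 0 := by omega
      simp
    | succ N ih =>
      intro i n hN δ h a ha
      rcases i with _ | i
      · rw [show δ = 0 from h]; simp
      rcases n with _ | n
      · simp
      rw [show n + 1 + (i + 1) - 1 = (n + i) + 1 by omega, pow_succ'] at ha
      refine Submodule.mul_induction_on ha (fun x hx y hy => ?_)
        (fun x y hx hy => by rw [map_add]; exact add_mem hx hy)
      have : δ (x * y) = φ x * δ y + diffComm φ δ x y := by simp
      rw [this]
      refine add_mem ?_ ?_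
      · rw [pow_succ']
        refine Ideal.mul_mem_mul (Ideal.mem_map_of_mem _ hx) ?_
        exact ih (i + 1) n (by omega) δ h y (by rwa [show n + (i + 1) - 1 = n + i by omega])
      · exact ih i (n + 1) (by omega) _ (h x) y (by rwa [show n + 1 + i - 1 = n + i by omega])
  exact key _ (i + 1) n rfl δ h a (by rwa [show n + (i + 1) - 1 = n + i by omega])

/-- The description of differential operators by vanishing on powers of the kernel of the
multiplication `A ⊗ A → A` agrees with the inductive one by commutators. -/
theorem isDiffOp_iff_diffLT (i : ℕ) (D : A →ₗ[ℤ] A) :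
    IsDiffOp ℤ i D ↔ DiffLT (RingHom.id A) (i + 1) D.toAddMonoidHom := by
  have key : ∀ n, ∀ D : A →ₗ[ℤ] A,
      (∀ t ∈ KaehlerDifferential.ideal ℤ A ^ n,
        LinearMap.mul' ℤ A (LinearMap.lTensor A D t) = 0) ↔
      DiffLT (RingHom.id A) n D.toAddMonoidHom := by
    intro n
    induction n with
    | zero =>
      intro D
      constructor
      · intro h
        refine AddMonoidHom.ext fun a => ?_
        simpa using h (1 ⊗ₜ a) (by simp)
      · intro h t _
        have : D = 0 := by
          ext a
          exact DFunLike.congr_fun (show D.toAddMonoidHom = 0 from h) a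
        simp [this]
    | succ n ih =>
      intro D
      have hmul : ∀ (r : A) (t : A ⊗[ℤ] A),
          LinearMap.mul' ℤ A (LinearMap.lTensor A D
            (((1 : A) ⊗ₜ[ℤ] r - r ⊗ₜ[ℤ] (1 : A)) * t)) =
          LinearMap.mul' ℤ A (LinearMap.lTensor A
            (diffComm (RingHom.id A) D.toAddMonoidHom r).toIntLinearMap t) := by
        intro r t
        induction t using TensorProduct.induction_on with
        | zero => simp
        | tmul x y =>
          simp [sub_mul, mul_sub]
          ring
        | add x y hx hy => rw [mul_add, map_add, map_add, hx, hy, map_add, map_add]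
      constructor
      · intro h r
        refine (ih (diffComm (RingHom.id A) D.toAddMonoidHom r).toIntLinearMap).mp fun t ht => ?_
        rw [← hmul]
        refine h _ ?_
        rw [pow_succ']
        exact Ideal.mul_mem_mul (KaehlerDifferential.one_smul_sub_smul_one_mem_ideal ℤ r) ht
      · intro h t ht
        rw [pow_succ'] at ht
        refine Submodule.smul_induction_on (p := fun t => LinearMap.mul' ℤ A
          (LinearMap.lTensor A D t) = 0) ht ?_ ?_
        · intro x hx
          rw [← KaehlerDifferential.span_range_eq_ideal] at hx
          refine Submodule.span_induction (p := fun x _ =>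
            ∀ y ∈ KaehlerDifferential.ideal ℤ A ^ n, LinearMap.mul' ℤ A
              (LinearMap.lTensor A D (x • y)) = 0) ?_ ?_ ?_ ?_ hx
          · rintro _ ⟨r, rfl⟩ y hy
            rw [smul_eq_mul, hmul]
            exact (ih (diffComm (RingHom.id A) D.toAddMonoidHom r).toIntLinearMap).mpr (h r) y hy
          · intro y _; simp
          · intro x x' _ _ hx hx' y hy
            rw [add_smul, map_add, map_add, hx y hy, hx' y hy, add_zero]
          · intro c x _ hx y hy
            rw [smul_assoc, ← smul_comm]
            exact hx _ (Ideal.mul_mem_left _ c hy)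
        · intro x y hx hy
          rw [map_add, map_add, hx, hy, add_zero]
  exact key (i + 1) D

theorem mem_diffPlusIdeal {i : ℕ} {s : Set A} {D : A →+ A} (hD : DiffLT (RingHom.id A) (i + 1) D)
    (h1 : D 1 = 0) {m : A} (hm : m ∈ s) : D m ∈ diffPlusIdeal ℤ i s :=
  Ideal.subset_span ⟨D.toIntLinearMap, (isDiffOp_iff_diffLT i _).mpr hD, h1, m, hm, rfl⟩

theorem diffPlusIdeal_le_iff {i : ℕ} {s : Set A} {I : Ideal A} :
    diffPlusIdeal ℤ i s ≤ I ↔ ∀ D : A →+ A, DiffLT (RingHom.id A) (i + 1) D → D 1 = 0 →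
      ∀ m ∈ s, D m ∈ I := by
  rw [diffPlusIdeal, Ideal.span_le]
  constructor
  · intro h D hD h1 m hm
    exact h ⟨D.toIntLinearMap, (isDiffOp_iff_diffLT i _).mpr hD, h1, m, hm, rfl⟩
  · rintro h _ ⟨D, hD, h1, m, hm, rfl⟩
    exact h D.toAddMonoidHom ((isDiffOp_iff_diffLT i D).mp hD) h1 m hm

/-- Applying an operator of order `≤ j` to the ideal `Diff_+^i` lands in `Diff_+^(i + j)`. -/
theorem DiffLT.map_diffPlusIdeal {i j : ℕ} {s : Set A} {D : A →+ A}
    (hD : DiffLT (RingHom.id A) (j + 1) D) {a : A} (ha : a ∈ diffPlusIdeal ℤ i s) :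
    D a ∈ diffPlusIdeal ℤ (i + j) s := by
  refine Submodule.span_induction (p := fun a _ => ∀ D : A →+ A,
    DiffLT (RingHom.id A) (j + 1) D → D a ∈ diffPlusIdeal ℤ (i + j) s) ?_ ?_ ?_ ?_ ha D hD
  · rintro _ ⟨E, hE, h1, m, hm, rfl⟩ D hD
    refine mem_diffPlusIdeal (D := D.comp E.toAddMonoidHom)
      (hD.comp ((isDiffOp_iff_diffLT i E).mp hE)) ?_ hm
    simp [h1]
  · intro D _; simp
  · intro x y _ _ hx hy D hD
    rw [map_add]; exact add_mem (hx D hD) (hy D hD)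
  · intro c x _ hx D hD
    exact hx _ (hD.mul_right c)

theorem diffPlusIdeal_zero (s : Set A) : diffPlusIdeal ℤ 0 s = ⊥ := by
  rw [eq_bot_iff, diffPlusIdeal_le_iff]
  intro D hD h1 m _
  have := DFunLike.congr_fun (hD m) 1
  simpa [h1] using this

end DiffLT

/-! ### Bases of monomials over the ring of `q`-th powers -/

theorem natCast_eq_of_modEq {A : Type*} [CommRing A] {p : ℕ} (hA : (p : A) = 0) {m n : ℕ}
    (h : m ≡ n [MOD p]) : (m : A) = n := by
  rw [← Nat.div_add_mod m p, ← Nat.div_add_mod n p, show m % p = n % p from h]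
  simp [hA]

section FrobPow

variable {A : Type*} [CommRing A] {p : ℕ} [hp : Fact p.Prime]

/-- The ring endomorphism `x ↦ x ^ p ^ e` of a ring in which the prime `p` vanishes; unlike
`iterateFrobenius` it makes sense for the zero ring as well. -/
def frobPow (p e : ℕ) [hp : Fact p.Prime] (hA : (p : A) = 0) : A →+* A where
  toFun x := x ^ p ^ e
  map_one' := one_pow _
  map_mul' := fun x y => mul_pow x y _
  map_zero' := zero_pow (pow_ne_zero _ hp.out.ne_zero)
  map_add' := fun x y => by
    rcases subsingleton_or_nontrivial A with _ | _
    · exact Subsingleton.elim _ _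
    have : CharP A p := (CharP.charP_iff_prime_eq_zero hp.out).mpr hA
    exact add_pow_char_pow x y p e

@[simp]
theorem frobPow_apply (e : ℕ) (hA : (p : A) = 0) (x : A) : frobPow p e hA x = x ^ p ^ e := rfl

theorem natCast_pow_prime_pow (hA : (p : A) = 0) (e m : ℕ) : (m : A) ^ p ^ e = m :=
  map_natCast (frobPow p e hA) m

theorem isUnit_natCast_of_not_dvd (hA : (p : A) = 0) {m : ℕ} (h : ¬ p ∣ m) :
    IsUnit (m : A) := by
  have hc : IsCoprime (m : ℤ) (p : ℤ) :=
    Nat.isCoprime_iff_coprime.mpr (((Nat.Prime.coprime_iff_not_dvd hp.out).mpr h).symm)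
  obtain ⟨a, b, hab⟩ := hc
  refine IsUnit.of_mul_eq_one (a : A) ?_
  have := congrArg (Int.cast : ℤ → A) hab
  push_cast at this
  rw [hA, mul_zero, add_zero] at this
  rw [mul_comm]; exact this

theorem choose_modEq_choose_mod_pow (e : ℕ) : ∀ n k : ℕ, k < p ^ e →
    n.choose k ≡ (n % p ^ e).choose k [MOD p] := by
  induction e with
  | zero =>
    intro n k hk
    obtain rfl : k = 0 := by simpa using hk
    simp [Nat.ModEq.refl]
  | succ e ih =>
    intro n k hk
    have h1 := Choose.choose_modEq_choose_mod_mul_choose_div_nat (n := n) (k := k) (p := p)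
    have h2 := Choose.choose_modEq_choose_mod_mul_choose_div_nat
      (n := n % p ^ (e + 1)) (k := k) (p := p)
    have h3 : n % p ^ (e + 1) % p = n % p := by
      rw [pow_succ', Nat.mod_mul_right_mod]
    have h4 : n % p ^ (e + 1) / p = n / p % p ^ e := by
      rw [pow_succ', Nat.mod_mul_right_div_self]
    rw [h3, h4] at h2
    refine h1.trans ((Nat.ModEq.mul_left _ (ih (n / p) (k / p) ?_)).trans h2.symm)
    rw [Nat.div_lt_iff_lt_mul hp.out.pos, ← pow_succ]
    exact hk

theorem choose_prime_pow_modEq (k : ℕ) : ∀ n : ℕ, n.choose (p ^ k) ≡ n / p ^ k [MOD p] := by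
  induction k with
  | zero => intro n; simp [Nat.ModEq.refl]
  | succ k ih =>
    intro n
    have h1 := Choose.choose_modEq_choose_mod_mul_choose_div_nat
      (n := n) (k := p ^ (k + 1)) (p := p)
    have h2 : p ^ (k + 1) % p = 0 := by rw [pow_succ, Nat.mul_mod_left]
    have h3 : p ^ (k + 1) / p = p ^ k := by rw [pow_succ, Nat.mul_div_cancel _ hp.out.pos]
    rw [h2, h3, Nat.choose_zero_right, one_mul] at h1
    refine h1.trans ((ih (n / p)).trans ?_)
    rw [Nat.div_div_eq_div_mul, ← pow_succ']

/-- The top `p`-adic digit of `n` is, modulo `p`, the binomial coefficient of `n` over the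
corresponding power of `p`. -/
theorem not_dvd_choose_prime_pow_log {n : ℕ} (hn : n ≠ 0) : ¬ p ∣ n.choose (p ^ Nat.log p n) := by
  rw [(choose_prime_pow_modEq (Nat.log p n) n).dvd_iff dvd_rfl]
  have h1 : p ^ Nat.log p n ≤ n := Nat.pow_log_le_self p hn
  have h2 : n < p ^ (Nat.log p n + 1) := Nat.lt_pow_succ_log_self hp.out.one_lt n
  have hpos : 0 < p ^ Nat.log p n := pow_pos hp.out.pos _
  refine Nat.not_dvd_of_pos_of_lt (Nat.div_pos h1 hpos) ?_
  rw [Nat.div_lt_iff_lt_mul hpos, ← pow_succ']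
  exact h2

end FrobPow

section PowBasis

variable {A B : Type*} [CommRing A] [CommRing B] {ι : Type*} [Fintype ι] [DecidableEq ι]

/-- The expansion `∑ c_γ ^ q * w ^ γ` over the monomials `w ^ γ` with all exponents less than
`q`. -/
def powExpand (q : ℕ) (w : ι → A) (c : (ι → Fin q) → A) : A :=
  ∑ γ, c γ ^ q * ∏ i, w i ^ (γ i : ℕ)

/-- The monomials `w ^ γ` with exponents less than `q` form a basis of `A` over `A ^ q`, and
taking `q`-th powers is injective. For `q = p` this is a (finite) `p`-basis of `A`. Coefficients
are recorded by their `q`-th roots, which avoids the subring of `q`-th powers. -/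
def IsPowBasis (q : ℕ) (w : ι → A) : Prop :=
  Function.Bijective (powExpand q w)

theorem powExpand_map (φ : A →+* B) (q : ℕ) (w : ι → A) (c : (ι → Fin q) → A) :
    powExpand q (φ ∘ w) (φ ∘ c) = φ (powExpand q w c) := by
  simp [powExpand, map_sum, map_mul, map_prod, map_pow]

theorem pow_mul_powExpand (q : ℕ) (w : ι → A) (a : A) (c : (ι → Fin q) → A) :
    a ^ q * powExpand q w c = powExpand q w (fun γ => a * c γ) := by
  simp [powExpand, Finset.mul_sum, mul_pow, mul_assoc]

theorem powExpand_single {q : ℕ} (hq : q ≠ 0) (w : ι → A) (γ : ι → Fin q)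
    (a : A) : powExpand q w (Pi.single γ a) = a ^ q * ∏ i, w i ^ (γ i : ℕ) := by
  rw [powExpand, Finset.sum_eq_single γ]
  · simp
  · intro δ _ hδ
    rw [Pi.single_eq_of_ne hδ, zero_pow hq, zero_mul]
  · simp

theorem powExpand_sum {p e : ℕ} [hp : Fact p.Prime] (hA : (p : A) = 0) (w : ι → A) {κ : Type*}
    (s : Finset κ) (c : κ → (ι → Fin (p ^ e)) → A) :
    powExpand (p ^ e) w (∑ k ∈ s, c k) = ∑ k ∈ s, powExpand (p ^ e) w (c k) := by
  simp only [powExpand]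
  rw [Finset.sum_comm]
  refine Finset.sum_congr rfl fun γ _ => ?_
  rw [Finset.sum_apply, ← frobPow_apply e hA, map_sum, Finset.sum_mul]
  rfl

theorem powExpand_add {p e : ℕ} [hp : Fact p.Prime] (hA : (p : A) = 0) (w : ι → A)
    (c d : (ι → Fin (p ^ e)) → A) :
    powExpand (p ^ e) w (c + d) = powExpand (p ^ e) w c + powExpand (p ^ e) w d := by
  simpa [Fin.sum_univ_two] using powExpand_sum hA w (Finset.univ : Finset (Fin 2)) ![c, d]

theorem powExpand_zero {q : ℕ} (hq : q ≠ 0) (w : ι → A) : powExpand q w 0 = 0 := by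
  simp [powExpand, hq]

theorem powExpand_sub {p e : ℕ} [hp : Fact p.Prime] (hA : (p : A) = 0) (w : ι → A)
    (c d : (ι → Fin (p ^ e)) → A) :
    powExpand (p ^ e) w (c - d) = powExpand (p ^ e) w c - powExpand (p ^ e) w d := by
  rw [eq_sub_iff_add_eq, ← powExpand_add hA, sub_add_cancel]

theorem powExpand_injective_iff {p e : ℕ} [hp : Fact p.Prime] (hA : (p : A) = 0) (w : ι → A) :
    Function.Injective (powExpand (p ^ e) w) ↔ ∀ c, powExpand (p ^ e) w c = 0 → c = 0 := by
  constructor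
  · intro h c hc
    exact h (hc.trans (powExpand_zero (pow_ne_zero _ hp.out.ne_zero) w).symm)
  · intro h c d hcd
    rw [← sub_eq_zero]
    refine h _ ?_
    rw [powExpand_sub hA, hcd, sub_self]

/-- The elements with an expansion in monomials form an `A ^ q`-submodule. -/
theorem sum_mem_range_powExpand {p e : ℕ} [hp : Fact p.Prime] (hA : (p : A) = 0) (w : ι → A)
    {κ : Type*} (s : Finset κ) (c g : κ → A) (hg : ∀ k ∈ s, g k ∈ Set.range (powExpand (p ^ e) w)) :
    ∑ k ∈ s, c k ^ p ^ e * g k ∈ Set.range (powExpand (p ^ e) w) := by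
  choose! d hd using hg
  refine ⟨∑ k ∈ s, fun γ => c k * d k γ, ?_⟩
  rw [powExpand_sum hA]
  refine Finset.sum_congr rfl fun k hk => ?_
  rw [← pow_mul_powExpand, hd k hk]

/-- Multiplying the members of a basis by `q`-th powers of units gives a basis. -/
theorem IsPowBasis.mul_units {q : ℕ} {w : ι → A} (h : IsPowBasis q w) (u : Aˣ) :
    IsPowBasis q (fun i => (u : A) ^ q * w i) := by
  have hΦ : powExpand q (fun i => (u : A) ^ q * w i) =
      powExpand q w ∘ fun c γ => (u : A) ^ (∑ i, (γ i : ℕ)) * c γ := by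
    funext c
    refine Finset.sum_congr rfl fun γ _ => ?_
    simp only [mul_pow, Finset.prod_mul_distrib, ← pow_mul, Finset.prod_pow_eq_pow_sum]
    rw [← Finset.mul_sum, mul_comm q]
    ring
  rw [IsPowBasis, hΦ]
  refine h.comp ⟨fun c d hcd => funext fun γ => ?_, fun c =>
    ⟨fun γ => ((u⁻¹ : Aˣ) : A) ^ (∑ i, (γ i : ℕ)) * c γ, funext fun γ => ?_⟩⟩
  · exact (u ^ (∑ i, (γ i : ℕ))).isUnit.mul_left_cancel (by simpa using congrFun hcd γ)
  · simp only
    rw [← mul_assoc, ← mul_pow, Units.mul_inv, one_pow, one_mul]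

/-- A `p`-basis gives bases over the rings of `p ^ e`-th powers for all `e`. -/
theorem IsPowBasis.pow_prime {p : ℕ} [hp : Fact p.Prime] (hA : (p : A) = 0) {w : ι → A}
    (h : IsPowBasis p w) (e : ℕ) : IsPowBasis (p ^ e) w := by
  induction e with
  | zero =>
    have : powExpand (p ^ 0) w = fun c => c 0 := by
      funext c
      have : Subsingleton (Fin (p ^ 0)) := by rw [pow_zero]; infer_instance
      rw [powExpand, Finset.sum_eq_single 0]
      · simp
      · intro γ _ hγ; exact absurd (Subsingleton.elim _ _) hγ
      · intro h0; exact absurd (Finset.mem_univ _) h0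
    rw [IsPowBasis, this]
    have : Subsingleton (Fin (p ^ 0)) := by rw [pow_zero]; infer_instance
    have : Unique (ι → Fin (p ^ 0)) := ⟨⟨0⟩, fun _ => Subsingleton.elim _ _⟩
    exact ⟨fun c d hcd => funext fun γ => by rw [Subsingleton.elim γ 0]; exact hcd,
      fun a => ⟨fun _ => a, rfl⟩⟩
  | succ e ih =>
    let E : (ι → Fin (p ^ (e + 1))) ≃ (ι → Fin p) × (ι → Fin (p ^ e)) :=
      (Equiv.arrowCongr (Equiv.refl ι) ((finCongr (pow_succ p e)).trans
        (finProdFinEquiv.symm.trans (Equiv.prodComm _ _)))).trans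
        (Equiv.arrowProdEquivProdArrow ι (fun _ => Fin p) (fun _ => Fin (p ^ e)))
    have hE : ∀ γ i, (γ i : ℕ) = ((E γ).1 i : ℕ) + p * ((E γ).2 i : ℕ) := by
      intro γ i
      exact (congrArg Fin.val
        (finProdFinEquiv.apply_symm_apply (Fin.cast (pow_succ p e) (γ i)))).symm
    have hΦ : powExpand (p ^ (e + 1)) w =
        powExpand p w ∘ (fun (c : (ι → Fin p) → ((ι → Fin (p ^ e)) → A)) γ =>
          powExpand (p ^ e) w (c γ)) ∘
          (fun (c : (ι → Fin (p ^ (e + 1))) → A) (γ : ι → Fin p) δ => c (E.symm (γ, δ))) := by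
      funext c
      have hfr : ∀ x : A, x ^ p = frobPow p 1 hA x := by simp
      rw [powExpand, ← E.symm.sum_comp, Fintype.sum_prod_type]
      refine Finset.sum_congr rfl fun γ _ => ?_
      simp only [Function.comp_apply, powExpand]
      rw [hfr (∑ _, _), map_sum, Finset.sum_mul]
      refine Finset.sum_congr rfl fun δ _ => ?_
      rw [frobPow_apply, pow_one, mul_pow, ← pow_mul, ← pow_succ, mul_assoc]
      congr 1
      rw [← Finset.prod_pow, ← Finset.prod_mul_distrib]
      refine Finset.prod_congr rfl fun i _ => ?_
      rw [hE, Equiv.apply_symm_apply, pow_add, mul_comm, mul_comm p, pow_mul]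
    rw [IsPowBasis, hΦ]
    refine h.comp (Function.Bijective.comp (Function.Bijective.piMap fun _ => ih) ?_)
    exact ((Equiv.arrowCongr E (Equiv.refl A)).trans
      (Equiv.curry (ι → Fin p) (ι → Fin (p ^ e)) A)).bijective

end PowBasis

/-! ### Hasse derivatives with respect to a basis of monomials -/

section Hasse

variable {A B : Type*} [CommRing A] [CommRing B] {ι : Type*} [Fintype ι] [DecidableEq ι]

namespace IsPowBasis

/-- The `q`-th roots of the coordinates of an element in a basis of monomials. -/
noncomputable def coeff {q : ℕ} {w : ι → A} (h : IsPowBasis q w) (a : A) : (ι → Fin q) → A :=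
  (Equiv.ofBijective _ h).symm a

theorem powExpand_coeff {q : ℕ} {w : ι → A} (h : IsPowBasis q w) (a : A) :
    powExpand q w (h.coeff a) = a :=
  (Equiv.ofBijective _ h).apply_symm_apply a

theorem coeff_powExpand {q : ℕ} {w : ι → A} (h : IsPowBasis q w) (c : (ι → Fin q) → A) :
    h.coeff (powExpand q w c) = c :=
  (Equiv.ofBijective _ h).symm_apply_apply c

variable {w : ι → A}

/-- An additive property of elements of `A` can be checked on multiples of basis monomials by
`q`-th powers. -/
theorem induction_on {q : ℕ} (h : IsPowBasis q w) {P : A → Prop} (h0 : P 0)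
    (hadd : ∀ a b, P a → P b → P (a + b))
    (hmon : ∀ (a : A) (γ : ι → Fin q), P (a ^ q * ∏ i, w i ^ (γ i : ℕ))) (a : A) : P a := by
  rw [← h.powExpand_coeff a]
  exact Finset.sum_induction _ P hadd h0 fun γ _ => hmon _ γ

theorem addMonoidHom_ext {q : ℕ} (h : IsPowBasis q w) {f g : A →+ B}
    (hfg : ∀ (a : A) (γ : ι → Fin q),
      f (a ^ q * ∏ i, w i ^ (γ i : ℕ)) = g (a ^ q * ∏ i, w i ^ (γ i : ℕ))) : f = g :=
  AddMonoidHom.ext fun a => h.induction_on (P := fun a => f a = g a) (by rw [map_zero, map_zero])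
    (fun a b ha hb => by rw [map_add, ha, hb, map_add]) hfg a

theorem closure_eq_top {q : ℕ} (h : IsPowBasis q w) :
    Subring.closure (Set.range (fun x : A => x ^ q) ∪ Set.range w) = ⊤ := by
  refine eq_top_iff.mpr fun a _ => ?_
  set S := Subring.closure (Set.range (fun x : A => x ^ q) ∪ Set.range w) with hS
  have h1 : ∀ a : A, a ^ q ∈ S := fun a =>
    Subring.subset_closure (Set.mem_union_left _ ⟨a, rfl⟩)
  have h2 : ∀ i, w i ∈ S := fun i => Subring.subset_closure (Set.mem_union_right _ ⟨i, rfl⟩)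
  exact h.induction_on (P := (· ∈ S)) (zero_mem S) (fun _ _ => add_mem)
    (fun a γ => mul_mem (h1 a) (prod_mem fun i _ => pow_mem (h2 i) _)) a

variable {p e : ℕ} [hp : Fact p.Prime]

theorem coeff_add (hA : (p : A) = 0) (h : IsPowBasis (p ^ e) w) (a b : A) :
    h.coeff (a + b) = h.coeff a + h.coeff b := by
  apply h.injective
  rw [powExpand_coeff, powExpand_add hA, powExpand_coeff, powExpand_coeff]

theorem coeff_pow_mul {q : ℕ} (h : IsPowBasis q w) (a b : A) :
    h.coeff (a ^ q * b) = fun γ => a * h.coeff b γ := by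
  apply h.injective
  rw [powExpand_coeff, ← pow_mul_powExpand, powExpand_coeff]

theorem coeff_monomial (h : IsPowBasis (p ^ e) w) (a : A) (γ : ι → Fin (p ^ e)) :
    h.coeff (a ^ p ^ e * ∏ i, w i ^ (γ i : ℕ)) = Pi.single γ a := by
  rw [← powExpand_single (pow_ne_zero _ hp.out.ne_zero), coeff_powExpand]

/-- The Hasse derivative `D_γ` with respect to a basis of monomials `w ^ β`: the additive map with
`D_γ (c ^ q * w ^ β) = (β choose γ) * c ^ q * w ^ (β - γ)`. It is defined on coordinates;
multi-indices `γ` with an entry `≥ q` give zero. -/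
noncomputable def hasse (hA : (p : A) = 0) (h : IsPowBasis (p ^ e) w) (γ : ι → ℕ) : A →+ A where
  toFun a := powExpand (p ^ e) w fun δ =>
    if H : ∀ i, (δ i : ℕ) + γ i < p ^ e then
      ((∏ i, ((δ i : ℕ) + γ i).choose (γ i) : ℕ) : A) * h.coeff a fun i => ⟨δ i + γ i, H i⟩
    else 0
  map_zero' := by
    have h0 : h.coeff 0 = 0 := by
      have := coeff_add hA h 0 0
      rwa [add_zero, left_eq_add] at this
    refine Eq.trans (congrArg _ (funext fun δ => ?_))
      (powExpand_zero (pow_ne_zero e hp.out.ne_zero) w)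
    split_ifs <;> simp [h0]
  map_add' a b := by
    rw [← powExpand_add hA, coeff_add hA]
    congr 1
    funext δ
    rw [Pi.add_apply]
    split_ifs
    · rw [Pi.add_apply, mul_add]
    · rw [add_zero]

theorem coeff_hasse (hA : (p : A) = 0) (h : IsPowBasis (p ^ e) w) (γ : ι → ℕ) (a : A)
    (δ : ι → Fin (p ^ e)) (H : ∀ i, (δ i : ℕ) + γ i < p ^ e) :
    h.coeff (h.hasse hA γ a) δ =
      ((∏ i, ((δ i : ℕ) + γ i).choose (γ i) : ℕ) : A) * h.coeff a fun i => ⟨δ i + γ i, H i⟩ := by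
  rw [hasse, AddMonoidHom.coe_mk, ZeroHom.coe_mk, coeff_powExpand, dif_pos H]

theorem hasse_pow_mul (hA : (p : A) = 0) (h : IsPowBasis (p ^ e) w) (γ : ι → ℕ) (a b : A) :
    h.hasse hA γ (a ^ p ^ e * b) = a ^ p ^ e * h.hasse hA γ b := by
  simp only [hasse, AddMonoidHom.coe_mk, ZeroHom.coe_mk]
  rw [pow_mul_powExpand, coeff_pow_mul]
  congr 1
  funext δ
  split_ifs
  · ring
  · rw [mul_zero]

theorem hasse_basis (hA : (p : A) = 0) (h : IsPowBasis (p ^ e) w) (γ : ι → ℕ)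
    (β : ι → Fin (p ^ e)) :
    h.hasse hA γ (∏ i, w i ^ (β i : ℕ)) =
      ∏ i, (((β i : ℕ).choose (γ i) : A) * w i ^ ((β i : ℕ) - γ i)) := by
  have hq : p ^ e ≠ 0 := pow_ne_zero e hp.out.ne_zero
  have hc := coeff_monomial h 1 β
  rw [one_pow, one_mul] at hc
  simp only [hasse, AddMonoidHom.coe_mk, ZeroHom.coe_mk]
  rw [hc]
  by_cases hγ : ∀ i, γ i ≤ β i
  · let δ₀ : ι → Fin (p ^ e) := fun i => ⟨β i - γ i, lt_of_le_of_lt (Nat.sub_le _ _) (β i).2⟩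
    have hδ₀ : ∀ i, (δ₀ i : ℕ) + γ i = β i := fun i => Nat.sub_add_cancel (hγ i)
    rw [powExpand, Finset.sum_eq_single δ₀]
    · have H : ∀ i, (δ₀ i : ℕ) + γ i < p ^ e := fun i => by rw [hδ₀]; exact (β i).2
      rw [dif_pos H]
      have : (fun i => (⟨δ₀ i + γ i, H i⟩ : Fin (p ^ e))) = β := by
        funext i; exact Fin.ext (hδ₀ i)
      rw [this, Pi.single_eq_same, mul_one, natCast_pow_prime_pow hA, Nat.cast_prod,
        ← Finset.prod_mul_distrib]
      simp only [hδ₀]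
      rfl
    · intro δ _ hδ
      split_ifs with H
      · rw [Pi.single_eq_of_ne, mul_zero, zero_pow hq, zero_mul]
        intro hβ
        refine hδ (funext fun i => Fin.ext ?_)
        have := congrArg Fin.val (congrFun hβ i)
        simp only at this
        simp only [δ₀]
        omega
      · rw [zero_pow hq, zero_mul]
    · intro h0; exact absurd (Finset.mem_univ _) h0
  · obtain ⟨j, hj⟩ := not_forall.mp hγ
    rw [Finset.prod_eq_zero (Finset.mem_univ j) (by
      rw [Nat.choose_eq_zero_of_lt (not_le.mp hj), Nat.cast_zero, zero_mul])]
    refine Eq.trans (congrArg _ (funext fun δ => ?_)) (powExpand_zero hq w)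
    split_ifs with H
    · rw [Pi.single_eq_of_ne, mul_zero]; · rfl
      intro hβ
      have := congrArg Fin.val (congrFun hβ j)
      simp only at this
      omega
    · rfl

/-- The formula for `D_γ` on monomials with arbitrary exponents; reducing exponents modulo `q`
is harmless because `(β + q choose γ) = (β choose γ)` modulo `p` for `γ < q`. -/
theorem hasse_monomial (hA : (p : A) = 0) (h : IsPowBasis (p ^ e) w) (γ : ι → ℕ)
    (hγ : ∀ i, γ i < p ^ e) (β : ι → ℕ) (c : A) :
    h.hasse hA γ (c ^ p ^ e * ∏ i, w i ^ β i) =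
      c ^ p ^ e * ∏ i, (((β i).choose (γ i) : A) * w i ^ (β i - γ i)) := by
  have hq : 0 < p ^ e := pow_pos hp.out.pos e
  let ρ : ι → Fin (p ^ e) := fun i => ⟨β i % p ^ e, Nat.mod_lt _ hq⟩
  have h1 : ∏ i, w i ^ β i = (∏ i, w i ^ (β i / p ^ e)) ^ p ^ e * ∏ i, w i ^ (ρ i : ℕ) := by
    rw [← Finset.prod_pow, ← Finset.prod_mul_distrib]
    refine Finset.prod_congr rfl fun i _ => ?_
    rw [← pow_mul, ← pow_add, mul_comm, Nat.div_add_mod]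
  rw [hasse_pow_mul, h1, hasse_pow_mul, hasse_basis, ← Finset.prod_pow,
    ← Finset.prod_mul_distrib]
  congr 1
  refine Finset.prod_congr rfl fun i _ => ?_
  have h2 := natCast_eq_of_modEq hA (choose_modEq_choose_mod_pow e (β i) (γ i) (hγ i))
  rw [h2, ← pow_mul]
  simp only [ρ]
  by_cases hle : γ i ≤ β i % p ^ e
  · rw [mul_left_comm, ← pow_add]
    congr 2
    rw [mul_comm]
    conv_rhs => rw [← Nat.div_add_mod (β i) (p ^ e)]
    omega
  · rw [Nat.choose_eq_zero_of_lt (not_le.mp hle), Nat.cast_zero, zero_mul, zero_mul, mul_zero]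

theorem hasse_zero (hA : (p : A) = 0) (h : IsPowBasis (p ^ e) w) :
    h.hasse hA 0 = AddMonoidHom.id A := by
  refine h.addMonoidHom_ext fun c γ => ?_
  rw [hasse_monomial hA h 0 (fun i => pow_pos hp.out.pos e)]
  simp

theorem hasse_diffComm (hA : (p : A) = 0) (h : IsPowBasis (p ^ e) w) (γ : ι → ℕ)
    (hγ : ∀ i, γ i < p ^ e) (j : ι) :
    diffComm (RingHom.id A) (h.hasse hA γ) (w j) =
      if γ j = 0 then 0 else h.hasse hA (Function.update γ j (γ j - 1)) := by
  refine h.addMonoidHom_ext fun c β => ?_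
  have hmul : w j * (c ^ p ^ e * ∏ i, w i ^ (β i : ℕ)) =
      c ^ p ^ e * ∏ i, w i ^ (Function.update (fun i => (β i : ℕ)) j (β j + 1) i) := by
    rw [← Finset.mul_prod_erase _ _ (Finset.mem_univ j),
      ← Finset.mul_prod_erase _ (fun i => w i ^ (Function.update _ j _ i)) (Finset.mem_univ j)]
    rw [Function.update_self, pow_succ]
    have : ∏ x ∈ Finset.univ.erase j, w x ^ Function.update (fun i => (β i : ℕ)) j (β j + 1) x =
        ∏ x ∈ Finset.univ.erase j, w x ^ (β x : ℕ) :=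
      Finset.prod_congr rfl fun i hi => by rw [Function.update_of_ne (Finset.ne_of_mem_erase hi)]
    rw [this]; ring
  rw [diffComm_apply, hmul, hasse_monomial hA h γ hγ, hasse_monomial hA h γ hγ, RingHom.id_apply,
    ← Finset.mul_prod_erase _ _ (Finset.mem_univ j),
    ← Finset.mul_prod_erase _ (fun i => (((β i : ℕ).choose (γ i) : A) * w i ^ ((β i : ℕ) - γ i)))
      (Finset.mem_univ j), Function.update_self]
  have h1 : ∏ x ∈ Finset.univ.erase j,
      (((Function.update (fun i => (β i : ℕ)) j (β j + 1) x).choose (γ x) : A) *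
        w x ^ (Function.update (fun i => (β i : ℕ)) j (β j + 1) x - γ x)) =
      ∏ x ∈ Finset.univ.erase j, (((β x : ℕ).choose (γ x) : A) * w x ^ ((β x : ℕ) - γ x)) :=
    Finset.prod_congr rfl fun i hi => by rw [Function.update_of_ne (Finset.ne_of_mem_erase hi)]
  rw [h1]
  split_ifs with h0
  · rw [h0, AddMonoidHom.zero_apply]
    simp only [Nat.choose_zero_right, Nat.sub_zero, pow_succ]
    ring
  · rw [hasse_monomial hA h _ (fun i => ?_),
      ← Finset.mul_prod_erase _ (fun i => (((β i : ℕ).choose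
        (Function.update γ j (γ j - 1) i) : A) * w i ^ ((β i : ℕ) - Function.update γ j (γ j - 1) i)))
        (Finset.mem_univ j), Function.update_self]
    · have h2 : ∏ x ∈ Finset.univ.erase j, (((β x : ℕ).choose
          (Function.update γ j (γ j - 1) x) : A) *
            w x ^ ((β x : ℕ) - Function.update γ j (γ j - 1) x)) =
          ∏ x ∈ Finset.univ.erase j, (((β x : ℕ).choose (γ x) : A) * w x ^ ((β x : ℕ) - γ x)) :=
        Finset.prod_congr rfl fun i hi => by
          rw [Function.update_of_ne (Finset.ne_of_mem_erase hi)]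
      rw [h2]
      obtain ⟨k, hk⟩ := Nat.exists_eq_succ_of_ne_zero h0
      have hpow : ((β j : ℕ).choose (k + 1) : A) * w j ^ ((β j : ℕ) - k) =
          w j * (((β j : ℕ).choose (k + 1) : A) * w j ^ ((β j : ℕ) - (k + 1))) := by
        by_cases hle : k + 1 ≤ (β j : ℕ)
        · rw [show (β j : ℕ) - k = ((β j : ℕ) - (k + 1)) + 1 by omega, pow_succ]; ring
        · rw [Nat.choose_eq_zero_of_lt (not_le.mp hle)]; simp
      rw [hk]
      simp only [Nat.succ_eq_add_one, Nat.add_sub_cancel, Nat.choose_succ_succ, Nat.cast_add,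
        Nat.add_sub_add_right]
      rw [add_mul, hpow]
      ring
    · by_cases hij : i = j
      · subst hij; rw [Function.update_self]; exact lt_of_le_of_lt (Nat.sub_le _ _) (hγ i)
      · rw [Function.update_of_ne hij]; exact hγ i

theorem diffLT_hasse (hA : (p : A) = 0) (h : IsPowBasis (p ^ e) w) (γ : ι → ℕ)
    (hγ : ∀ i, γ i < p ^ e) : DiffLT (RingHom.id A) (∑ i, γ i + 1) (h.hasse hA γ) := by
  have key : ∀ n, ∀ γ : ι → ℕ, (∀ i, γ i < p ^ e) → ∑ i, γ i = n →
      DiffLT (RingHom.id A) (n + 1) (h.hasse hA γ) := by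
    intro n
    induction n with
    | zero =>
      intro γ hγ hn
      have : γ = 0 := by
        funext i
        exact (Finset.sum_eq_zero_iff.mp hn) i (Finset.mem_univ i)
      rw [this, hasse_zero]
      exact DiffLT.id
    | succ n ih =>
      intro γ hγ hn
      refine DiffLT.of_closure h.closure_eq_top ?_
      rintro _ (⟨c, rfl⟩ | ⟨j, rfl⟩)
      · have : diffComm (RingHom.id A) (h.hasse hA γ) (c ^ p ^ e) = 0 := by
          refine AddMonoidHom.ext fun a => ?_
          rw [diffComm_apply, hasse_pow_mul, RingHom.id_apply, sub_self, AddMonoidHom.zero_apply]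
        simp only [this]
        exact DiffLT.zero _
      · rw [hasse_diffComm hA h γ hγ]
        split_ifs with h0
        · exact DiffLT.zero _
        · refine ih _ (fun i => ?_) ?_
          · by_cases hij : i = j
            · subst hij; rw [Function.update_self]; exact lt_of_le_of_lt (Nat.sub_le _ _) (hγ i)
            · rw [Function.update_of_ne hij]; exact hγ i
          · rw [← Finset.add_sum_erase _ _ (Finset.mem_univ j)] at hn ⊢
            have : ∑ x ∈ Finset.univ.erase j, Function.update γ j (γ j - 1) x =
                ∑ x ∈ Finset.univ.erase j, γ x :=
              Finset.sum_congr rfl fun i hi => by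
                rw [Function.update_of_ne (Finset.ne_of_mem_erase hi)]
            rw [this, Function.update_self]
            omega
  exact key _ γ hγ rfl

theorem hasse_one (hA : (p : A) = 0) (h : IsPowBasis (p ^ e) w) (γ : ι → ℕ)
    (hγ : ∀ i, γ i < p ^ e) (h0 : γ ≠ 0) : h.hasse hA γ 1 = 0 := by
  have := h.hasse_monomial hA γ hγ 0 1
  simp only [Pi.zero_apply, pow_zero, one_pow, one_mul, Finset.prod_const_one, mul_one,
    Nat.zero_sub] at this
  rw [this]
  obtain ⟨j, hj⟩ := Function.ne_iff.mp h0
  refine Finset.prod_eq_zero (Finset.mem_univ j) ?_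
  rw [Nat.choose_eq_zero_of_lt (Nat.pos_of_ne_zero hj), Nat.cast_zero]

end IsPowBasis

end Hasse

/-! ### Ideals generated by part of a basis of monomials -/

theorem mem_span_image {A : Type*} [CommRing A] {ι : Type*} (w : ι → A) {J : Finset ι}
    {i : ι} (hi : i ∈ J) :
    w i ∈ Ideal.span (w '' J) :=
  Ideal.subset_span (Set.mem_image_of_mem w (Finset.mem_coe.mpr hi))

section BasisIdeal

variable {A B : Type*} [CommRing A] [CommRing B] {ι : Type*} [Fintype ι] [DecidableEq ι]

namespace IsPowBasis

variable {p e : ℕ} [hp : Fact p.Prime] {w : ι → A}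

/-- Membership in the ideal generated by part of the basis is visible on the coordinates which do
not involve the corresponding variables. -/
theorem mem_span_image_iff (hA : (p : A) = 0) (h : IsPowBasis (p ^ e) w) (J : Finset ι) (g : A) :
    g ∈ Ideal.span (w '' J) ↔
      ∀ δ : ι → Fin (p ^ e), (∀ i ∈ J, (δ i : ℕ) = 0) → h.coeff g δ ∈ Ideal.span (w '' J) := by
  have hq : p ^ e ≠ 0 := pow_ne_zero e hp.out.ne_zero
  have hq' : 0 < p ^ e := Nat.pos_of_ne_zero hq
  constructor
  · intro hg
    let P : A → Prop := fun g => ∀ δ : ι → Fin (p ^ e), (∀ i ∈ J, (δ i : ℕ) = 0) →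
      h.coeff g δ ∈ Ideal.span (w '' J)
    have hadd : ∀ a b, P a → P b → P (a + b) := fun a b ha hb δ hδ => by
      rw [coeff_add hA]; exact add_mem (ha δ hδ) (hb δ hδ)
    have hzero : P 0 := fun δ _ => by
      have := coeff_monomial h 0 δ
      rw [zero_pow hq, zero_mul] at this
      rw [this]; simp
    refine Submodule.closure_induction (p := fun g _ => P g) hzero
      (fun a b _ _ => hadd a b) ?_ hg
    rintro r _ ⟨j, hj, rfl⟩
    refine h.induction_on (P := fun r => P (r • w j)) (by rw [zero_smul]; exact hzero)
      (fun a b ha hb => by rw [add_smul]; exact hadd _ _ ha hb) (fun c β => ?_) r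
    have hprod : ∀ k : ℕ, ∏ i, w i ^ (Function.update (fun i => (β i : ℕ)) j k i) =
        w j ^ k * ∏ x ∈ Finset.univ.erase j, w x ^ (β x : ℕ) := by
      intro k
      rw [← Finset.mul_prod_erase _ _ (Finset.mem_univ j), Function.update_self]
      congr 1
      exact Finset.prod_congr rfl fun i hi => by
        rw [Function.update_of_ne (Finset.ne_of_mem_erase hi)]
    have hβ : (c ^ p ^ e * ∏ i, w i ^ (β i : ℕ)) • w j =
        c ^ p ^ e * (w j ^ ((β j : ℕ) + 1) * ∏ x ∈ Finset.univ.erase j, w x ^ (β x : ℕ)) := by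
      rw [← Finset.mul_prod_erase _ _ (Finset.mem_univ j), smul_eq_mul, pow_succ]
      ring
    have hup : ∀ (k : ℕ) (hk : k < p ^ e),
        ∏ i, w i ^ ((Function.update β j ⟨k, hk⟩ i : Fin (p ^ e)) : ℕ) =
        w j ^ k * ∏ x ∈ Finset.univ.erase j, w x ^ (β x : ℕ) := by
      intro k hk
      rw [← hprod]
      refine Finset.prod_congr rfl fun i _ => ?_
      by_cases hij : i = j
      · subst hij; simp
      · simp [Function.update_of_ne hij]
    intro δ hδ
    rcases lt_or_eq_of_le (Nat.succ_le_of_lt (β j).2) with hlt | heq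
    · have hlt' : (β j : ℕ) + 1 < p ^ e := hlt
      have : h.coeff ((c ^ p ^ e * ∏ i, w i ^ (β i : ℕ)) • w j) =
          Pi.single (Function.update β j ⟨_, hlt'⟩) c := by
        rw [hβ, ← hup _ hlt', coeff_monomial]
      rw [this, Pi.single_eq_of_ne]
      · exact zero_mem _
      · rintro rfl
        have := hδ j hj
        simp at this
    · have heq' : (β j : ℕ) + 1 = p ^ e := heq
      have : h.coeff ((c ^ p ^ e * ∏ i, w i ^ (β i : ℕ)) • w j) =
          Pi.single (Function.update β j ⟨0, hq'⟩) (c * w j) := by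
        rw [hβ, heq', ← coeff_monomial h, hup]
        congr 1
        rw [pow_zero, one_mul, mul_pow, mul_assoc]
      rw [this]
      by_cases hδ' : δ = Function.update β j ⟨0, hq'⟩
      · rw [hδ', Pi.single_eq_same]
        exact Ideal.mul_mem_left _ _ (mem_span_image w hj)
      · rw [Pi.single_eq_of_ne hδ']; exact zero_mem _
  · intro hg
    rw [← h.powExpand_coeff g, powExpand]
    refine sum_mem fun δ _ => ?_
    by_cases hδ : ∀ i ∈ J, (δ i : ℕ) = 0
    · exact Ideal.mul_mem_right _ _ (Ideal.pow_mem_of_mem _ (hg δ hδ) _ hq')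
    · push Not at hδ
      obtain ⟨j, hj, hδj⟩ := hδ
      refine Ideal.mul_mem_left _ _ ?_
      rw [← Finset.mul_prod_erase _ _ (Finset.mem_univ j)]
      exact Ideal.mul_mem_right _ _ (Ideal.pow_mem_of_mem _ (mem_span_image w hj) _
        (Nat.pos_of_ne_zero hδj))

/-- The ideal generated by part of a `p`-basis is radical. -/
theorem isRadical_span (hA : (p : A) = 0) (h : IsPowBasis p w) (J : Finset ι) :
    (Ideal.span (w '' J)).IsRadical := by
  rintro g ⟨n, hn⟩
  obtain ⟨e, he⟩ : ∃ e, n ≤ p ^ e := ⟨n, (Nat.lt_pow_self hp.out.one_lt).le⟩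
  have h' := h.pow_prime hA e
  have hg : g ^ p ^ e ∈ Ideal.span (w '' J) := Ideal.pow_mem_of_pow_mem _ hn he
  rw [mem_span_image_iff hA h'] at hg
  have := hg (fun _ => ⟨0, pow_pos hp.out.pos e⟩) (fun _ _ => rfl)
  have hc := coeff_monomial h' g (fun _ => ⟨0, pow_pos hp.out.pos e⟩)
  simp only [pow_zero, Finset.prod_const_one, mul_one] at hc
  rwa [hc, Pi.single_eq_same] at this

/-- Taylor expansion along `I = (w_j : j ∈ J)`: if all Hasse derivatives of order `< n` of `f` in
the directions of `J` lie in `I`, then `f ∈ I ^ n`, provided that `n ≤ q`. -/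
theorem mem_span_pow_of_hasse (hA : (p : A) = 0) (h : IsPowBasis (p ^ e) w) (J : Finset ι) {n : ℕ}
    (hn : n ≤ p ^ e) {f : A} (hf : ∀ β : ι → ℕ, (∀ i ∉ J, β i = 0) → ∑ i, β i < n →
      h.hasse hA β f ∈ Ideal.span (w '' J)) : f ∈ Ideal.span (w '' J) ^ n := by
  have hq' : 0 < p ^ e := pow_pos hp.out.pos e
  rw [← h.powExpand_coeff f, powExpand]
  refine sum_mem fun δ _ => ?_
  let β : ι → ℕ := fun i => if i ∈ J then (δ i : ℕ) else 0
  have hβJ : ∀ i ∉ J, β i = 0 := fun i hi => if_neg hi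
  by_cases hβ : ∑ i, β i < n
  · refine Ideal.mul_mem_right _ _ (Ideal.pow_le_pow_right hn (Ideal.pow_mem_pow ?_ _))
    have h1 := (mem_span_image_iff hA h J _).mp (hf β hβJ hβ)
      (fun i => if i ∈ J then ⟨0, hq'⟩ else δ i) (fun i hi => by simp [hi])
    have hδβ : ∀ i, ((if i ∈ J then ⟨0, hq'⟩ else δ i : Fin (p ^ e)) : ℕ) + β i = δ i := by
      intro i
      by_cases hi : i ∈ J <;> simp [β, hi]
    rw [coeff_hasse hA h _ _ _ (fun i => by rw [hδβ]; exact (δ i).2)] at h1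
    have h2 : (∏ i, (((if i ∈ J then ⟨0, hq'⟩ else δ i : Fin (p ^ e)) : ℕ) + β i).choose (β i)) =
        1 := by
      refine Finset.prod_eq_one fun i _ => ?_
      by_cases hi : i ∈ J <;> simp [β, hi]
    rw [h2, Nat.cast_one, one_mul] at h1
    convert h1 using 2
    funext i
    exact Fin.ext (hδβ i).symm
  · refine Ideal.mul_mem_left _ _ (Ideal.pow_le_pow_right (not_lt.mp hβ) ?_)
    have : ∏ i, w i ^ (δ i : ℕ) = (∏ i, w i ^ β i) * ∏ i, w i ^ ((δ i : ℕ) - β i) := by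
      rw [← Finset.prod_mul_distrib]
      refine Finset.prod_congr rfl fun i _ => ?_
      rw [← pow_add]
      congr 1
      simp only [β]
      split_ifs <;> omega
    rw [this]
    refine Ideal.mul_mem_right _ _ ?_
    rw [← Finset.prod_pow_eq_pow_sum]
    refine Ideal.prod_mem_prod fun i _ => ?_
    by_cases hi : i ∈ J
    · exact Ideal.pow_mem_pow (mem_span_image w hi) _
    · rw [hβJ i hi]; simp

/-- A function vanishing to order `n` at every point of the closed set defined by part of a
`p`-basis lies in the `n`-th power of its ideal. -/
theorem mem_span_pow_of_forall_prime (hA : (p : A) = 0) (h : IsPowBasis p w) (J : Finset ι) {n : ℕ}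
    {f : A} (hf : ∀ P : Ideal A, P.IsPrime → Ideal.span (w '' J) ≤ P → ∃ s ∉ P, s * f ∈ P ^ n) :
    f ∈ Ideal.span (w '' J) ^ n := by
  obtain ⟨e, he⟩ : ∃ e, n ≤ p ^ e := ⟨n, (Nat.lt_pow_self hp.out.one_lt).le⟩
  have h' := h.pow_prime hA e
  refine h'.mem_span_pow_of_hasse hA J he fun β _ hβ => ?_
  refine h.isRadical_span hA J ?_
  rw [Ideal.radical_eq_sInf, Submodule.mem_sInf]
  rintro P ⟨hJP, hP⟩
  obtain ⟨s, hs, hsf⟩ := hf P hP hJP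
  have hβ' : ∀ i, β i < p ^ e := fun i =>
    lt_of_le_of_lt (Finset.single_le_sum (fun _ _ => Nat.zero_le _) (Finset.mem_univ i))
      (lt_of_lt_of_le hβ he)
  have h1 : s ^ p ^ e * f ∈ P ^ (n - ∑ i, β i + ∑ i, β i) := by
    rw [Nat.sub_add_cancel hβ.le,
      ← Nat.sub_add_cancel (Nat.one_le_iff_ne_zero.mpr (pow_ne_zero e hp.out.ne_zero)), pow_succ,
      mul_assoc]
    exact Ideal.mul_mem_left _ _ hsf
  have h2 := (h'.diffLT_hasse hA β hβ').map_mem_pow P h1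
  rw [hasse_pow_mul, Ideal.map_id] at h2
  have h3 := Ideal.pow_le_self (Nat.sub_ne_zero_of_lt hβ) h2
  exact (hP.mem_or_mem h3).resolve_left fun h4 => hs (hP.mem_of_pow_mem _ h4)

/-- Elements of the basis are nonzerodivisors on the associated graded ring. -/
theorem mem_span_pow_of_mul_mem (hA : (p : A) = 0) (h : IsPowBasis p w) (J : Finset ι) {j : ι}
    (hj : j ∈ J) {n : ℕ} {g : A} (hg : w j * g ∈ Ideal.span (w '' J) ^ (n + 1)) :
    g ∈ Ideal.span (w '' J) ^ n := by
  obtain ⟨e, he⟩ : ∃ e, n + 1 ≤ p ^ e := ⟨n + 1, (Nat.lt_pow_self hp.out.one_lt).le⟩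
  have h' := h.pow_prime hA e
  refine h'.mem_span_pow_of_hasse hA J (by omega) fun β hβJ hβ => ?_
  let β' : ι → ℕ := Function.update β j (β j + 1)
  have hsum : ∑ i, β' i = ∑ i, β i + 1 := by
    rw [← Finset.add_sum_erase _ _ (Finset.mem_univ j),
      ← Finset.add_sum_erase _ β (Finset.mem_univ j)]
    have : ∑ x ∈ Finset.univ.erase j, β' x = ∑ x ∈ Finset.univ.erase j, β x :=
      Finset.sum_congr rfl fun i hi => Function.update_of_ne (Finset.ne_of_mem_erase hi) _ _
    rw [this]
    simp only [β', Function.update_self]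
    omega
  have hβ' : ∀ i, β' i < p ^ e := fun i =>
    lt_of_le_of_lt (Finset.single_le_sum (fun _ _ => Nat.zero_le _) (Finset.mem_univ i))
      (by omega)
  have h1 : h'.hasse hA β' (w j * g) = w j * h'.hasse hA β' g + h'.hasse hA β g := by
    have := DFunLike.congr_fun (h'.hasse_diffComm hA β' hβ' j) g
    have hne : β' j ≠ 0 := by simp [β']
    rw [if_neg hne, diffComm_apply, RingHom.id_apply] at this
    have hβ0 : Function.update β' j (β' j - 1) = β := by simp [β']
    rw [hβ0] at this
    rw [← this]; ring
  have h2 : h'.hasse hA β' (w j * g) ∈ Ideal.span (w '' J) := by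
    have h3 := (h'.diffLT_hasse hA β' hβ').map_mem_pow (Ideal.span (w '' J))
      (n := n + 1 - ∑ i, β' i) (a := w j * g) (by rwa [Nat.sub_add_cancel (by omega)])
    rw [Ideal.map_id] at h3
    exact Ideal.pow_le_self (by omega) h3
  rw [h1] at h2
  exact (Ideal.add_mem_iff_right _
    (Ideal.mul_mem_right _ _ (mem_span_image w hj))).mp h2

theorem mem_span_pow_of_pow_mul_mem (hA : (p : A) = 0) (h : IsPowBasis p w) (J : Finset ι) {j : ι}
    (hj : j ∈ J) {n N : ℕ} {g : A} (hg : w j ^ N * g ∈ Ideal.span (w '' J) ^ (N + n)) :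
    g ∈ Ideal.span (w '' J) ^ n := by
  induction N with
  | zero => simpa using hg
  | succ N ih =>
    refine ih (h.mem_span_pow_of_mul_mem hA J hj ?_)
    rw [← mul_assoc, ← pow_succ', show N + n + 1 = N + 1 + n by ring]
    exact hg

/-- The key statement for one equation `t` of a `p`-basis: if all operators of order `< q` which
kill `1` map `f` into `(t)`, then `f` is a `q`-th power modulo `t ^ q`. -/
theorem exists_pow_add_of_diff_mem (hA : (p : A) = 0) (h : IsPowBasis (p ^ e) w) (j : ι) {f : A}
    (hf : ∀ D : A →+ A, DiffLT (RingHom.id A) (p ^ e) D → D 1 = 0 → D f ∈ Ideal.span {w j}) :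
    ∃ G k : A, f = G ^ p ^ e + w j ^ p ^ e * k := by
  have hq : p ^ e ≠ 0 := pow_ne_zero e hp.out.ne_zero
  have hspan : Ideal.span {w j} = Ideal.span (w '' (({j} : Finset ι) : Set ι)) := by simp
  have hD : ∀ (i : ι) (r : ℕ), 0 < r → r < p ^ e → ∀ δ : ι → Fin (p ^ e),
      (δ j : ℕ) = (Pi.single i r : ι → ℕ) j → r ≤ δ i →
      (((δ i : ℕ).choose r : ℕ) : A) * h.coeff f δ ∈ Ideal.span {w j} := by
    intro i r hr0 hr δ hδj hri
    let γ : ι → ℕ := Pi.single i r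
    have hγ : ∀ k, γ k < p ^ e := by
      intro k
      by_cases hk : k = i
      · subst hk; simpa [γ] using hr
      · simp [γ, Pi.single_eq_of_ne hk, Nat.pos_of_ne_zero hq]
    have hsum : ∑ k, γ k = r := by simp [γ]
    have hγ0 : γ ≠ 0 := fun h0 => by
      have := congrFun h0 i
      simp [γ] at this
      omega
    have hle : ∀ k, γ k ≤ δ k := by
      intro k
      by_cases hk : k = i
      · subst hk; simpa [γ] using hri
      · simp [γ, Pi.single_eq_of_ne hk]
    have h1 := hf _ ((h.diffLT_hasse hA γ hγ).mono (by omega)) (h.hasse_one hA γ hγ hγ0)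
    rw [hspan, mem_span_image_iff hA h] at h1
    have hδ' : ∀ k, ((⟨δ k - γ k, lt_of_le_of_lt (Nat.sub_le _ _) (δ k).2⟩ : Fin (p ^ e)) : ℕ) +
        γ k = δ k := fun k => Nat.sub_add_cancel (hle k)
    have h2 := h1 (fun k => ⟨δ k - γ k, lt_of_le_of_lt (Nat.sub_le _ _) (δ k).2⟩) (by
      intro k hk
      rw [Finset.mem_singleton] at hk
      subst hk
      simp only [γ]
      omega)
    rw [coeff_hasse hA h _ _ _ (fun k => by rw [hδ']; exact (δ k).2), ← hspan] at h2
    convert h2 using 1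
    congr 1
    · rw [Finset.prod_eq_single i]
      · congr 2
        · exact (hδ' i).symm
        · simp [γ]
      · intro k _ hk
        simp [γ, Pi.single_eq_of_ne hk]
      · intro h0; exact absurd (Finset.mem_univ _) h0
    · congr 1
      funext k
      exact Fin.ext (hδ' k).symm
  -- All coordinates but the constant one are divisible by `t`.
  have hcoeff : ∀ γ : ι → Fin (p ^ e), (∃ i, (γ i : ℕ) ≠ 0) → w j ∣ h.coeff f γ := by
    rintro γ ⟨i, hi⟩
    rw [← Ideal.mem_span_singleton]
    by_cases hγj : (γ j : ℕ) = 0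
    · have hij : j ≠ i := fun hij => hi (hij ▸ hγj)
      have h1 := hD i (p ^ Nat.log p (γ i)) (pow_pos hp.out.pos _)
        (lt_of_le_of_lt (Nat.pow_log_le_self p hi) (γ i).2) γ
        (by rw [Pi.single_eq_of_ne hij, hγj]) (Nat.pow_log_le_self p hi)
      exact (Ideal.unit_mul_mem_iff_mem _
        (isUnit_natCast_of_not_dvd hA (not_dvd_choose_prime_pow_log hi))).mp h1
    · have h1 := hD j (γ j) (Nat.pos_of_ne_zero hγj) (γ j).2 γ (by simp) le_rfl
      simpa using h1
  choose! k hk using hcoeff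
  let γ₀ : ι → Fin (p ^ e) := fun _ => ⟨0, Nat.pos_of_ne_zero hq⟩
  refine ⟨h.coeff f γ₀, ∑ γ ∈ Finset.univ.erase γ₀, k γ ^ p ^ e * ∏ i, w i ^ (γ i : ℕ), ?_⟩
  conv_lhs => rw [← h.powExpand_coeff f, powExpand,
    ← Finset.add_sum_erase _ _ (Finset.mem_univ γ₀)]
  congr 1
  · simp [γ₀]
  · rw [Finset.mul_sum]
    refine Finset.sum_congr rfl fun γ hγ => ?_
    have : ∃ i, (γ i : ℕ) ≠ 0 := by
      by_contra hcon
      push Not at hcon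
      exact Finset.ne_of_mem_erase hγ (funext fun i => Fin.ext (hcon i))
    rw [hk γ this, mul_pow, mul_assoc]

/-- The iterated form of `exists_pow_add_of_diff_mem`: the conditions
`Diff_+^j f ⊆ (t ^ (a q - j))` for `1 ≤ j < q` force `f` to be a `q`-th power modulo
`t ^ (q * a)`. -/
theorem exists_pow_add_of_diff_mem_pow (hA : (p : A) = 0) (h : IsPowBasis (p ^ e) w) (j : ι)
    (hj : w j ∈ nonZeroDivisors A) (a : ℕ) {f : A}
    (hf : ∀ i < p ^ e, ∀ D : A →+ A, DiffLT (RingHom.id A) (i + 1) D → D 1 = 0 →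
      w j ^ (p ^ e * a - i) ∣ D f) :
    ∃ G k : A, f = G ^ p ^ e + w j ^ (p ^ e * a) * k := by
  have hq : p ^ e ≠ 0 := pow_ne_zero e hp.out.ne_zero
  induction a generalizing f with
  | zero => exact ⟨0, f, by rw [zero_pow hq]; simp⟩
  | succ a ih =>
    obtain ⟨G, k, hGk⟩ := h.exists_pow_add_of_diff_mem hA j (f := f) (by
      intro D hD h1
      rw [Ideal.mem_span_singleton]
      refine (dvd_pow_self (w j) ?_).trans (hf (p ^ e - 1) (by omega) D
        (by rwa [Nat.sub_add_cancel (Nat.one_le_iff_ne_zero.mpr hq)]) h1)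
      rw [mul_add]
      omega)
    obtain ⟨G', k', hk⟩ := ih (f := k) (by
      intro i hi D hD h1
      have hDf : D f = w j ^ p ^ e * D k := by
        rw [hGk, map_add, hD.map_pow_mul hA (by omega), ← mul_one (G ^ p ^ e),
          hD.map_pow_mul hA (by omega), h1, mul_zero, zero_add, RingHom.id_apply]
      by_cases hai : p ^ e * a ≤ i
      · rw [Nat.sub_eq_zero_of_le hai, pow_zero]; exact one_dvd _
      · have h2 := hf i hi D hD h1
        rw [hDf, show p ^ e * (a + 1) - i = p ^ e + (p ^ e * a - i) by rw [mul_add]; omega,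
          pow_add] at h2
        obtain ⟨b, hb⟩ := h2
        refine ⟨b, ?_⟩
        rw [mul_assoc] at hb
        exact (mul_cancel_left_mem_nonZeroDivisors (pow_mem hj _)).mp hb)
    refine ⟨G + w j * G', k', ?_⟩
    rw [← frobPow_apply e hA (G + w j * G'), map_add, frobPow_apply, frobPow_apply, hGk, hk,
      mul_pow, mul_add (p ^ e), mul_one, pow_add]
    ring

end IsPowBasis

/-- An operator of order `≤ n < q` which vanishes on all monomials of degree `≤ n` in the basis
is zero. -/
theorem DiffLT.eq_zero_of_monomials {p e : ℕ} [hp : Fact p.Prime] (hB : (p : B) = 0)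
    {w : ι → A} (h : IsPowBasis (p ^ e) w) {φ : A →+* B} {n : ℕ} (hn : n ≤ p ^ e) {δ : A →+ B}
    (hδ : DiffLT φ n δ) (h0 : ∀ β : ι → ℕ, ∑ i, β i < n → δ (∏ i, w i ^ β i) = 0) : δ = 0 := by
  induction n generalizing δ with
  | zero => exact hδ
  | succ n ih =>
    have hcomm : ∀ j, diffComm φ δ (w j) = 0 := by
      intro j
      refine ih (by omega) (hδ (w j)) fun β hβ => ?_
      have hprod : w j * ∏ i, w i ^ β i = ∏ i, w i ^ (β + Pi.single j 1 : ι → ℕ) i := by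
        simp only [Pi.add_apply, pow_add, Finset.prod_mul_distrib]
        rw [mul_comm]
        congr 1
        rw [Finset.prod_eq_single j]
        · simp
        · intro i _ hi; simp [Pi.single_eq_of_ne hi]
        · simp
      rw [diffComm_apply, hprod, h0 β (by omega), h0 _ (by
        simp only [Pi.add_apply, Finset.sum_add_distrib, Finset.sum_pi_single', Finset.mem_univ]
        simp; omega)]
      simp
    have hone : δ 1 = 0 := by simpa using h0 0 (by simp)
    have hconst : ∀ a, diffComm φ δ a = 0 := by
      have h1 : DiffLT φ 1 δ := by
        refine DiffLT.of_closure h.closure_eq_top ?_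
        rintro _ (⟨c, rfl⟩ | ⟨j, rfl⟩)
        · refine AddMonoidHom.ext fun b => ?_
          simp [hδ.map_pow_mul hB hn]
        · exact hcomm j
      exact h1
    refine AddMonoidHom.ext fun a => ?_
    have := DFunLike.congr_fun (hconst a) 1
    simpa [hone] using this

/-- Absolute differential operators of order `< q` along `φ : A → B` are combinations of Hasse
derivatives; in particular the values of those killing `1` lie in the extension of `Diff_+`. -/
theorem DiffLT.map_mem_map_diffPlusIdeal {p e : ℕ} [hp : Fact p.Prime] (hA : (p : A) = 0)
    {w : ι → A} (h : IsPowBasis (p ^ e) w) {φ : A →+* B} {n : ℕ} (hn : n < p ^ e) {δ : A →+ B}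
    (hδ : DiffLT φ (n + 1) δ) (h1 : δ 1 = 0) {s : Set A} {m : A} (hm : m ∈ s) :
    δ m ∈ (diffPlusIdeal ℤ n s).map φ := by
  have hB : (p : B) = 0 := by rw [← map_natCast φ, hA, map_zero]
  let Good : (A →+ B) → Prop := fun ε =>
    DiffLT φ (n + 1) ε ∧ ε m ∈ (diffPlusIdeal ℤ n s).map φ
  have hgood : ∀ r, 1 ≤ r → r ≤ n + 1 → ∃ ε, Good ε ∧
      ∀ β : ι → ℕ, ∑ i, β i < r → (δ - ε) (∏ i, w i ^ β i) = 0 := by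
    intro r hr
    induction r, hr using Nat.le_induction with
    | base =>
      intro _
      refine ⟨0, ⟨DiffLT.zero _, by simp⟩, fun β hβ => ?_⟩
      have : β = 0 := by
        funext i
        exact (Finset.sum_eq_zero_iff.mp (Nat.lt_one_iff.mp hβ)) i (Finset.mem_univ i)
      simp [this, h1]
    | succ r hr ih =>
      intro hrn
      obtain ⟨ε, hε, hβ⟩ := ih (by omega)
      -- Correct `ε` in degree `r` by the Hasse derivatives of order `r`.
      let T : (ι → ℕ) → A →+ B := fun γ =>
        (AddMonoidHom.mulLeft ((δ - ε) (∏ i, w i ^ γ i))).comp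
          (φ.toAddMonoidHom.comp (h.hasse hA γ))
      have hlt : ∀ γ : ι → ℕ, ∑ i, γ i ≤ r → ∀ i, γ i < p ^ e := fun γ hγ i =>
        lt_of_le_of_lt (Finset.single_le_sum (fun _ _ => Nat.zero_le _) (Finset.mem_univ i))
          (by omega)
      have hT : ∀ γ ∈ Finset.piAntidiag (Finset.univ : Finset ι) r, Good (T γ) := by
        intro γ hγ
        rw [Finset.mem_piAntidiag] at hγ
        have hγ' := hlt γ hγ.1.le
        have hd := h.diffLT_hasse hA γ hγ'
        have hγ0 : γ ≠ 0 := by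
          rintro rfl
          have := hγ.1
          simp at this
          omega
        refine ⟨((hd.mono (by rw [hγ.1]; omega)).ringHom_comp (ψ := φ)).mul_left _, ?_⟩
        refine Ideal.mul_mem_left _ _ (Ideal.mem_map_of_mem φ ?_)
        exact mem_diffPlusIdeal (hd.mono (by rw [hγ.1]; omega)) (h.hasse_one hA γ hγ' hγ0) hm
      refine ⟨ε + ∑ γ ∈ Finset.piAntidiag Finset.univ r, T γ,
        ⟨hε.1.add (DiffLT.sum _ fun γ hγ => (hT γ hγ).1), ?_⟩, ?_⟩
      · rw [AddMonoidHom.add_apply, AddMonoidHom.finsetSum_apply]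
        exact add_mem hε.2 (sum_mem fun γ hγ => (hT γ hγ).2)
      · intro β hβr
        have hval : ∀ γ ∈ Finset.piAntidiag (Finset.univ : Finset ι) r, γ ≠ β →
            T γ (∏ i, w i ^ β i) = 0 := by
          intro γ hγ hne
          rw [Finset.mem_piAntidiag] at hγ
          have : ∃ i, β i < γ i := by
            by_contra hcon
            push Not at hcon
            refine hne (funext fun i => ?_)
            exact (Finset.sum_eq_sum_iff_of_le (fun i _ => hcon i)).mp
              (le_antisymm (Finset.sum_le_sum fun i _ => hcon i) (by rw [hγ.1]; omega)) i
                (Finset.mem_univ i)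
          obtain ⟨i, hi⟩ := this
          have h0 : ∏ i, (((β i).choose (γ i) : A) * w i ^ (β i - γ i)) = 0 :=
            Finset.prod_eq_zero (Finset.mem_univ i) (by
              rw [Nat.choose_eq_zero_of_lt hi, Nat.cast_zero, zero_mul])
          have hm := h.hasse_monomial hA γ (hlt γ hγ.1.le) β 1
          rw [one_pow, one_mul, one_mul, h0] at hm
          simp [T, hm]
        rw [← sub_sub, AddMonoidHom.sub_apply, AddMonoidHom.finsetSum_apply]
        rcases Nat.lt_succ_iff_lt_or_eq.mp hβr with hlt' | heq
        · rw [hβ β hlt', Finset.sum_eq_zero fun γ hγ => hval γ hγ ?_, sub_zero]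
          rintro rfl
          rw [Finset.mem_piAntidiag] at hγ
          exact hlt'.ne hγ.1
        · have hmem : β ∈ Finset.piAntidiag (Finset.univ : Finset ι) r := by
            rw [Finset.mem_piAntidiag]
            exact ⟨heq, fun i _ => Finset.mem_univ i⟩
          rw [Finset.sum_eq_single_of_mem β hmem hval]
          have hm := h.hasse_monomial hA β (hlt β heq.le) β 1
          simp only [one_pow, one_mul, Nat.choose_self, Nat.cast_one, Nat.sub_self, pow_zero,
            Finset.prod_const_one] at hm
          simp [T, hm]
  obtain ⟨ε, hε, hzero⟩ := hgood (n + 1) (by omega) le_rfl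
  have := DiffLT.eq_zero_of_monomials hB h (by omega) (hδ.sub hε.1) hzero
  rw [sub_eq_zero.mp this]
  exact hε.2

end BasisIdeal

/-! ### Regular local rings -/

section RegularLocal

open IsLocalRing

variable {R S : Type u} [CommRing R] [CommRing S]

/-- One element outside `m ^ 2` can be exchanged into a minimal system of generators of `m`. -/
theorem spanFinrank_maximalIdeal_quotient_lt [IsLocalRing R] [IsNoetherianRing R] {x : R}
    (hx : x ∈ maximalIdeal R) (hx2 : x ∉ maximalIdeal R ^ 2)
    [IsLocalRing (R ⧸ Ideal.span {x})] :
    (maximalIdeal (R ⧸ Ideal.span {x})).spanFinrank + 1 ≤ (maximalIdeal R).spanFinrank := by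
  have hfg := (maximalIdeal R).fg_of_isNoetherianRing
  have hfin := Submodule.FG.finite_generators hfg
  set s := Submodule.generators (maximalIdeal R) with hs
  have hspan : Ideal.span s = maximalIdeal R := Submodule.span_generators _
  -- A relation expressing `x` has a unit coefficient.
  classical
  obtain ⟨y, hy, a, ha, hxa⟩ : ∃ y ∈ s, ∃ a : R, IsUnit a ∧ x - a * y ∈ Ideal.span (s \ {y}) := by
    by_contra hcon
    push Not at hcon
    refine hx2 ?_
    rw [← hspan] at hx
    obtain ⟨c, hcs, hc⟩ := (Submodule.mem_span_set (R := R)).mp hx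
    rw [← hc]
    refine sum_mem fun y hy => ?_
    have hys : y ∈ s := hcs hy
    have hym : y ∈ maximalIdeal R := hspan ▸ Ideal.subset_span hys
    change c y * y ∈ _
    rw [pow_two]
    refine Ideal.mul_mem_mul ?_ hym
    rw [mem_maximalIdeal, mem_nonunits_iff]
    intro hu
    refine hcon y hys (c y) hu ?_
    have : x - c y * y = ∑ z ∈ c.support.erase y, c z * z := by
      rw [← hc, Finsupp.sum, ← Finset.add_sum_erase _ _ hy, smul_eq_mul, add_sub_cancel_left]
      rfl
    rw [this]
    refine sum_mem fun z hz => Ideal.mul_mem_left _ _ (Ideal.subset_span ⟨?_, ?_⟩)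
    · exact hcs (Finset.mem_of_mem_erase hz)
    · exact Finset.ne_of_mem_erase hz
  have hmax : Ideal.span (Ideal.Quotient.mk (Ideal.span {x}) '' (s \ {y})) =
      maximalIdeal (R ⧸ Ideal.span {x}) := by
    have h1 : maximalIdeal (R ⧸ Ideal.span {x}) =
        (maximalIdeal R).map (Ideal.Quotient.mk (Ideal.span {x})) := by
      rw [IsLocalRing.map_maximalIdeal_of_surjective _ Ideal.Quotient.mk_surjective]
    rw [h1, ← hspan, Ideal.map_span]
    refine le_antisymm (Ideal.span_mono (Set.image_mono Set.sdiff_subset)) ?_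
    rw [Ideal.span_le]
    rintro _ ⟨z, hz, rfl⟩
    by_cases hzy : z = y
    · subst hzy
      have h2 : Ideal.Quotient.mk (Ideal.span {x}) (x - a * z) ∈
          Ideal.span (Ideal.Quotient.mk (Ideal.span {x}) '' (s \ {z})) := by
        rw [← Ideal.map_span]
        exact Ideal.mem_map_of_mem _ hxa
      have h3 : Ideal.Quotient.mk (Ideal.span {x}) x = 0 :=
        Ideal.Quotient.eq_zero_iff_mem.mpr (Ideal.mem_span_singleton_self x)
      rw [map_sub, h3, zero_sub, neg_mem_iff, map_mul] at h2
      exact (Ideal.unit_mul_mem_iff_mem _ (ha.map _)).mp h2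
    · exact Ideal.subset_span ⟨z, ⟨hz, hzy⟩, rfl⟩
  have hfin' : (s \ {y}).Finite := hfin.subset Set.sdiff_subset
  rw [← hmax]
  have h1 : (Ideal.span (Ideal.Quotient.mk (Ideal.span {x}) '' (s \ {y}))).spanFinrank ≤
      (s \ {y}).ncard :=
    (Submodule.spanFinrank_span_le_ncard_of_finite (hfin'.image _)).trans
      (Set.ncard_image_le hfin')
  have h2 : (s \ {y}).ncard + 1 = (maximalIdeal R).spanFinrank := by
    rw [← Submodule.FG.generators_ncard hfg, Set.ncard_sdiff_singleton_add_one hy hfin]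
  omega

theorem isLocalRing_quotient_span_singleton [IsLocalRing R] {x : R} (hx : x ∈ maximalIdeal R) :
    IsLocalRing (R ⧸ Ideal.span {x}) := by
  have : Nontrivial (R ⧸ Ideal.span {x}) := Ideal.Quotient.nontrivial_iff.mpr fun h =>
    (Ideal.IsPrime.ne_top (maximalIdeal.isMaximal R).isPrime)
      (top_le_iff.mp (h ▸ (Ideal.span_singleton_le_iff_mem _).mpr hx))
  exact IsLocalRing.of_surjective' _ Ideal.Quotient.mk_surjective

theorem IsRegularLocalRing.quotient_span_singleton [IsRegularLocalRing R] {x : R}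
    (hx : x ∈ maximalIdeal R) (hx2 : x ∉ maximalIdeal R ^ 2)
    [IsLocalRing (R ⧸ Ideal.span {x})] :
    IsRegularLocalRing (R ⧸ Ideal.span {x}) ∧
      (maximalIdeal (R ⧸ Ideal.span {x})).spanFinrank + 1 = (maximalIdeal R).spanFinrank := by
  have h1 := spanFinrank_maximalIdeal_quotient_lt hx hx2
  have h2 : ((maximalIdeal R).spanFinrank : WithBot ℕ∞) = ringKrullDim R :=
    IsRegularLocalRing.spanFinrank_maximalIdeal
  have h3 : ringKrullDim R ≤ ringKrullDim (R ⧸ Ideal.span {x}) + 1 := by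
    have := ringKrullDim_le_ringKrullDim_quotient_add_card ({x} : Finset R) (by
      simpa [IsLocalRing.ringJacobson_eq_maximalIdeal] using hx)
    rw [Finset.coe_singleton, Finset.card_singleton] at this
    exact_mod_cast this
  have h4 := ringKrullDim_le_spanFinrank_maximalIdeal (R := R ⧸ Ideal.span {x})
  have h5 : ((maximalIdeal R).spanFinrank : WithBot ℕ∞) ≤
      ((maximalIdeal (R ⧸ Ideal.span {x})).spanFinrank : WithBot ℕ∞) + 1 := by
    rw [h2]; exact h3.trans (by gcongr)
  have h6 : (maximalIdeal R).spanFinrank ≤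
      (maximalIdeal (R ⧸ Ideal.span {x})).spanFinrank + 1 := by exact_mod_cast h5
  refine ⟨IsRegularLocalRing.of_spanFinrank_maximalIdeal_le _ ?_, by omega⟩
  have h7 : ((maximalIdeal (R ⧸ Ideal.span {x})).spanFinrank : WithBot ℕ∞) + 1 ≤
      ringKrullDim (R ⧸ Ideal.span {x}) + 1 := by
    refine le_trans ?_ (h2.le.trans h3)
    exact_mod_cast h1
  have hne : ringKrullDim (R ⧸ Ideal.span {x}) ≠ ⊥ := ringKrullDim_ne_bot
  obtain ⟨d, hd⟩ := WithBot.ne_bot_iff_exists.mp hne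
  rw [← hd] at h7 ⊢
  have h8 : (((maximalIdeal (R ⧸ Ideal.span {x})).spanFinrank + 1 : ℕ) : ℕ∞) ≤ d + 1 := by
    exact_mod_cast h7
  push_cast at h8
  exact_mod_cast (ENat.add_le_add_iff_right (by simp)).mp h8

theorem IsRegularLocalRing.exists_mem_notMem_sq [IsRegularLocalRing R]
    (h0 : (maximalIdeal R).spanFinrank ≠ 0) :
    ∃ x ∈ maximalIdeal R, x ∉ maximalIdeal R ^ 2 ∧ ∀ P ∈ minimalPrimes R, x ∉ P := by
  have hbot : maximalIdeal R ≠ ⊥ := fun h => h0 (by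
    rw [h]; simp)
  by_contra hcon
  push Not at hcon
  have hfin := minimalPrimes.finite_of_isNoetherianRing R
  have hsub : (maximalIdeal R : Set R) ⊆ ⋃ i ∈ (↑(insert (maximalIdeal R ^ 2) hfin.toFinset) :
      Set (Ideal R)), ((id i : Ideal R) : Set R) := by
    intro x hx
    by_cases hx2 : x ∈ maximalIdeal R ^ 2
    · exact Set.mem_biUnion (x := maximalIdeal R ^ 2) (by simp) hx2
    · obtain ⟨P, hP, hxP⟩ := hcon x hx hx2
      exact Set.mem_biUnion (x := P) (by simp [hP]) hxP
  rw [Ideal.subset_union_prime (maximalIdeal R ^ 2) (maximalIdeal R ^ 2) (by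
    intro i hi hne _
    have : i ∈ minimalPrimes R := by simpa [hne] using hi
    exact this.1.1)] at hsub
  obtain ⟨P, hP, hle⟩ := hsub
  rw [Finset.mem_insert, Set.Finite.mem_toFinset] at hP
  rcases hP with rfl | hP
  · refine hbot (Submodule.eq_bot_of_le_smul_of_le_jacobson_bot (maximalIdeal R) _
      (maximalIdeal R).fg_of_isNoetherianRing ?_
      (IsLocalRing.maximalIdeal_le_jacobson _))
    rw [smul_eq_mul, ← pow_two]; exact hle
  · have hPm : P = maximalIdeal R := le_antisymm (le_maximalIdeal hP.1.1.ne_top) hle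
    rw [hPm] at hP
    have h1 := Ideal.height_eq_zero_iff.mpr hP
    have h2 := maximalIdeal_height_eq_ringKrullDim (R := R)
    rw [h1, ← IsRegularLocalRing.spanFinrank_maximalIdeal (R := R)] at h2
    exact h0 (by exact_mod_cast h2.symm)

theorem IsRegularLocalRing.isDomain_of_spanFinrank (n : ℕ) : ∀ (R : Type u) [CommRing R]
    [IsRegularLocalRing R], (maximalIdeal R).spanFinrank = n → IsDomain R := by
  induction n with
  | zero =>
    intro R _ _ hn
    have hbot : maximalIdeal R = ⊥ := by
      have := (maximalIdeal R).fg_of_isNoetherianRing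
      exact (Submodule.spanFinrank_eq_zero_iff_eq_bot this).mp hn
    exact (IsLocalRing.isField_iff_maximalIdeal_eq.mpr hbot).isDomain
  | succ n ih =>
    intro R _ _ hn
    obtain ⟨x, hx, hx2, hxP⟩ := IsRegularLocalRing.exists_mem_notMem_sq (R := R) (by omega)
    have := isLocalRing_quotient_span_singleton hx
    obtain ⟨hreg, hdim⟩ := IsRegularLocalRing.quotient_span_singleton hx hx2
    have hdom := ih (R ⧸ Ideal.span {x}) (by omega)
    have hprime : (Ideal.span {x}).IsPrime := (Ideal.Quotient.isDomain_iff_prime _).mp hdom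
    obtain ⟨Q, hQ, hQx⟩ := Ideal.exists_minimalPrimes_le (I := ⊥) (J := Ideal.span {x}) bot_le
    have hQ0 : Q = ⊥ := by
      refine Submodule.eq_bot_of_le_smul_of_le_jacobson_bot (maximalIdeal R) Q
        Q.fg_of_isNoetherianRing (fun y hy => ?_) (IsLocalRing.maximalIdeal_le_jacobson _)
      obtain ⟨r, rfl⟩ := Ideal.mem_span_singleton.mp (hQx hy)
      exact Submodule.smul_mem_smul hx ((hQ.1.1.mem_or_mem hy).resolve_left (hxP Q hQ))
    have : (⊥ : Ideal R).IsPrime := hQ0 ▸ hQ.1.1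
    exact IsDomain.of_bot_isPrime R

/-- Regular local rings are domains. -/
theorem IsRegularLocalRing.isDomain (R : Type u) [CommRing R] [IsRegularLocalRing R] :
    IsDomain R :=
  IsRegularLocalRing.isDomain_of_spanFinrank _ R rfl

/-- The kernel of a proper surjection between regular local rings contains part of a regular
system of parameters. -/
theorem IsRegularLocalRing.exists_mem_ker_notMem_sq [IsRegularLocalRing R] [IsRegularLocalRing S]
    (φ : R →+* S) (hφ : Function.Surjective φ) (hker : RingHom.ker φ ≠ ⊥) :
    ∃ x ∈ RingHom.ker φ, x ∈ maximalIdeal R ∧ x ∉ maximalIdeal R ^ 2 := by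
  have := IsRegularLocalRing.isDomain R
  have hkm : RingHom.ker φ ≤ maximalIdeal R := le_maximalIdeal (RingHom.ker_ne_top φ)
  by_contra hcon
  push Not at hcon
  have hle : RingHom.ker φ ≤ maximalIdeal R ^ 2 := fun x hx => hcon x hx (hkm hx)
  have hfg := (maximalIdeal S).fg_of_isNoetherianRing
  have hfin := Submodule.FG.finite_generators hfg
  set s := Submodule.generators (maximalIdeal S) with hs
  have hspan : Ideal.span s = maximalIdeal S := Submodule.span_generators _
  let g : S → R := Function.surjInv hφ
  have hg : ∀ y, φ (g y) = y := Function.surjInv_eq hφ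
  have hmap : (maximalIdeal R).map φ = maximalIdeal S :=
    IsLocalRing.map_maximalIdeal_of_surjective _ hφ
  have hgm : Ideal.span (g '' s) ≤ maximalIdeal R := by
    rw [Ideal.span_le]
    rintro _ ⟨y, hy, rfl⟩
    have : φ (g y) ∈ maximalIdeal S := by rw [hg, ← hspan]; exact Ideal.subset_span hy
    rw [← hmap, Ideal.mem_map_iff_of_surjective φ hφ] at this
    obtain ⟨z, hz, hzy⟩ := this
    have h1 : g y - z ∈ RingHom.ker φ := by rw [RingHom.mem_ker, map_sub, hzy, sub_self]
    have := add_mem (hkm h1) hz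
    rwa [sub_add_cancel] at this
  have hgen : maximalIdeal R ≤ Ideal.span (g '' s) := by
    refine Submodule.le_of_le_smul_of_le_jacobson_bot (I := maximalIdeal R)
      (maximalIdeal R).fg_of_isNoetherianRing (IsLocalRing.maximalIdeal_le_jacobson _) ?_
    intro x hx
    have h1 : φ x ∈ (Ideal.span (g '' s)).map φ := by
      rw [Ideal.map_span, ← Set.image_comp]
      have : (φ ∘ g) '' s = s := by
        rw [show (φ ∘ g) = id from funext hg, Set.image_id]
      rw [this, hspan, ← hmap]
      exact Ideal.mem_map_of_mem _ hx
    rw [Ideal.mem_map_iff_of_surjective φ hφ] at h1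
    obtain ⟨z, hz, hzx⟩ := h1
    have h2 : x - z ∈ RingHom.ker φ := by rw [RingHom.mem_ker, map_sub, hzx, sub_self]
    have h3 : x = z + (x - z) := by ring
    rw [h3]
    refine Submodule.add_mem_sup hz ?_
    rw [smul_eq_mul, ← pow_two]
    exact hle h2
  have hrank : (maximalIdeal R).spanFinrank ≤ (maximalIdeal S).spanFinrank := by
    rw [le_antisymm hgen hgm, ← Submodule.FG.generators_ncard hfg]
    exact (Submodule.spanFinrank_span_le_ncard_of_finite (hfin.image _)).trans
      (Set.ncard_image_le hfin)
  obtain ⟨x, hx, hx0⟩ := Submodule.exists_mem_ne_zero_of_ne_bot hker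
  have hdim := ringKrullDim_succ_le_of_surjective φ hφ (mem_nonZeroDivisors_of_ne_zero hx0) hx
  rw [← IsRegularLocalRing.spanFinrank_maximalIdeal (R := R),
    ← IsRegularLocalRing.spanFinrank_maximalIdeal (R := S)] at hdim
  have : (maximalIdeal S).spanFinrank + 1 ≤ (maximalIdeal R).spanFinrank := by
    exact_mod_cast hdim
  omega

end RegularLocal

/-! ### Existence of `p`-bases -/

section PowSpan

open Matrix

variable {A B : Type*} [CommRing A] [CommRing B] {ι : Type*} [Fintype ι] [DecidableEq ι]
  {p e : ℕ} [hp : Fact p.Prime]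

theorem monomial_mem_range_powExpand (w : ι → A) (β : ι → ℕ) :
    ∏ i, w i ^ β i ∈ Set.range (powExpand (p ^ e) w) := by
  have hq : p ^ e ≠ 0 := pow_ne_zero e hp.out.ne_zero
  refine ⟨Pi.single (fun i => ⟨β i % p ^ e, Nat.mod_lt _ (Nat.pos_of_ne_zero hq)⟩)
    (∏ i, w i ^ (β i / p ^ e)), ?_⟩
  rw [powExpand_single hq, ← Finset.prod_pow, ← Finset.prod_mul_distrib]
  refine Finset.prod_congr rfl fun i _ => ?_
  rw [← pow_mul, ← pow_add, mul_comm, Nat.div_add_mod]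

/-- The subring `A ^ q [w]` of all elements with an expansion in monomials. -/
def powExpandRange (hA : (p : A) = 0) (e : ℕ) (w : ι → A) : Subring A where
  carrier := Set.range (powExpand (p ^ e) w)
  one_mem' := by simpa using monomial_mem_range_powExpand (p := p) (e := e) w 0
  zero_mem' := ⟨0, powExpand_zero (pow_ne_zero e hp.out.ne_zero) w⟩
  add_mem' := by
    rintro _ _ ⟨c, rfl⟩ ⟨d, rfl⟩
    exact ⟨c + d, powExpand_add hA w c d⟩
  neg_mem' := by
    rintro _ ⟨c, rfl⟩
    exact ⟨0 - c, by
      rw [powExpand_sub hA, powExpand_zero (pow_ne_zero e hp.out.ne_zero), zero_sub]⟩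
  mul_mem' := by
    rintro _ _ ⟨c, rfl⟩ ⟨d, rfl⟩
    rw [powExpand, powExpand, Finset.sum_mul]
    simp only [mul_assoc]
    refine sum_mem_range_powExpand hA w _ _ _ fun γ _ => ?_
    simp only [Finset.mul_sum, mul_left_comm (∏ i, w i ^ (γ i : ℕ)), ← Finset.prod_mul_distrib,
      ← pow_add]
    refine sum_mem_range_powExpand hA w _ _ _ fun δ _ => ?_
    exact monomial_mem_range_powExpand w fun i => (γ i : ℕ) + δ i

theorem mem_powExpandRange {hA : (p : A) = 0} {w : ι → A} {a : A} :
    a ∈ powExpandRange hA e w ↔ ∃ c, powExpand (p ^ e) w c = a := Iff.rfl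

theorem mem_powExpandRange_one {hA : (p : A) = 0} {w : ι → A} {a : A} :
    a ∈ powExpandRange hA 1 w ↔ ∃ c, powExpand p w c = a := by
  rw [mem_powExpandRange, pow_one]

theorem pow_mem_powExpandRange (hA : (p : A) = 0) (w : ι → A) (a : A) :
    a ^ p ^ e ∈ powExpandRange hA e w := by
  have := sum_mem_range_powExpand (e := e) hA w {()} (fun _ => a) (fun _ => 1) (fun _ _ => by
    simpa using monomial_mem_range_powExpand (p := p) (e := e) w 0)
  rwa [Finset.sum_singleton, mul_one] at this

theorem apply_mem_powExpandRange (hA : (p : A) = 0) (w : ι → A) (i : ι) :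
    w i ∈ powExpandRange hA e w := by
  have := monomial_mem_range_powExpand (p := p) (e := e) w (Pi.single i 1)
  rw [Finset.prod_eq_single i (by intro j _ hj; simp [hj]) (by simp),
    Pi.single_eq_same, pow_one] at this
  exact this

theorem powExpand_cons {q n : ℕ} (x : A) (z : Fin n → A) (c : (Fin (n + 1) → Fin q) → A) :
    powExpand q (Fin.cons x z : Fin (n + 1) → A) c =
      ∑ j : Fin q, x ^ (j : ℕ) * powExpand q z fun γ => c (Fin.cons j γ) := by
  rw [powExpand, ← (Fin.consEquiv (fun _ : Fin (n + 1) => Fin q)).sum_comp, Fintype.sum_prod_type]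
  refine Finset.sum_congr rfl fun j _ => ?_
  rw [powExpand, Finset.mul_sum]
  refine Finset.sum_congr rfl fun γ _ => ?_
  simp only [Fin.consEquiv_apply, Fin.prod_univ_succ, Fin.cons_zero, Fin.cons_succ]
  exact mul_left_comm _ _ _

/-- `A` is finite over its subring of `q`-th powers. -/
def IsPowFinite (q : ℕ) (A : Type*) [CommRing A] : Prop :=
  ∃ (n : ℕ) (g : Fin n → A), ∀ a : A, ∃ c : Fin n → A, a = ∑ j, c j ^ q * g j

theorem IsPowFinite.of_finite (hA : (p : A) = 0) [Module.Finite (powSubring A p) A] :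
    IsPowFinite p A := by
  obtain ⟨n, g, hg⟩ := Module.Finite.exists_fin (R := powSubring A p) (M := A)
  refine ⟨n, g, fun a => ?_⟩
  have ha : a ∈ Submodule.span (powSubring A p) (Set.range g) := hg ▸ Submodule.mem_top
  obtain ⟨c, rfl⟩ := (Submodule.mem_span_range_iff_exists_fun _).mp ha
  have hc : ∀ j, ∃ d : A, d ^ p = c j := fun j => by
    have := (mem_powSubring_iff hA 1 (c j : A)).mp (by rw [pow_one]; exact (c j).2)
    simpa using this
  choose d hd using hc
  exact ⟨d, Finset.sum_congr rfl fun j _ => by rw [hd]; rfl⟩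

theorem IsPowFinite.of_surjective {q : ℕ} (h : IsPowFinite q A) (φ : A →+* B)
    (hφ : Function.Surjective φ) : IsPowFinite q B := by
  obtain ⟨n, g, hg⟩ := h
  refine ⟨n, φ ∘ g, fun b => ?_⟩
  obtain ⟨a, rfl⟩ := hφ b
  obtain ⟨c, hc⟩ := hg a
  exact ⟨φ ∘ c, by rw [hc]; simp⟩

theorem exists_eq_sum_of_isLocalization {q n : ℕ} (hq : q ≠ 0) {g : Fin n → A}
    (hg : ∀ a : A, ∃ c : Fin n → A, a = ∑ j, c j ^ q * g j) (M : Submonoid A)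
    [Algebra A B] [IsLocalization M B] (b : B) :
    ∃ c : Fin n → B, b = ∑ j, c j ^ q * algebraMap A B (g j) := by
  obtain ⟨⟨a, s⟩, has⟩ := IsLocalization.surj M b
  obtain ⟨v, hv⟩ := IsLocalization.map_units B s
  obtain ⟨c, hc⟩ := hg ((s : A) ^ (q - 1) * a)
  refine ⟨fun j => ((v⁻¹ : Bˣ) : B) * algebraMap A B (c j), ?_⟩
  have h1 : (v : B) ^ q * b = algebraMap A B ((s : A) ^ (q - 1) * a) := by
    rw [map_mul, ← has, map_pow, hv, ← mul_pow_sub_one hq]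
    ring
  have h2 : b = ((v⁻¹ : Bˣ) : B) ^ q * ((v : B) ^ q * b) := by
    rw [← mul_assoc, ← mul_pow, Units.inv_mul, one_pow, one_mul]
  rw [h2, h1, hc, map_sum, Finset.mul_sum]
  refine Finset.sum_congr rfl fun j _ => ?_
  simp only [map_mul, map_pow, mul_pow]
  ring

theorem IsPowFinite.localization {q : ℕ} (hq : q ≠ 0) (h : IsPowFinite q A) (M : Submonoid A)
    [Algebra A B] [IsLocalization M B] : IsPowFinite q B := by
  obtain ⟨n, g, hg⟩ := h
  exact ⟨n, _, exists_eq_sum_of_isLocalization hq hg M⟩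

theorem IsPowFinite.pow_prime (hA : (p : A) = 0) (h : IsPowFinite p A) (e : ℕ) :
    IsPowFinite (p ^ e) A := by
  obtain ⟨n, g, hg⟩ := h
  induction e with
  | zero => exact ⟨1, fun _ => 1, fun a => ⟨fun _ => a, by simp⟩⟩
  | succ e ih =>
    obtain ⟨m, k, hk⟩ := ih
    refine ⟨n * m, fun t => g (finProdFinEquiv.symm t).1 * k (finProdFinEquiv.symm t).2 ^ p,
      fun a => ?_⟩
    obtain ⟨c, hc⟩ := hg a
    choose d hd using fun j => hk (c j)
    refine ⟨fun t => d (finProdFinEquiv.symm t).1 (finProdFinEquiv.symm t).2, ?_⟩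
    rw [← finProdFinEquiv.sum_comp, Fintype.sum_prod_type, hc]
    simp only [Equiv.symm_apply_apply]
    refine Finset.sum_congr rfl fun j _ => ?_
    have hfr : ∀ x : A, x ^ p = frobPow p 1 hA x := by simp
    conv_lhs => rw [hd j, hfr, map_sum, Finset.sum_mul]
    refine Finset.sum_congr rfl fun i _ => ?_
    rw [map_mul, ← hfr, ← hfr, ← pow_mul, ← pow_succ]
    ring

/-- In the field case, a new element outside `k ^ p [w]` keeps monomials independent. -/
theorem powExpand_cons_injective_of_field {k : Type*} [Field k] (hA : (p : k) = 0) {n : ℕ}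
    {w : Fin n → k} (hw : Function.Injective (powExpand p w)) {x : k}
    (hx : x ∉ powExpandRange hA 1 w) :
    Function.Injective (powExpand p (Fin.cons x w : Fin (n + 1) → k)) := by
  have hcons := powExpand_injective_iff (e := 1) hA (Fin.cons x w : Fin (n + 1) → k)
  rw [pow_one] at hcons
  rw [hcons]
  intro c hc
  have : CharP k p := (CharP.charP_iff_prime_eq_zero hp.out).mpr hA
  have hpow : ∀ y : k, y ^ p ∈ powExpandRange hA 1 w := fun y => by
    simpa using pow_mem_powExpandRange (e := 1) hA w y
  let L : Subfield k :=
    { powExpandRange hA 1 w with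
      inv_mem' := fun y hy => by
        rcases eq_or_ne y 0 with rfl | hy0
        · simp
        have : y⁻¹ = y⁻¹ ^ p * y ^ (p - 1) := by
          rw [← mul_pow_sub_one hp.out.ne_zero y⁻¹, mul_assoc, ← mul_pow, inv_mul_cancel₀ hy0,
            one_pow, mul_one]
        change y⁻¹ ∈ powExpandRange hA 1 w
        rw [this]
        exact mul_mem (hpow _) (pow_mem hy _) }
  have hL : ∀ y, y ∈ L ↔ y ∈ powExpandRange hA 1 w := fun _ => Iff.rfl
  let a : L := ⟨x ^ p, hpow x⟩
  have hirr : Irreducible (Polynomial.X ^ p - Polynomial.C a : Polynomial L) := by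
    refine X_pow_sub_C_irreducible_of_prime hp.out fun b hb => hx ?_
    have h1 : (b : k) ^ p = x ^ p := congrArg Subtype.val hb
    have h2 : (b : k) - x = 0 := by
      rw [← pow_eq_zero_iff hp.out.ne_zero, sub_pow_char, h1, sub_self]
    rw [← sub_eq_zero.mp h2]
    exact b.2
  have hmin : (Polynomial.X ^ p - Polynomial.C a : Polynomial L) = minpoly L x := by
    refine minpoly.eq_of_irreducible_of_monic hirr ?_
      (Polynomial.monic_X_pow_sub_C a hp.out.ne_zero)
    simp only [map_sub, map_pow, Polynomial.aeval_X, Polynomial.aeval_C]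
    exact sub_self _
  let y : Fin p → L := fun j => ⟨powExpand p w fun γ => c (Fin.cons j γ),
    (hL _).mpr (mem_powExpandRange_one.mpr ⟨_, rfl⟩)⟩
  let f : Polynomial L := ∑ j : Fin p, Polynomial.monomial (j : ℕ) (y j)
  have hf : Polynomial.aeval x f = 0 := by
    rw [powExpand_cons] at hc
    rw [map_sum, ← hc]
    refine Finset.sum_congr rfl fun j _ => ?_
    rw [Polynomial.aeval_monomial, mul_comm]
    rfl
  have hf0 : f = 0 := by
    by_contra hne
    have h1 := minpoly.degree_le_of_ne_zero L x hne hf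
    rw [← hmin, Polynomial.degree_X_pow_sub_C hp.out.pos] at h1
    have h2 : f.degree < p := by
      refine (Polynomial.degree_sum_le _ _).trans_lt ?_
      rw [Finset.sup_lt_iff (WithBot.bot_lt_coe _)]
      exact fun j _ => (Polynomial.degree_monomial_le _ _).trans_lt (by exact_mod_cast j.2)
    exact absurd (h1.trans_lt h2) (lt_irrefl _)
  have hy : ∀ j, y j = 0 := fun j => by
    have := congrArg (fun g => Polynomial.coeff g (j : ℕ)) hf0
    simp only [f, Polynomial.finsetSum_coeff, Polynomial.coeff_monomial, Polynomial.coeff_zero,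
      Fin.val_inj] at this
    simpa using this
  have hw' := powExpand_injective_iff (e := 1) hA w
  rw [pow_one] at hw'
  funext γ
  have h1 := congrFun (hw'.mp hw _ (congrArg Subtype.val (hy (γ 0)))) (Fin.tail γ)
  simpa using h1

theorem exists_isPowBasis_of_field {k : Type*} [Field k] (hA : (p : k) = 0)
    (hk : IsPowFinite p k) : ∃ (n : ℕ) (w : Fin n → k), IsPowBasis p w := by
  classical
  obtain ⟨m, g, hg⟩ := hk
  -- Adjoin generators one at a time; the number of missing ones drops.
  have key : ∀ (N n : ℕ) (w : Fin n → k), Function.Injective (powExpand p w) →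
      (Finset.univ.filter fun j => g j ∉ powExpandRange hA 1 w).card ≤ N →
      ∃ (n : ℕ) (w : Fin n → k), IsPowBasis p w := by
    intro N
    induction N with
    | zero =>
      intro n w hw hN
      refine ⟨n, w, hw, fun a => ?_⟩
      obtain ⟨c, rfl⟩ := hg a
      have := sum_mem_range_powExpand (e := 1) hA w Finset.univ c g (fun j _ => by
        by_contra hj
        have h1 : j ∈ Finset.univ.filter fun j => g j ∉ powExpandRange hA 1 w :=
          Finset.mem_filter.mpr ⟨Finset.mem_univ j, hj⟩
        have h2 := Finset.card_pos.mpr ⟨j, h1⟩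
        omega)
      rwa [pow_one] at this
    | succ N ih =>
      intro n w hw hN
      by_cases hall : ∀ j, g j ∈ powExpandRange hA 1 w
      · exact ih n w hw (by
          rw [Finset.filter_false_of_mem fun j _ => not_not.mpr (hall j)]; simp)
      push Not at hall
      obtain ⟨j, hj⟩ := hall
      refine ih (n + 1) _ (powExpand_cons_injective_of_field hA hw hj) ?_
      refine Nat.lt_succ_iff.mp (lt_of_lt_of_le (Finset.card_lt_card ?_) hN)
      have hle : powExpandRange hA 1 w ≤ powExpandRange hA 1 (Fin.cons (g j) w) := by
        rintro _ ⟨c, rfl⟩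
        refine sum_mem fun γ _ => mul_mem (pow_mem_powExpandRange hA _ _)
          (prod_mem fun i _ => pow_mem ?_ _)
        have := apply_mem_powExpandRange (e := 1) hA (Fin.cons (g j) w : Fin (n + 1) → k) i.succ
        rwa [Fin.cons_succ] at this
      refine (Finset.ssubset_iff_of_subset fun i hi => ?_).mpr ⟨j, ?_, ?_⟩
      · rw [Finset.mem_filter] at hi ⊢
        exact ⟨hi.1, fun h => hi.2 (hle h)⟩
      · simpa using hj
      · have := apply_mem_powExpandRange (e := 1) hA (Fin.cons (g j) w : Fin (n + 1) → k) 0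
        rw [Fin.cons_zero] at this
        simpa using this
  refine key _ 0 Fin.elim0 ?_ le_rfl
  have hcons := powExpand_injective_iff (e := 1) hA (Fin.elim0 : Fin 0 → k)
  rw [pow_one] at hcons
  rw [hcons]
  intro c hc
  funext γ
  have : ∀ δ : Fin 0 → Fin p, δ = γ := fun δ => Subsingleton.elim _ _
  rw [powExpand, Finset.sum_eq_single γ (fun δ _ h => absurd (this δ) h)
    (fun h => absurd (Finset.mem_univ _) h),
    Fin.prod_univ_zero, mul_one] at hc
  exact (pow_eq_zero_iff hp.out.ne_zero).mp hc

/-- A basis of `A / (x)` lifts to a basis of `A` after adjoining `x`: independence follows from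
Krull's intersection theorem, generation by a Nakayama argument, in the form of the inversion of a
matrix congruent to the identity. -/
theorem IsPowBasis.cons [IsLocalRing A] [IsNoetherianRing A] [IsDomain A] (hA : (p : A) = 0)
    (hfin : IsPowFinite (p ^ e) A) {x : A} (hx : x ∈ IsLocalRing.maximalIdeal A) (hx0 : x ≠ 0)
    (φ : A →+* B) (hφ : Function.Surjective φ) (hker : RingHom.ker φ = Ideal.span {x}) {n : ℕ}
    {z : Fin n → A} (hz : IsPowBasis (p ^ e) (φ ∘ z)) :
    IsPowBasis (p ^ e) (Fin.cons x z : Fin (n + 1) → A) := by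
  have hB : (p : B) = 0 := by rw [← map_natCast φ, hA, map_zero]
  have hq : p ^ e ≠ 0 := pow_ne_zero e hp.out.ne_zero
  have hφx : ∀ a, φ a = 0 ↔ x ∣ a := fun a => by
    rw [← RingHom.mem_ker, hker, Ideal.mem_span_singleton]
  constructor
  · rw [powExpand_injective_iff hA]
    have hdvd : ∀ c, powExpand (p ^ e) (Fin.cons x z : Fin (n + 1) → A) c = 0 →
        ∀ γ, x ∣ c γ := by
      intro c hc
      rw [powExpand_cons] at hc
      have hj : ∀ N : ℕ, ∀ j : Fin (p ^ e), (j : ℕ) = N → ∀ γ, x ∣ c (Fin.cons j γ) := by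
        intro N
        induction N using Nat.strong_induction_on with
        | _ N ih =>
          intro j hjN γ
          rw [← Finset.add_sum_erase _ _ (Finset.mem_univ j)] at hc
          have h1 : x ^ ((j : ℕ) + 1) ∣ x ^ (j : ℕ) *
              powExpand (p ^ e) z fun γ => c (Fin.cons j γ) := by
            rw [eq_neg_of_add_eq_zero_left hc, dvd_neg]
            refine Finset.dvd_sum fun i hi => ?_
            rcases lt_or_gt_of_ne (fun h => Finset.ne_of_mem_erase hi (Fin.ext h) :
              (i : ℕ) ≠ j) with hij | hij
            · refine Dvd.dvd.mul_left (Finset.dvd_sum fun δ _ => Dvd.dvd.mul_right ?_ _) _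
              exact (pow_dvd_pow x j.2).trans
                (pow_dvd_pow_of_dvd (ih i (by omega) i rfl δ) _)
            · exact Dvd.dvd.mul_right (pow_dvd_pow x hij) _
          rw [pow_succ, mul_dvd_mul_iff_left (pow_ne_zero _ hx0), ← hφx, ← powExpand_map] at h1
          rw [← hφx]
          exact congrFun ((powExpand_injective_iff hB _).mp hz.injective _ h1) γ
      intro γ
      have := hj _ (γ 0) rfl (Fin.tail γ)
      rwa [Fin.cons_self_tail] at this
    have hpow : ∀ N : ℕ, ∀ c, powExpand (p ^ e) (Fin.cons x z : Fin (n + 1) → A) c = 0 →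
        ∀ γ, x ^ N ∣ c γ := by
      intro N
      induction N with
      | zero => intro c _ γ; simp
      | succ N ih =>
        intro c hc γ
        choose d hd using hdvd c hc
        have h1 : powExpand (p ^ e) (Fin.cons x z : Fin (n + 1) → A) d = 0 := by
          have : c = fun γ => x * d γ := funext hd
          rw [this, ← pow_mul_powExpand] at hc
          exact (mul_eq_zero.mp hc).resolve_left (pow_ne_zero _ hx0)
        rw [hd γ, pow_succ']
        exact mul_dvd_mul_left x (ih d h1 γ)
    intro c hc
    funext γ
    have h1 : c γ ∈ ⨅ i : ℕ, IsLocalRing.maximalIdeal A ^ i := by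
      rw [Submodule.mem_iInf]
      intro N
      exact Ideal.mem_of_dvd _ (hpow N c hc γ) (Ideal.pow_mem_pow hx N)
    rw [Ideal.iInf_pow_eq_bot_of_isLocalRing _ (Ideal.IsPrime.ne_top inferInstance)] at h1
    exact h1
  · have happrox : ∀ N, N ≤ p ^ e → ∀ a, ∃ y ∈ powExpandRange hA e (Fin.cons x z : Fin (n + 1) → A),
        ∃ b, a = y + x ^ N * b := by
      intro N
      have hxm : x ∈ powExpandRange hA e (Fin.cons x z : Fin (n + 1) → A) := by
        simpa using apply_mem_powExpandRange (e := e) hA (Fin.cons x z : Fin (n + 1) → A) 0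
      induction N with
      | zero => intro _ a; exact ⟨0, zero_mem _, a, by simp⟩
      | succ N ih =>
        intro hN a
        obtain ⟨y, hy, b, hb⟩ := ih (by omega) a
        obtain ⟨c, hc⟩ := hz.surjective (φ b)
        choose d hd using fun γ => hφ (c γ)
        have h1 : φ (b - powExpand (p ^ e) z d) = 0 := by
          rw [map_sub, ← powExpand_map, Function.comp_def φ d]
          simp only [hd]
          rw [hc, sub_self]
        obtain ⟨b', hb'⟩ := (hφx _).mp h1
        refine ⟨y + x ^ N * powExpand (p ^ e) z d, add_mem hy (mul_mem (pow_mem hxm N) ?_), b', ?_⟩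
        · refine sum_mem fun γ _ => mul_mem (pow_mem_powExpandRange hA _ _)
            (prod_mem fun i _ => pow_mem ?_ _)
          have := apply_mem_powExpandRange (e := e) hA (Fin.cons x z : Fin (n + 1) → A) i.succ
          rwa [Fin.cons_succ] at this
        · rw [hb, pow_succ, mul_assoc, ← hb']; ring
    obtain ⟨m, g, hg⟩ := hfin
    choose y hy b hb using fun i => happrox (p ^ e) le_rfl (g i)
    choose d hd using fun i => hg (b i)
    let f := frobPow p e hA
    let D : Matrix (Fin m) (Fin m) A := Matrix.of d
    let T : Matrix (Fin m) (Fin m) A := 1 - x • D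
    have hT : IsUnit T.det := by
      rw [← IsLocalRing.notMem_maximalIdeal, ← IsLocalRing.residue_eq_zero_iff, RingHom.map_det]
      have : (IsLocalRing.residue A).mapMatrix T = 1 := by
        have hx' : IsLocalRing.residue A x = 0 := (IsLocalRing.residue_eq_zero_iff x).mpr hx
        ext i j
        simp only [T, RingHom.mapMatrix_apply, Matrix.map_apply, Matrix.sub_apply,
          Matrix.smul_apply, smul_eq_mul, map_sub, map_mul, hx', zero_mul, sub_zero,
          Matrix.one_apply]
        split_ifs <;> simp
      rw [this]; simp
    have hmul : T.map f *ᵥ g = y := by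
      funext i
      have h1 : ∀ j, T.map f i j = (1 : Matrix (Fin m) (Fin m) A) i j - x ^ p ^ e * d i j ^ p ^ e := by
        intro j
        simp only [T, Matrix.map_apply, Matrix.sub_apply, Matrix.smul_apply, smul_eq_mul, map_sub,
          map_mul, f, frobPow_apply, D, Matrix.of_apply]
        congr 1
        rw [Matrix.one_apply]
        split_ifs
        · exact one_pow _
        · exact zero_pow hq
      have h2 : (T.map f *ᵥ g) i = g i - x ^ p ^ e * ∑ j, d i j ^ p ^ e * g j := by
        simp only [Matrix.mulVec, dotProduct, h1, sub_mul, Finset.sum_sub_distrib, Finset.mul_sum,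
          mul_assoc]
        congr 1
        simp [Matrix.one_apply]
      rw [h2, ← hd i]
      conv_lhs => rw [hb i]
      ring
    have hg' : g = T⁻¹.map f *ᵥ y := by
      rw [← hmul, Matrix.mulVec_mulVec]
      have : T⁻¹.map f * T.map f = 1 := by
        rw [← Matrix.map_mul, Matrix.nonsing_inv_mul T hT]
        simp
      rw [this, Matrix.one_mulVec]
    intro a
    obtain ⟨c, rfl⟩ := hg a
    refine sum_mem_range_powExpand hA _ _ _ _ fun i _ => ?_
    rw [hg']
    exact sum_mem_range_powExpand hA _ Finset.univ (fun j => T⁻¹ i j) y fun j _ => hy j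

end PowSpan

section RegularPowBasis

open IsLocalRing

/-- An `F`-finite regular local ring has a `p`-basis containing generators of the kernel of any
given surjection onto a regular local ring. -/
theorem IsRegularLocalRing.exists_isPowBasis {p : ℕ} [hp : Fact p.Prime] (R S : Type u) [CommRing R]
    [CommRing S] [IsRegularLocalRing R] [IsRegularLocalRing S] (hR : (p : R) = 0)
    (hfin : IsPowFinite p R) (φ : R →+* S) (hφ : Function.Surjective φ) :
    ∃ (n : ℕ) (w : Fin n → R) (J : Finset (Fin n)),
      IsPowBasis p w ∧ RingHom.ker φ = Ideal.span (w '' J) := by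
  generalize hn : (maximalIdeal R).spanFinrank = N
  induction N generalizing R S with
  | zero =>
    have hbot : maximalIdeal R = ⊥ := by
      have := (maximalIdeal R).fg_of_isNoetherianRing
      exact (Submodule.spanFinrank_eq_zero_iff_eq_bot this).mp hn
    have hf := IsLocalRing.isField_iff_maximalIdeal_eq.mpr hbot
    let _ := hf.toField
    obtain ⟨n, w, hw⟩ := exists_isPowBasis_of_field hR hfin
    refine ⟨n, w, ∅, hw, ?_⟩
    have : RingHom.ker φ ≤ maximalIdeal R := le_maximalIdeal (RingHom.ker_ne_top φ)
    rw [hbot] at this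
    simpa using this
  | succ N ih =>
    have hdom := IsRegularLocalRing.isDomain R
    have step : ∀ (S : Type u) [CommRing S] [IsRegularLocalRing S] (φ : R →+* S),
        Function.Surjective φ → RingHom.ker φ ≠ ⊥ →
        ∃ (n : ℕ) (w : Fin n → R) (J : Finset (Fin n)),
          IsPowBasis p w ∧ RingHom.ker φ = Ideal.span (w '' J) := by
      intro S _ _ φ hφ hker
      obtain ⟨x, hxker, hx, hx2⟩ := exists_mem_ker_notMem_sq φ hφ hker
      have hx0 : x ≠ 0 := fun h => hx2 (h ▸ zero_mem _)
      have := isLocalRing_quotient_span_singleton hx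
      obtain ⟨hreg, hdim⟩ := quotient_span_singleton hx hx2
      let mk := Ideal.Quotient.mk (Ideal.span {x})
      have hmk : Function.Surjective mk := Ideal.Quotient.mk_surjective
      let ψ : R ⧸ Ideal.span {x} →+* S := Ideal.Quotient.lift _ φ fun a ha => by
        obtain ⟨b, rfl⟩ := Ideal.mem_span_singleton.mp ha
        rw [map_mul, RingHom.mem_ker.mp hxker, zero_mul]
      have hψmk : ∀ a, ψ (mk a) = φ a := fun a => Ideal.Quotient.lift_mk _ _ _
      have hψ : Function.Surjective ψ := fun s => by
        obtain ⟨a, rfl⟩ := hφ s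
        exact ⟨mk a, hψmk a⟩
      obtain ⟨n, z', J, hz', hJ⟩ := ih (R ⧸ Ideal.span {x}) S
        (by rw [← map_natCast mk, hR, map_zero]) (hfin.of_surjective mk hmk) ψ hψ (by omega)
      choose z hz using fun i => hmk (z' i)
      have hzz : mk ∘ z = z' := funext hz
      rw [← hzz] at hz' hJ
      refine ⟨n + 1, Fin.cons x z, insert 0 (J.map (Fin.succEmb n)), ?_, ?_⟩
      · have := IsPowBasis.cons (e := 1) hR (by rwa [pow_one]) hx hx0 mk hmk
          (Ideal.mk_ker) (z := z) (by rwa [pow_one])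
        rwa [pow_one] at this
      · have himg : (Fin.cons x z : Fin (n + 1) → R) ''
            (insert 0 (J.map (Fin.succEmb n)) : Finset (Fin (n + 1))) = insert x (z '' J) := by
          rw [Finset.coe_insert, Set.image_insert_eq, Fin.cons_zero, Finset.coe_map,
            Set.image_image]
          simp
        rw [himg]
        ext a
        rw [RingHom.mem_ker, ← hψmk, ← RingHom.mem_ker, hJ, Set.image_comp, ← Ideal.map_span,
          Ideal.mem_quotient_iff_mem_sup, Ideal.span_insert, sup_comm]
    by_cases hker : RingHom.ker φ = ⊥
    · have hres : RingHom.ker (residue R) ≠ ⊥ := by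
        rw [ker_residue]
        intro h
        rw [h] at hn
        simp at hn
      obtain ⟨n, w, -, hw, -⟩ := step (ResidueField R) (residue R) residue_surjective hres
      exact ⟨n, w, ∅, hw, by simpa using hker⟩
    · exact step S φ hφ hker

end RegularPowBasis

/-! ### Spreading out `p`-bases -/

section SpreadOut

variable {A B : Type*} [CommRing A] [CommRing B] [Algebra A B]

theorem exists_mul_mem_of_map_le (M : Submonoid A) [IsLocalization M B] {I I' : Ideal A}
    (hfg : I.FG) (h : I.map (algebraMap A B) ≤ I'.map (algebraMap A B)) :
    ∃ s ∈ M, ∀ a ∈ I, s * a ∈ I' := by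
  classical
  obtain ⟨T, rfl⟩ := hfg
  have h1 : ∀ a ∈ T, ∃ s ∈ M, s * a ∈ I' := fun a ha =>
    (IsLocalization.algebraMap_mem_map_algebraMap_iff M B I' a).mp
      (h (Ideal.mem_map_of_mem _ (Ideal.subset_span ha)))
  choose! s hsM hs using h1
  refine ⟨∏ a ∈ T, s a, prod_mem fun a ha => hsM a ha, fun a ha => ?_⟩
  have : Ideal.span (T : Set A) ≤ I'.colon {∏ a ∈ T, s a} := by
    rw [Ideal.span_le]
    intro b hb
    rw [SetLike.mem_coe, Submodule.mem_colon_singleton, smul_eq_mul,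
      ← Finset.prod_erase_mul _ _ (Finset.mem_coe.mp hb), mul_comm, mul_assoc]
    exact I'.mul_mem_left _ (hs b hb)
  have h2 := this ha
  rwa [Submodule.mem_colon_singleton, smul_eq_mul, mul_comm] at h2

theorem mul_mem_map_away {f : A} [IsLocalization.Away f B] {I I' : Ideal A} {s : A} (hs : s ∣ f)
    (h : ∀ a ∈ I, s * a ∈ I') : I.map (algebraMap A B) ≤ I'.map (algebraMap A B) := by
  rw [Ideal.map_le_iff_le_comap]
  intro a ha
  have hu : IsUnit (algebraMap A B s) :=
    isUnit_of_dvd_unit (map_dvd _ hs) (IsLocalization.Away.algebraMap_isUnit f)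
  rw [Ideal.mem_comap, ← Ideal.unit_mul_mem_iff_mem _ hu, ← map_mul]
  exact Ideal.mem_map_of_mem _ (h a ha)

/-- A `p`-basis of a local ring of `A` is, up to scaling, a `p`-basis of a basic open
neighbourhood. -/
theorem IsPowBasis.spread_out {A R : Type u} [CommRing A] [CommRing R] [Algebra A R]
    [IsNoetherianRing A] [IsDomain A] {p : ℕ} [hp : Fact p.Prime] (hA : (p : A) = 0)
    (hfin : IsPowFinite p A) (P : Ideal A) [P.IsPrime] [IsLocalization.AtPrime R P] {n : ℕ}
    {w₀ : Fin n → R} (hw : IsPowBasis p w₀) (J : Finset (Fin n)) (I : Ideal A)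
    (hI : I.map (algebraMap A R) = Ideal.span (w₀ '' J)) :
    ∃ f ∉ P, ∃ w : Fin n → A, ∀ (B : Type u) [CommRing B] [Algebra A B]
      [IsLocalization.Away f B], IsPowBasis p (algebraMap A B ∘ w) ∧
        I.map (algebraMap A B) = Ideal.span ((algebraMap A B ∘ w) '' J) := by
  have hM : P.primeCompl ≤ nonZeroDivisors A :=
    le_nonZeroDivisors_of_noZeroDivisors fun h => h P.zero_mem
  have hinj : Function.Injective (algebraMap A R) := IsLocalization.injective R hM
  have hR : (p : R) = 0 := by rw [← map_natCast (algebraMap A R), hA, map_zero]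
  obtain ⟨s, hs⟩ := IsLocalization.exist_integer_multiples_of_finite P.primeCompl w₀
  choose a ha using hs
  obtain ⟨u, hu⟩ := IsLocalization.map_units R s
  let w : Fin n → A := fun i => (s : A) ^ (p - 1) * a i
  have hww : algebraMap A R ∘ w = fun i => (u : R) ^ p * w₀ i := by
    funext i
    simp only [w, Function.comp_apply, map_mul, map_pow, ha, Algebra.smul_def, ← hu]
    rw [← mul_assoc, pow_sub_one_mul hp.out.ne_zero]
  have hw' : IsPowBasis p (algebraMap A R ∘ w) := hww ▸ hw.mul_units u
  have hI' : I.map (algebraMap A R) = (Ideal.span (w '' J)).map (algebraMap A R) := by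
    rw [hI, Ideal.map_span, ← Set.image_comp, hww]
    refine le_antisymm (Ideal.span_le.mpr ?_) (Ideal.span_le.mpr ?_)
    · rintro _ ⟨i, hi, rfl⟩
      rw [SetLike.mem_coe, ← Ideal.unit_mul_mem_iff_mem _ (u ^ p).isUnit]
      exact Ideal.subset_span ⟨i, hi, by simp⟩
    · rintro _ ⟨i, hi, rfl⟩
      exact Ideal.mul_mem_left _ _ (Ideal.subset_span ⟨i, hi, rfl⟩)
  obtain ⟨m, g, hg⟩ := hfin
  choose c hc using fun j => hw'.surjective (algebraMap A R (g j))
  obtain ⟨t, ht⟩ := IsLocalization.exist_integer_multiples_of_finite P.primeCompl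
    (fun jγ : Fin m × (Fin n → Fin p) => c jγ.1 jγ.2)
  choose d hd using ht
  have hgd : ∀ j, (t : A) ^ p * g j = powExpand p w fun γ => d (j, γ) := by
    intro j
    apply hinj
    rw [← powExpand_map, map_mul, map_pow, ← hc j, pow_mul_powExpand]
    congr 1
    funext γ
    rw [Function.comp_apply, hd, Algebra.smul_def]
  obtain ⟨s₁, hs₁, h₁⟩ := exists_mul_mem_of_map_le (B := R) P.primeCompl
    I.fg_of_isNoetherianRing hI'.le
  obtain ⟨s₂, hs₂, h₂⟩ := exists_mul_mem_of_map_le (B := R) P.primeCompl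
    (Ideal.span (w '' J)).fg_of_isNoetherianRing hI'.ge
  refine ⟨t * s₁ * s₂, mul_mem (mul_mem t.2 hs₁) hs₂, w, fun B _ _ _ => ⟨⟨?_, ?_⟩, ?_⟩⟩
  · -- `B` embeds into the local ring
    set f : A := t * s₁ * s₂ with hf
    have hfP : f ∈ P.primeCompl := mul_mem (mul_mem t.2 hs₁) hs₂
    have hfu : IsUnit (algebraMap A R f) := IsLocalization.map_units R ⟨f, hfP⟩
    let ψ : B →+* R := IsLocalization.Away.lift f hfu
    have hψ : ∀ a, ψ (algebraMap A B a) = algebraMap A R a := fun a =>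
      IsLocalization.Away.lift_eq f hfu a
    have hψi : Function.Injective ψ := by
      rw [injective_iff_map_eq_zero]
      intro b hb
      obtain ⟨⟨a, v⟩, hav⟩ := IsLocalization.surj (Submonoid.powers f) b
      have h3 : algebraMap A R a = 0 := by
        rw [← hψ, ← hav, map_mul, hb, zero_mul]
      rw [(map_eq_zero_iff _ hinj).mp h3, map_zero] at hav
      exact (IsLocalization.map_units B v).mul_left_eq_zero.mp hav
    intro c₁ c₂ h12
    have h4 := congrArg ψ h12
    rw [← powExpand_map, ← powExpand_map] at h4
    have h5 : ψ ∘ (algebraMap A B ∘ w) = algebraMap A R ∘ w := funext fun i => hψ _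
    rw [h5] at h4
    exact hψi.comp_left (hw'.injective h4)
  · intro b
    obtain ⟨c', hc'⟩ := exists_eq_sum_of_isLocalization hp.out.ne_zero hg
      (Submonoid.powers (t * s₁ * s₂)) b
    have hB : (p : B) = 0 := by rw [← map_natCast (algebraMap A B), hA, map_zero]
    have htu : IsUnit (algebraMap A B t) := isUnit_of_dvd_unit (map_dvd _ ⟨s₁ * s₂, by ring⟩)
      (IsLocalization.Away.algebraMap_isUnit (t * s₁ * s₂))
    obtain ⟨v, hv⟩ := htu
    have h6 := sum_mem_range_powExpand (e := 1) hB (algebraMap A B ∘ w) Finset.univ c'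
      (fun j => algebraMap A B (g j)) (fun j _ => by
        rw [pow_one]
        refine ⟨fun γ => ((v⁻¹ : Bˣ) : B) * algebraMap A B (d (j, γ)), ?_⟩
        have := powExpand_map (algebraMap A B) p w fun γ => d (j, γ)
        rw [← pow_mul_powExpand, ← Function.comp_def (algebraMap A B) fun γ => d (j, γ), this,
          ← hgd, map_mul, map_pow, ← hv, ← mul_assoc, ← mul_pow, Units.inv_mul, one_pow, one_mul])
    rw [pow_one, ← hc'] at h6
    exact h6
  · rw [Set.image_comp, ← Ideal.map_span]
    exact le_antisymm (mul_mem_map_away (f := t * s₁ * s₂) ⟨t * s₂, by ring⟩ h₁)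
      (mul_mem_map_away (f := t * s₁ * s₂) ⟨t * s₁, by ring⟩ h₂)

end SpreadOut

/-! ### The charts of a blowup -/

section Chart

variable {A K : Type*} [CommRing A] [Field K] [Algebra A K]

/-- The chart ring `A[I / x]` of the blowup of an ideal `I` at an element `x ∈ I`, as a
subalgebra of the fraction field `K` of `A`: the quotients `P / x ^ N` with `P ∈ I ^ N`. -/
def blowupChart (K : Type*) [Field K] [Algebra A K] (I : Ideal A) {x : A} (hx : x ∈ I) :
    Subalgebra A K where
  carrier := {b | ∃ N, ∃ P ∈ I ^ N, algebraMap A K x ^ N * b = algebraMap A K P}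
  mul_mem' := by
    rintro b c ⟨N, P, hP, hb⟩ ⟨M, Q, hQ, hc⟩
    refine ⟨N + M, P * Q, pow_add I N M ▸ Ideal.mul_mem_mul hP hQ, ?_⟩
    rw [map_mul, ← hb, ← hc]; ring
  add_mem' := by
    rintro b c ⟨N, P, hP, hb⟩ ⟨M, Q, hQ, hc⟩
    refine ⟨N + M, x ^ M * P + x ^ N * Q, add_mem ?_ ?_, ?_⟩
    · rw [add_comm, pow_add]; exact Ideal.mul_mem_mul (Ideal.pow_mem_pow hx M) hP
    · rw [pow_add]; exact Ideal.mul_mem_mul (Ideal.pow_mem_pow hx N) hQ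
    · rw [map_add, map_mul, map_mul, ← hb, ← hc, map_pow, map_pow]; ring
  algebraMap_mem' a := ⟨0, a, by simp, by simp⟩

variable {I : Ideal A} {x : A} {hx : x ∈ I}

theorem exists_blowupChart_eq (b : blowupChart K I hx) : ∃ N, ∃ P ∈ I ^ N,
    algebraMap A (blowupChart K I hx) x ^ N * b = algebraMap A (blowupChart K I hx) P := by
  obtain ⟨N, P, hP, h⟩ := b.2
  exact ⟨N, P, hP, Subtype.ext h⟩

theorem exists_blowupChart_eq_of_le (b : blowupChart K I hx) : ∃ N₀, ∀ N, N₀ ≤ N → ∃ P ∈ I ^ N,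
    algebraMap A (blowupChart K I hx) x ^ N * b = algebraMap A (blowupChart K I hx) P := by
  obtain ⟨N₀, P, hP, h⟩ := exists_blowupChart_eq b
  refine ⟨N₀, fun N hN => ⟨x ^ (N - N₀) * P, ?_, ?_⟩⟩
  · have := Ideal.mul_mem_mul (Ideal.pow_mem_pow hx (N - N₀)) hP
    rwa [← pow_add, Nat.sub_add_cancel hN] at this
  · rw [map_mul, ← h, map_pow, ← mul_assoc, ← pow_add, Nat.sub_add_cancel hN]

section FractionRing

variable [IsFractionRing A K]

theorem algebraMap_blowupChart_injective :
    Function.Injective (algebraMap A (blowupChart K I hx)) := fun _ _ h =>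
  IsFractionRing.injective A K (congrArg Subtype.val h)

theorem exists_mul_eq_of_mem_pow (hx0 : x ≠ 0) {N : ℕ} {P : A} (hP : P ∈ I ^ N) :
    ∃ b : blowupChart K I hx,
      algebraMap A (blowupChart K I hx) x ^ N * b = algebraMap A (blowupChart K I hx) P := by
  have h0 : algebraMap A K x ≠ 0 := by
    rwa [Ne, map_eq_zero_iff _ (IsFractionRing.injective A K)]
  have h1 : algebraMap A K x ^ N * (algebraMap A K P / algebraMap A K x ^ N) = algebraMap A K P :=
    mul_div_cancel₀ _ (pow_ne_zero _ h0)
  exact ⟨⟨algebraMap A K P / algebraMap A K x ^ N, N, P, hP, h1⟩, Subtype.ext h1⟩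

theorem map_blowupChart (hx0 : x ≠ 0) : I.map (algebraMap A (blowupChart K I hx)) =
    Ideal.span {algebraMap A (blowupChart K I hx) x} := by
  refine le_antisymm (Ideal.map_le_iff_le_comap.mpr fun P hP => ?_) ?_
  · obtain ⟨b, hb⟩ := exists_mul_eq_of_mem_pow (K := K) (hx := hx) hx0 (N := 1) (P := P) (by simpa)
    rw [Ideal.mem_comap, Ideal.mem_span_singleton]
    exact ⟨b, by rw [← hb, pow_one]⟩
  · rw [Ideal.span_singleton_le_iff_mem]
    exact Ideal.mem_map_of_mem _ hx

end FractionRing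

variable {C : Type*} [CommRing C]

theorem blowupChart_hom_ext {θ₁ θ₂ : blowupChart K I hx →+* C}
    (h : θ₁.comp (algebraMap A _) = θ₂.comp (algebraMap A _))
    (hnz : θ₁ (algebraMap A _ x) ∈ nonZeroDivisors C) : θ₁ = θ₂ := by
  have h' : ∀ a, θ₁ (algebraMap A _ a) = θ₂ (algebraMap A _ a) := fun a => RingHom.congr_fun h a
  ext b
  obtain ⟨N, P, -, hP⟩ := exists_blowupChart_eq b
  have h₁ := congrArg θ₁ hP
  have h₂ := congrArg θ₂ hP
  rw [map_mul, map_pow] at h₁ h₂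
  rw [← mul_cancel_left_mem_nonZeroDivisors (pow_mem hnz N), h₁, h' x, h₂, h']

/-- The universal property of the chart ring. -/
theorem exists_blowupChart_lift [IsFractionRing A K] (ψ : A →+* C) (hnz : ψ x ∈ nonZeroDivisors C)
    (hI : I.map ψ ≤ Ideal.span {ψ x}) :
    ∃ θ : blowupChart K I hx →+* C, θ.comp (algebraMap A _) = ψ := by
  have hinj := algebraMap_blowupChart_injective (K := K) (hx := hx)
  have key : ∀ b : blowupChart K I hx, ∃ c : C, ∀ N, ∀ P : A,
      algebraMap A (blowupChart K I hx) x ^ N * b = algebraMap A (blowupChart K I hx) P →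
      ψ x ^ N * c = ψ P := by
    intro b
    obtain ⟨N₀, P₀, hP₀, hb₀⟩ := exists_blowupChart_eq b
    have h1 : ψ P₀ ∈ Ideal.span {ψ x ^ N₀} := by
      rw [← Ideal.span_singleton_pow]
      have := Ideal.mem_map_of_mem ψ hP₀
      rw [Ideal.map_pow] at this
      exact Ideal.pow_right_mono hI _ this
    obtain ⟨c, hc⟩ := Ideal.mem_span_singleton.mp h1
    refine ⟨c, fun N P hP => ?_⟩
    have h2 : x ^ N * P₀ = x ^ N₀ * P := hinj (by
      rw [map_mul, map_mul, ← hP, ← hb₀, map_pow, map_pow]; ring)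
    rw [← mul_cancel_left_mem_nonZeroDivisors (pow_mem hnz N₀), mul_left_comm, ← hc, ← map_pow,
      ← map_mul, h2, map_mul, map_pow]
  choose θ hθ using key
  have huniq : ∀ b c, (∃ N P, algebraMap A (blowupChart K I hx) x ^ N * b =
      algebraMap A (blowupChart K I hx) P ∧ ψ x ^ N * c = ψ P) → θ b = c := by
    rintro b c ⟨N, P, hb, hc⟩
    rw [← mul_cancel_left_mem_nonZeroDivisors (pow_mem hnz N), hθ b N P hb, hc]
  have halg : ∀ a, θ (algebraMap A _ a) = ψ a := fun a => huniq _ _ ⟨0, a, by simp, by simp⟩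
  refine ⟨{ toFun := θ, map_one' := ?_, map_zero' := ?_, map_add' := fun b c => ?_,
            map_mul' := fun b c => ?_ }, RingHom.ext halg⟩
  · have := halg 1; rwa [map_one, map_one] at this
  · obtain ⟨N, P, -, hb⟩ := exists_blowupChart_eq b
    obtain ⟨M, Q, -, hc⟩ := exists_blowupChart_eq c
    refine huniq _ _ ⟨N + M, P * Q, ?_, ?_⟩
    · rw [map_mul, ← hb, ← hc]; ring
    · rw [map_mul, ← hθ b N P hb, ← hθ c M Q hc]; ring
  · have := halg 0; rwa [map_zero, map_zero] at this
  · obtain ⟨N, P, -, hb⟩ := exists_blowupChart_eq b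
    obtain ⟨M, Q, -, hc⟩ := exists_blowupChart_eq c
    refine huniq _ _ ⟨N + M, x ^ M * P + x ^ N * Q, ?_, ?_⟩
    · rw [map_add, map_mul, map_mul, ← hb, ← hc, map_pow, map_pow]; ring
    · rw [map_add, map_mul, map_mul, ← hθ b N P hb, ← hθ c M Q hc, map_pow, map_pow]; ring

end Chart

section ChartBasis

variable {A K : Type*} [CommRing A] [Field K] [Algebra A K] [IsDomain A] [IsFractionRing A K]
  {ι : Type*} [Fintype ι] [DecidableEq ι] {p : ℕ} [hp : Fact p.Prime]

/-- If `w` is a `p`-basis of `A` and `I` is generated by `w i`, `i ∈ J`, then the chart ring of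
`I` at `w j` has the `p`-basis obtained by replacing `w i` by `w i / w j` for `i ∈ J`, `i ≠ j`. -/
theorem IsPowBasis.blowupChart (hA : (p : A) = 0) {w : ι → A} (h : IsPowBasis p w) (J : Finset ι)
    {j : ι} (hj : j ∈ J) (hj0 : w j ≠ 0) :
    ∃ w' : ι → _root_.blowupChart K (Ideal.span (w '' J)) (mem_span_image w hj),
      w' j = algebraMap A _ (w j) ∧ IsPowBasis p w' := by
  set I := Ideal.span (w '' J) with hI
  set A' := _root_.blowupChart K I (mem_span_image w hj) with hA'
  have hA'p : (p : A') = 0 := by rw [← map_natCast (algebraMap A A'), hA, map_zero]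
  have hinj : Function.Injective (algebraMap A A') := algebraMap_blowupChart_injective
  have hx0 : algebraMap A A' (w j) ≠ 0 := by rwa [Ne, map_eq_zero_iff _ hinj]
  have hw' : ∀ i, ∃ b : A', (i ∈ J.erase j → algebraMap A A' (w j) * b = algebraMap A A' (w i)) ∧
      (i ∉ J.erase j → b = algebraMap A A' (w i)) := by
    intro i
    by_cases hi : i ∈ J.erase j
    · obtain ⟨b, hb⟩ := exists_mul_eq_of_mem_pow (K := K) (hx := mem_span_image w hj) hj0
        (N := 1) (P := w i) (by rw [pow_one]; exact mem_span_image w (Finset.mem_of_mem_erase hi))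
      exact ⟨b, fun _ => by rw [← hb, pow_one], fun h => absurd hi h⟩
    · exact ⟨_, fun h => absurd h hi, fun _ => rfl⟩
  choose w' hw'1 hw'2 using hw'
  have hw'j : w' j = algebraMap A A' (w j) := hw'2 j (by simp)
  refine ⟨w', hw'j, ?_, ?_⟩
  · have hinj0 := powExpand_injective_iff (e := 1) hA'p w'
    rw [pow_one] at hinj0
    rw [hinj0]
    intro c hc
    -- Clear denominators; the exponents of `w j` are then permuted modulo `p`.
    choose N₀ hN₀ using fun γ => exists_blowupChart_eq_of_le (c γ)
    let N := Finset.univ.sup N₀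
    choose P _ hP using fun γ => hN₀ γ N (Finset.le_sup (Finset.mem_univ γ))
    let d : (ι → Fin p) → ℕ := fun γ => ∑ i ∈ J.erase j, (γ i : ℕ)
    let n := Fintype.card ι
    have hd : ∀ γ, d γ ≤ p * n := by
      intro γ
      calc d γ ≤ ∑ i ∈ J.erase j, p := Finset.sum_le_sum fun i _ => (γ i).2.le
        _ = (J.erase j).card * p := by simp
        _ ≤ p * n := by
          rw [mul_comm]; exact Nat.mul_le_mul_left _ (Finset.card_le_univ _)
    have hmon : ∀ γ : ι → Fin p, algebraMap A A' (w j) ^ d γ * ∏ i, w' i ^ (γ i : ℕ) =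
        algebraMap A A' (∏ i, w i ^ (γ i : ℕ)) := by
      intro γ
      rw [map_prod, ← Finset.prod_pow_eq_pow_sum,
        ← Finset.prod_mul_prod_compl (J.erase j) (fun i => w' i ^ (γ i : ℕ)),
        ← Finset.prod_mul_prod_compl (J.erase j) (fun i => algebraMap A A' (w i ^ (γ i : ℕ))),
        ← mul_assoc, ← Finset.prod_mul_distrib]
      congr 1
      · exact Finset.prod_congr rfl fun i hi => by rw [← mul_pow, hw'1 i hi, map_pow]
      · exact Finset.prod_congr rfl fun i hi => by
          rw [hw'2 i (Finset.mem_compl.mp hi), map_pow]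
    let E : (ι → Fin p) → ℕ := fun γ => (γ j : ℕ) + (p * n - d γ)
    let σ : (ι → Fin p) → (ι → Fin p) := fun γ =>
      Function.update γ j ⟨E γ % p, Nat.mod_lt _ hp.out.pos⟩
    have hmonσ : ∀ γ : ι → Fin p, w j ^ (p * n - d γ) * ∏ i, w i ^ (γ i : ℕ) =
        (w j ^ (E γ / p)) ^ p * ∏ i, w i ^ (σ γ i : ℕ) := by
      intro γ
      rw [← Finset.mul_prod_erase _ _ (Finset.mem_univ j),
        ← Finset.mul_prod_erase _ (fun i => w i ^ (σ γ i : ℕ)) (Finset.mem_univ j), ← mul_assoc,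
        ← mul_assoc]
      congr 1
      · simp only [σ, Function.update_self]
        rw [← pow_mul, ← pow_add, ← pow_add, mul_comm (E γ / p), Nat.div_add_mod, add_comm]
      · exact Finset.prod_congr rfl fun i hi => by
          simp only [σ, Function.update_of_ne (Finset.ne_of_mem_erase hi)]
    have hσ : Function.Injective σ := by
      intro γ δ hγδ
      have h1 : ∀ i, i ≠ j → γ i = δ i := fun i hi => by
        have := congrFun hγδ i
        simpa [σ, Function.update_of_ne hi] using this
      have h2 : d γ = d δ := Finset.sum_congr rfl fun i hi => by
        rw [h1 i (Finset.ne_of_mem_erase hi)]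
      have h3 : E γ % p = E δ % p := by
        have := congrFun hγδ j
        simpa [σ] using this
      funext i
      by_cases hi : i = j
      · subst hi
        simp only [E, h2] at h3
        have h4 : (γ i : ℕ) ≡ δ i [MOD p] := Nat.ModEq.add_right_cancel' _ h3
        exact Fin.ext (Nat.ModEq.eq_of_lt_of_lt h4 (γ i).2 (δ i).2)
      · exact h1 i hi
    have hsum : ∑ γ, (w j ^ (E γ / p) * P γ) ^ p * ∏ i, w i ^ (σ γ i : ℕ) = 0 := by
      apply hinj
      rw [map_zero, map_sum, ← mul_zero (algebraMap A A' (w j) ^ (N * p + p * n)), ← hc, powExpand,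
        Finset.mul_sum]
      refine Finset.sum_congr rfl fun γ _ => ?_
      rw [mul_pow, mul_right_comm, ← hmonσ, map_mul, map_mul, ← hmon, map_pow, map_pow, ← hP γ]
      rw [mul_pow, ← pow_mul]
      have : p * n = (p * n - d γ) + d γ := (Nat.sub_add_cancel (hd γ)).symm
      conv_rhs => rw [pow_add, this, pow_add]
      ring
    have hzero : ∑ γ, Pi.single (M := fun _ => A) (σ γ) (w j ^ (E γ / p) * P γ) = 0 := by
      have h1 := powExpand_injective_iff (e := 1) hA w
      have h2 := powExpand_sum (e := 1) (κ := ι → Fin p) hA w Finset.univ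
      rw [pow_one] at h1 h2
      refine h1.mp h.injective _ ?_
      rw [h2, ← hsum]
      exact Finset.sum_congr rfl fun γ _ => powExpand_single hp.out.ne_zero _ _ _
    funext γ
    have h3 := congrFun hzero (σ γ)
    rw [Finset.sum_apply, Finset.sum_eq_single γ (fun δ _ hδ =>
      Pi.single_eq_of_ne (fun h => hδ (hσ h.symm)) _)
      (fun h => absurd (Finset.mem_univ _) h), Pi.single_eq_same, Pi.zero_apply] at h3
    have h4 : P γ = 0 := (mul_eq_zero.mp h3).resolve_left (pow_ne_zero _ hj0)
    have h5 := hP γ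
    rw [h4, map_zero] at h5
    exact (mul_eq_zero.mp h5).resolve_left (pow_ne_zero _ hx0)
  · have hpow : ∀ b : A', b ^ p ∈ powExpandRange hA'p 1 w' := fun b => by
      simpa using pow_mem_powExpandRange (e := 1) hA'p w' b
    have hmem : ∀ i, algebraMap A A' (w i) ∈ powExpandRange hA'p 1 w' := by
      intro i
      by_cases hi : i ∈ J.erase j
      · rw [← hw'1 i hi, ← hw'j]
        exact mul_mem (apply_mem_powExpandRange _ _ _) (apply_mem_powExpandRange _ _ _)
      · rw [← hw'2 i hi]
        exact apply_mem_powExpandRange _ _ _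
    have halg : ∀ a, algebraMap A A' a ∈ powExpandRange hA'p 1 w' := by
      intro a
      obtain ⟨c, rfl⟩ := h.surjective a
      rw [powExpand, map_sum]
      refine sum_mem fun γ _ => ?_
      rw [map_mul, map_pow, map_prod]
      refine mul_mem (hpow _) (prod_mem fun i _ => ?_)
      rw [map_pow]
      exact pow_mem (hmem i) _
    have hdiv : ∀ a ∈ I, ∃ b ∈ powExpandRange hA'p 1 w',
        algebraMap A A' (w j) * b = algebraMap A A' a := by
      intro a ha
      induction ha using Submodule.span_induction with
      | mem a ha =>
        obtain ⟨i, hi, rfl⟩ := ha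
        by_cases hij : i = j
        · exact ⟨1, one_mem _, by rw [mul_one, hij]⟩
        · exact ⟨w' i, apply_mem_powExpandRange _ _ _, hw'1 i (Finset.mem_erase.mpr ⟨hij, hi⟩)⟩
      | zero => exact ⟨0, zero_mem _, by simp⟩
      | add a a' _ _ ha ha' =>
        obtain ⟨b, hb, hab⟩ := ha
        obtain ⟨b', hb', hab'⟩ := ha'
        exact ⟨b + b', add_mem hb hb', by rw [mul_add, hab, hab', map_add]⟩
      | smul r a _ ha =>
        obtain ⟨b, hb, hab⟩ := ha
        exact ⟨algebraMap A A' r * b, mul_mem (halg r) hb, by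
          rw [mul_left_comm, hab, smul_eq_mul, map_mul]⟩
    have hdivN : ∀ N : ℕ, ∀ a ∈ I ^ N, ∃ b ∈ powExpandRange hA'p 1 w',
        algebraMap A A' (w j) ^ N * b = algebraMap A A' a := by
      intro N
      induction N with
      | zero => intro a _; exact ⟨_, halg a, by simp⟩
      | succ N ih =>
        intro a ha
        rw [pow_succ] at ha
        induction ha using Submodule.mul_induction_on' with
        | mem_mul_mem a ha a' ha' =>
          obtain ⟨b, hb, hab⟩ := ih a ha
          obtain ⟨b', hb', hab'⟩ := hdiv a' ha'
          exact ⟨b * b', mul_mem hb hb', by rw [map_mul, ← hab, ← hab']; ring⟩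
        | add a _ a' _ ha ha' =>
          obtain ⟨b, hb, hab⟩ := ha
          obtain ⟨b', hb', hab'⟩ := ha'
          exact ⟨b + b', add_mem hb hb', by rw [mul_add, hab, hab', map_add]⟩
    intro b
    refine (mem_powExpandRange_one (hA := hA'p)).mp ?_
    obtain ⟨N, P, hP, hb⟩ := exists_blowupChart_eq b
    obtain ⟨b', hb', hbP⟩ := hdivN N P hP
    rw [mul_left_cancel₀ (pow_ne_zero N hx0) (hb.trans hbP.symm)]
    exact hb'

end ChartBasis

section ChartOrder

variable {A K : Type*} [CommRing A] [Field K] [Algebra A K] [IsFractionRing A K]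
  {ι : Type*} [Fintype ι] [DecidableEq ι] {p : ℕ} [hp : Fact p.Prime]

/-- An element which is a `q`-th power up to `x ^ T` on a chart of the blowup has derivatives of
high order along the center. -/
theorem DiffLT.mem_span_pow_of_blowupChart {e : ℕ} (hA : (p : A) = 0) {w : ι → A}
    (h : IsPowBasis p w) (J : Finset ι) {j : ι} (hj : j ∈ J) {f : A}
    {G k : blowupChart K (Ideal.span (w '' J)) (mem_span_image w hj)} {T : ℕ}
    (hf : algebraMap A _ f = G ^ p ^ e + algebraMap A _ (w j) ^ (p ^ e * T) * k)
    {i : ℕ} (hi : i < p ^ e) {D : A →+ A} (hD : DiffLT (RingHom.id A) (i + 1) D) (h1 : D 1 = 0) :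
    D f ∈ Ideal.span (w '' J) ^ (p ^ e * T - i) := by
  have hq : 0 < p ^ e := pow_pos hp.out.pos e
  have hinj : Function.Injective
      (algebraMap A (blowupChart K (Ideal.span (w '' J)) (mem_span_image w hj))) :=
    algebraMap_blowupChart_injective
  obtain ⟨N₁, hN₁⟩ := exists_blowupChart_eq_of_le G
  obtain ⟨N₂, hN₂⟩ := exists_blowupChart_eq_of_le k
  let N := max N₁ N₂
  obtain ⟨G₀, -, hG₀⟩ := hN₁ N (le_max_left _ _)
  obtain ⟨P, hP, hk⟩ := hN₂ (p ^ e * N)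
    ((le_max_right _ _).trans (Nat.le_mul_of_pos_left _ hq))
  have heq : (w j ^ N) ^ p ^ e * f = G₀ ^ p ^ e * 1 + w j ^ (p ^ e * T) * P := by
    apply hinj
    rw [map_mul, map_add, map_mul, map_mul, hf, ← hk]
    simp only [map_pow, map_one, ← hG₀]
    ring
  have h2 := congrArg D heq
  rw [map_add, hD.map_pow_mul hA hi, hD.map_pow_mul hA hi, h1, mul_zero, zero_add,
    RingHom.id_apply] at h2
  by_cases hle : p ^ e * T ≤ i
  · rw [Nat.sub_eq_zero_of_le hle]; simp
  push Not at hle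
  have h3 : w j ^ (p ^ e * T) * P ∈
      Ideal.span (w '' J) ^ ((p ^ e * N + (p ^ e * T - i)) + i) := by
    have h4 := Ideal.mul_mem_mul (Ideal.pow_mem_pow (mem_span_image w hj) (p ^ e * T)) hP
    rw [← pow_add] at h4
    rwa [show p ^ e * N + (p ^ e * T - i) + i = p ^ e * T + p ^ e * N by omega]
  have h5 := hD.map_mem_pow _ h3
  rw [Ideal.map_id, ← h2, ← pow_mul, mul_comm N] at h5
  exact h.mem_span_pow_of_pow_mul_mem hA J hj h5

end ChartOrder

/-! ### Localization of differential operators -/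

section DiffLocalization

variable {A B : Type*} [CommRing A] [CommRing B] {p e : ℕ} [hp : Fact p.Prime]

theorem DiffLT.mem_of_mem_mapPow (φ : A →+* B) (hB : (p : B) = 0) {n : ℕ} (hn : n ≤ p ^ e)
    {D : B →+ B} (hD : DiffLT (RingHom.id B) n D) {N : Submodule (powSubring A (p ^ e)) A}
    {K : Ideal B} (h : ∀ m ∈ N, D (φ m) ∈ K) {b : B} (hb : b ∈ mapPow φ N) : D b ∈ K := by
  induction hb using Submodule.span_induction with
  | mem b hb => obtain ⟨m, hm, rfl⟩ := hb; exact h m hm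
  | zero => rw [map_zero]; exact K.zero_mem
  | add b c _ _ hb hc => rw [map_add]; exact K.add_mem hb hc
  | smul r b _ hb =>
    obtain ⟨d, hd⟩ := (mem_powSubring_iff hB e r.1).mp r.2
    rw [Subring.smul_def, smul_eq_mul, ← hd, hD.map_pow_mul hB hn]
    exact K.mul_mem_left _ hb

variable [Algebra A B]

/-- A differential operator of order less than `q` is linear over `q`-th powers, hence extends to
every localization. -/
theorem DiffLT.exists_localization (hA : (p : A) = 0) (M : Submonoid A) [IsLocalization M B] {n : ℕ}
    (hn : n ≤ p ^ e) {D : A →+ A} (hD : DiffLT (RingHom.id A) n D) :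
    ∃ D' : B →+ B, DiffLT (RingHom.id B) n D' ∧
      ∀ a, D' (algebraMap A B a) = algebraMap A B (D a) := by
  have hq : p ^ e ≠ 0 := pow_ne_zero e hp.out.ne_zero
  have hB : (p : B) = 0 := by rw [← map_natCast (algebraMap A B), hA, map_zero]
  have hden : ∀ b : B, ∃ s : M, ∃ a : A, algebraMap A B s ^ p ^ e * b = algebraMap A B a := by
    intro b
    obtain ⟨⟨a, s⟩, has⟩ := IsLocalization.surj M b
    refine ⟨s, (s : A) ^ (p ^ e - 1) * a, ?_⟩
    rw [map_mul, ← has, map_pow, ← mul_pow_sub_one hq]; ring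
  have hunit : ∀ s : M, IsUnit (algebraMap A B s ^ p ^ e) := fun s =>
    (IsLocalization.map_units B s).pow _
  have key : ∀ b : B, ∃ c : B, ∀ (s : M) (a : A), algebraMap A B s ^ p ^ e * b = algebraMap A B a →
      algebraMap A B s ^ p ^ e * c = algebraMap A B (D a) := by
    intro b
    obtain ⟨s₀, a₀, h₀⟩ := hden b
    obtain ⟨v, hv⟩ := hunit s₀
    refine ⟨((v⁻¹ : Bˣ) : B) * algebraMap A B (D a₀), fun s a h => ?_⟩
    have h1 : algebraMap A B ((s : A) ^ p ^ e * a₀) = algebraMap A B ((s₀ : A) ^ p ^ e * a) := by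
      rw [map_mul, map_mul, ← h, ← h₀, map_pow, map_pow]; ring
    obtain ⟨m, hm⟩ := (IsLocalization.eq_iff_exists M B).mp h1
    have h2 : ((m : A) * s) ^ p ^ e * a₀ = ((m : A) * s₀) ^ p ^ e * a := by
      rw [mul_pow, mul_pow, ← pow_sub_one_mul hq (m : A)]
      linear_combination (m : A) ^ (p ^ e - 1) * hm
    have h3 := congrArg D h2
    rw [hD.map_pow_mul hA hn, hD.map_pow_mul hA hn, RingHom.id_apply, RingHom.id_apply] at h3
    have h4 := congrArg (algebraMap A B) h3
    simp only [map_mul, map_pow, mul_pow] at h4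
    have h5 : algebraMap A B s ^ p ^ e * algebraMap A B (D a₀) =
        algebraMap A B s₀ ^ p ^ e * algebraMap A B (D a) := by
      refine (hunit m).mul_left_cancel ?_
      rw [← mul_assoc, ← mul_assoc]; exact h4
    rw [mul_left_comm, h5, ← hv, ← mul_assoc, Units.inv_mul, one_mul]
  choose D₀ hD₀ using key
  have huniq : ∀ b c, (∃ (s : M) (a : A), algebraMap A B s ^ p ^ e * b = algebraMap A B a ∧
      algebraMap A B s ^ p ^ e * c = algebraMap A B (D a)) → D₀ b = c := by
    rintro b c ⟨s, a, hb, hc⟩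
    exact (hunit s).mul_left_cancel ((hD₀ b s a hb).trans hc.symm)
  let D' : B →+ B :=
    { toFun := D₀
      map_zero' := huniq _ _ ⟨1, 0, by simp, by simp⟩
      map_add' := fun b c => by
        obtain ⟨s, a, hb⟩ := hden b
        obtain ⟨t, a', hc⟩ := hden c
        refine huniq _ _ ⟨s * t, (t : A) ^ p ^ e * a + (s : A) ^ p ^ e * a', ?_, ?_⟩
        · simp only [Submonoid.coe_mul, map_add, map_mul, map_pow, ← hb, ← hc]; ring
        · rw [map_add, hD.map_pow_mul hA hn, hD.map_pow_mul hA hn]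
          simp only [RingHom.id_apply, Submonoid.coe_mul, map_add, map_mul, map_pow,
            ← hD₀ b s a hb, ← hD₀ c t a' hc]
          ring }
  have hD'alg : ∀ a, D' (algebraMap A B a) = algebraMap A B (D a) := fun a =>
    huniq _ _ ⟨1, a, by simp, by simp⟩
  -- Linearity over `q`-th powers determines the order of the extension.
  have hlin : ∀ (D : A →+ A) (D' : B →+ B), (∀ a, D' (algebraMap A B a) = algebraMap A B (D a)) →
      (∀ b c : B, D' (b ^ p ^ e * c) = b ^ p ^ e * D' c) → ∀ m, DiffLT (RingHom.id A) m D →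
      DiffLT (RingHom.id B) m D' := by
    intro D D' halg hpow m
    induction m generalizing D D' with
    | zero =>
      intro h
      have h0 : D = 0 := h
      refine AddMonoidHom.ext fun b => ?_
      obtain ⟨s, a, hb⟩ := hden b
      refine (hunit s).mul_left_cancel ?_
      rw [← hpow, hb, halg, h0]
      simp
    | succ m ih =>
      intro h b
      obtain ⟨s, a, hb⟩ := hden b
      obtain ⟨v, hv⟩ := IsLocalization.map_units B s
      have h1 : diffComm (RingHom.id B) D' b = (AddMonoidHom.mulLeft (((v⁻¹ : Bˣ) : B) ^ p ^ e)).comp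
          (diffComm (RingHom.id B) D' (algebraMap A B a)) := by
        refine AddMonoidHom.ext fun c => ?_
        have h2 : b = ((v⁻¹ : Bˣ) : B) ^ p ^ e * algebraMap A B a := by
          rw [← hb, ← mul_assoc, ← hv, ← mul_pow, Units.inv_mul, one_pow, one_mul]
        simp only [diffComm_apply, AddMonoidHom.comp_apply, AddMonoidHom.coe_mulLeft,
          RingHom.id_apply]
        conv_lhs => rw [h2, mul_assoc, hpow]
        ring
      rw [h1]
      refine DiffLT.mul_left (ih (diffComm (RingHom.id A) D a) _ (fun x => ?_) (fun x y => ?_) (h a)) _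
      · simp only [diffComm_apply, RingHom.id_apply]
        rw [← map_mul, halg, halg, map_sub, map_mul (algebraMap A B) a]
      · simp only [diffComm_apply, RingHom.id_apply]
        rw [hpow, mul_left_comm, hpow]; ring
  refine ⟨D', hlin D D' hD'alg (fun b c => ?_) n hD, hD'alg⟩
  obtain ⟨s, a, hb⟩ := hden b
  obtain ⟨t, a', hc⟩ := hden c
  refine huniq _ _ ⟨s ^ p ^ e * t, a ^ p ^ e * a', ?_, ?_⟩
  · simp only [Submonoid.coe_mul, SubmonoidClass.coe_pow, map_mul, map_pow, ← hb, ← hc, mul_pow]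
    ring
  · rw [hD.map_pow_mul hA hn]
    simp only [RingHom.id_apply, Submonoid.coe_mul, SubmonoidClass.coe_pow, map_mul, map_pow, ← hb,
      ← hD₀ c t a' hc, mul_pow]
    change _ * (_ * D₀ c) = _
    ring

/-- Over a ring finite over its `q`-th powers, an operator into a localization at `f` becomes an
operator of the ring itself after multiplication by a power of `f`. -/
theorem DiffLT.exists_of_away [IsReduced A] (hA : (p : A) = 0) (hfin : IsPowFinite (p ^ e) A) (f : A)
    [IsLocalization.Away f B] {n : ℕ} (hn : n ≤ p ^ e) {δ : A →+ B}
    (hδ : DiffLT (algebraMap A B) n δ) : ∃ (D : A →+ A) (N : ℕ), DiffLT (RingHom.id A) n D ∧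
      ∀ a, algebraMap A B (D a) = algebraMap A B f ^ N * δ a := by
  have hB : (p : B) = 0 := by rw [← map_natCast (algebraMap A B), hA, map_zero]
  have hq : p ^ e ≠ 0 := pow_ne_zero e hp.out.ne_zero
  obtain ⟨m, g, hg⟩ := hfin
  obtain ⟨⟨s, k, hk⟩, hs⟩ := IsLocalization.exist_integer_multiples_of_finite
    (Submonoid.powers f) fun j => δ (g j)
  choose a ha using hs
  simp only [Algebra.smul_def] at ha
  have hk' : f ^ k = s := hk
  -- As `A` is reduced, the ideal `f A` embeds into the localization.
  have hinj : ∀ c c' : A, algebraMap A B (f * c) = algebraMap A B (f * c') → f * c = f * c' := by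
    intro c c' h
    obtain ⟨⟨_, l, rfl⟩, hl⟩ := (IsLocalization.eq_iff_exists (Submonoid.powers f) B).mp h
    have h1 : f ^ l * (f * (c - c')) = 0 := by
      rw [mul_sub, mul_sub, sub_eq_zero]; exact hl
    have h2 : (f * (c - c')) ^ (l + 1) = 0 := by
      rw [mul_pow]
      calc f ^ (l + 1) * (c - c') ^ (l + 1) = f ^ l * (f * (c - c')) * (c - c') ^ l := by ring
        _ = 0 := by rw [h1, zero_mul]
    have h3 := pow_eq_zero_iff (Nat.succ_ne_zero l) |>.mp h2
    rw [← sub_eq_zero, ← mul_sub]; exact h3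
  have hex : ∀ x : A, ∃ c : A, algebraMap A B c = algebraMap A B s ^ p ^ e * δ x := by
    intro x
    obtain ⟨c, rfl⟩ := hg x
    refine ⟨∑ j, c j ^ p ^ e * (s ^ (p ^ e - 1) * a j), ?_⟩
    rw [map_sum, map_sum, Finset.mul_sum]
    refine Finset.sum_congr rfl fun j _ => ?_
    rw [hδ.map_pow_mul hB hn]
    simp only [map_mul, map_pow, ha]
    rw [← mul_pow_sub_one hq (algebraMap A B s)]
    ring
  choose c hc using hex
  have hD : ∀ x, algebraMap A B (f * c x) = algebraMap A B f ^ (k * p ^ e + 1) * δ x := fun x => by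
    rw [map_mul, hc, ← hk', map_pow]; ring
  let D : A →+ A :=
    { toFun := fun x => f * c x
      map_zero' := by
        have := hinj (c 0) 0 (by rw [hD, map_zero, mul_zero, mul_zero, map_zero])
        rwa [mul_zero] at this
      map_add' := fun x y => by
        rw [← mul_add]; apply hinj; rw [hD, mul_add, map_add, map_add, mul_add, hD, hD] }
  refine ⟨D, k * p ^ e + 1, ?_, hD⟩
  have key : ∀ (n : ℕ) (E : A →+ A), (∀ x, ∃ c, E x = f * c) →
      DiffLT (algebraMap A B) n ((algebraMap A B).toAddMonoidHom.comp E) →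
      DiffLT (RingHom.id A) n E := by
    intro n
    induction n with
    | zero =>
      intro E hE h
      refine AddMonoidHom.ext fun x => ?_
      obtain ⟨y, hy⟩ := hE x
      have h1 : algebraMap A B (E x) = 0 := DFunLike.congr_fun
        (show (algebraMap A B).toAddMonoidHom.comp E = 0 from h) x
      rw [AddMonoidHom.zero_apply, hy, ← mul_zero f]
      apply hinj
      rw [← hy, h1, mul_zero, map_zero]
    | succ n ih =>
      intro E hE h y
      refine ih _ (fun x => ?_) ?_
      · obtain ⟨c₁, h1⟩ := hE (y * x)
        obtain ⟨c₂, h2⟩ := hE x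
        exact ⟨c₁ - y * c₂, by rw [diffComm_apply, h1, h2, RingHom.id_apply]; ring⟩
      · have : (algebraMap A B).toAddMonoidHom.comp (diffComm (RingHom.id A) E y) =
            diffComm (algebraMap A B) ((algebraMap A B).toAddMonoidHom.comp E) y := by
          ext; simp
        rw [this]; exact h y
  refine key n D (fun x => ⟨c x, rfl⟩) ?_
  have : (algebraMap A B).toAddMonoidHom.comp D =
      (AddMonoidHom.mulLeft (algebraMap A B f ^ (k * p ^ e + 1))).comp δ :=
    AddMonoidHom.ext hD
  rw [this]
  exact hδ.mul_left _

/-- The formation of `Diff_+^i`, `i < q`, commutes with localization. -/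
theorem map_diffPlusIdeal_away [IsReduced A] (hA : (p : A) = 0) (hfin : IsPowFinite (p ^ e) A)
    (f : A) [IsLocalization.Away f B] {i : ℕ} (hi : i < p ^ e)
    (N : Submodule (powSubring A (p ^ e)) A) :
    (diffPlusIdeal ℤ i (N : Set A)).map (algebraMap A B) =
      diffPlusIdeal ℤ i (mapPow (algebraMap A B) N : Set B) := by
  have hB : (p : B) = 0 := by rw [← map_natCast (algebraMap A B), hA, map_zero]
  apply le_antisymm
  · rw [Ideal.map_le_iff_le_comap, diffPlusIdeal_le_iff]
    intro D hD h1 m hm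
    obtain ⟨D', hD', halg⟩ := hD.exists_localization (B := B) hA (Submonoid.powers f) hi
    rw [Ideal.mem_comap, ← halg]
    refine mem_diffPlusIdeal hD' ?_ (Submodule.subset_span ⟨m, hm, rfl⟩)
    rw [← map_one (algebraMap A B), halg, h1, map_zero]
  · rw [diffPlusIdeal_le_iff]
    intro D hD h1 b hb
    refine hD.mem_of_mem_mapPow _ hB hi (fun m hm => ?_) hb
    obtain ⟨E, k, hE, hEalg⟩ := DiffLT.exists_of_away hA hfin f hi
      (hD.comp_ringHom (φ := algebraMap A B))
    have hu : IsUnit (algebraMap A B f ^ k) := (IsLocalization.Away.algebraMap_isUnit f).pow k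
    rw [← Ideal.unit_mul_mem_iff_mem _ hu]
    have h2 : algebraMap A B f ^ k * D (algebraMap A B m) =
        algebraMap A B (E m - m * E 1) := by
      have := hEalg 1
      simp only [AddMonoidHom.comp_apply, RingHom.toAddMonoidHom_eq_coe, AddMonoidHom.coe_coe,
        map_one, h1, mul_zero] at this
      rw [map_sub, hEalg, map_mul, this, mul_zero, sub_zero]
      rfl
    rw [h2]
    refine Ideal.mem_map_of_mem _ ?_
    have h3 : DiffLT (RingHom.id A) (i + 1) (E - AddMonoidHom.mulLeft (E 1)) := by
      refine hE.sub ?_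
      have := (DiffLT.id (A := A)).mul_left (E 1)
      exact this.mono (by omega)
    have h4 := mem_diffPlusIdeal h3 (by simp) (SetLike.mem_coe.mpr hm)
    simpa [mul_comm] using h4

/-- Finiteness over `q`-th powers can be checked on a cover by basic open sets. -/
theorem IsPowFinite.of_away_cover {A : Type u} [CommRing A] {q : ℕ} (hq : q ≠ 0) {κ : Type*}
    (s : Finset κ) (f : κ → A) (hf : Ideal.span (f '' s) = ⊤) (B : κ → Type u)
    [∀ k, CommRing (B k)] [∀ k, Algebra A (B k)] [∀ k, IsLocalization.Away (f k) (B k)]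
    (hB : ∀ k ∈ s, IsPowFinite q (B k)) (hadd : ∀ x y : A, (x + y) ^ q = x ^ q + y ^ q) :
    IsPowFinite q A := by
  classical
  have h1 : ∀ k ∈ s, ∃ (n : ℕ) (g : Fin n → A), ∀ a : A, ∃ N₀ : ℕ, ∀ N, N₀ ≤ N → ∃ c : Fin n → A,
      (f k ^ N) ^ q * a = ∑ j, c j ^ q * g j := by
    intro k hk
    obtain ⟨n, g, hg⟩ := hB k hk
    obtain ⟨⟨_, l, rfl⟩, hv⟩ :=
      IsLocalization.exist_integer_multiples_of_finite (Submonoid.powers (f k)) g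
    choose g' hg' using hv
    simp only [Algebra.smul_def] at hg'
    refine ⟨n, fun j => (f k ^ l) ^ (q - 1) * g' j, fun a => ?_⟩
    obtain ⟨c, hc⟩ := hg (algebraMap A (B k) a)
    obtain ⟨⟨_, t, rfl⟩, hu⟩ := IsLocalization.exist_integer_multiples_of_finite
      (Submonoid.powers (f k)) c
    choose c' hc' using hu
    simp only [Algebra.smul_def] at hc'
    have h3 : algebraMap A (B k) ((f k ^ t * f k ^ l) ^ q * a) =
        algebraMap A (B k) (∑ j, c' j ^ q * ((f k ^ l) ^ (q - 1) * g' j)) := by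
      simp only [map_mul, map_sum, map_pow, hc', hg', hc, Finset.mul_sum, mul_pow]
      refine Finset.sum_congr rfl fun j _ => ?_
      have : (algebraMap A (B k) (f k) ^ l) ^ q =
          (algebraMap A (B k) (f k) ^ l) ^ (q - 1) * algebraMap A (B k) (f k) ^ l :=
        (pow_sub_one_mul hq _).symm
      rw [this]; ring
    obtain ⟨⟨_, r, rfl⟩, hr⟩ := (IsLocalization.eq_iff_exists (Submonoid.powers (f k)) (B k)).mp h3
    refine ⟨t + l + r, fun N hN => ⟨fun j => f k ^ (N - t - l) * c' j, ?_⟩⟩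
    have h4 : (f k ^ N) ^ q = (f k ^ (N - t - l)) ^ q * (f k ^ t * f k ^ l) ^ q := by
      rw [← mul_pow, ← pow_add, ← pow_add]; congr 2; omega
    have h5 : (f k ^ (N - t - l)) ^ q =
        f k ^ ((N - t - l) * q - r) * f k ^ r := by
      have : r ≤ (N - t - l) * q :=
        (by omega : r ≤ N - t - l).trans (Nat.le_mul_of_pos_right _ (Nat.pos_of_ne_zero hq))
      rw [← pow_mul, ← pow_add, Nat.sub_add_cancel this]
    simp only [mul_pow, mul_assoc, ← Finset.mul_sum]
    simp only at hr
    rw [h4, h5]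
    linear_combination f k ^ ((N - t - l) * q - r) * hr
  have hsum : ∀ x : s → A, (∑ k, x k) ^ q = ∑ k, x k ^ q :=
    fun x => map_sum ({ toFun := fun x => x ^ q, map_zero' := zero_pow hq, map_add' := hadd } :
      A →+ A) x Finset.univ
  choose! n g hg using h1
  let G : (Σ k : s, Fin (n k)) → A := fun x => g x.1 x.2
  refine ⟨Fintype.card (Σ k : s, Fin (n k)), G ∘ (Fintype.equivFin _).symm, fun a => ?_⟩
  choose! N₀ hN₀ using fun k (hk : k ∈ s) => hg k hk a
  let N := s.sup N₀
  choose! c hc using fun k (hk : k ∈ s) => hN₀ k hk N (Finset.le_sup hk)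
  have hspan : Ideal.span ((fun k => f k ^ N) '' s) = ⊤ := by
    have := Ideal.span_pow_eq_top _ hf N
    rwa [Set.image_image] at this
  have h1mem : (1 : A) ∈ Ideal.span ((fun k => f k ^ N) '' (s : Set κ)) := hspan ▸ Submodule.mem_top
  obtain ⟨r, hr⟩ := (Submodule.mem_span_image_finset_iff_exists_fun A).mp h1mem
  have h6 : a = ∑ k : s, ∑ j, (r k * c k j) ^ q * g k j := by
    calc a = (∑ k : s, r k • f k ^ N) ^ q * a := by rw [hr, one_pow, one_mul]
      _ = ∑ k : s, r k ^ q * ((f k ^ N) ^ q * a) := by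
        rw [hsum, Finset.sum_mul]
        exact Finset.sum_congr rfl fun k _ => by rw [smul_eq_mul, mul_pow, mul_assoc]
      _ = _ := Finset.sum_congr rfl fun k _ => by
        rw [hc k k.2, Finset.mul_sum]
        exact Finset.sum_congr rfl fun j _ => by rw [mul_pow, mul_assoc]
  refine ⟨(fun x : Σ k : s, Fin (n k) => r x.1 * c x.1 x.2) ∘ (Fintype.equivFin _).symm, ?_⟩
  have h7 := (Fintype.equivFin (Σ k : s, Fin (n k))).symm.sum_comp
    (fun x => (r x.1 * c x.1 x.2) ^ q * G x)
  refine h6.trans (Eq.trans ?_ h7.symm)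
  rw [Fintype.sum_sigma]

end DiffLocalization

/-! ### Ideal sheaves: pullbacks, stalks and orders -/

section IdealSheaf

open Scheme Opposite

variable {X Y : Scheme.{u}}

theorem exists_affineOpens_mem_le {x : X} {O : X.Opens} (hx : x ∈ O) :
    ∃ U : X.affineOpens, x ∈ U.1 ∧ U.1 ≤ O := by
  obtain ⟨_, ⟨U, hU, rfl⟩, hxU, hUO⟩ :=
    X.isBasis_affineOpens.exists_subset_of_mem_open (show x ∈ (O : Set X) from hx) O.isOpen
  exact ⟨⟨U, hU⟩, hxU, hUO⟩

theorem ideal_comap_openImmersion (j : X ⟶ Y) [IsOpenImmersion j]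
    (I : Y.IdealSheafData) (U : Y.affineOpens) (W : X.affineOpens) (h : W.1 ≤ j ⁻¹ᵁ U.1) :
    (I.comap j).ideal W = (I.ideal U).map (j.appLE U.1 W.1 h).hom := by
  have hle : j ''ᵁ W.1 ≤ U.1 := by
    rintro _ ⟨x, hx, rfl⟩
    exact h hx
  have h1 := I.map_ideal (U := ⟨j ''ᵁ W.1, W.2.image_of_isOpenImmersion j⟩) (V := U) hle
  have h2 : j.appLE U.1 W.1 h = Y.presheaf.map (homOfLE hle).op ≫ (j.appIso W.1).hom := by
    rw [Hom.appIso_hom', Hom.map_appLE]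
  have h3 : (I.ideal U).map (j.appLE U.1 W.1 h).hom =
      ((I.ideal U).map (Y.presheaf.map (homOfLE hle).op).hom).map (j.appIso W.1).hom.hom := by
    rw [h2, CommRingCat.hom_comp, ← Ideal.map_map]
  refine (I.ideal_comap_of_isOpenImmersion j W).trans (Eq.trans ?_ h3.symm)
  refine Eq.trans ?_ (congrArg (Ideal.map (j.appIso W.1).hom.hom) h1.symm)
  exact Ideal.comap_symm (j.appIso W.1).commRingCatIsoToRingEquiv

theorem ideal_comap_of_isAffine [IsAffine X] [IsAffine Y] (f : X ⟶ Y) (I : Y.IdealSheafData)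
    (hX : ⊤ ∈ X.affineOpens) (hY : ⊤ ∈ Y.affineOpens) :
    (I.comap f).ideal ⟨⊤, hX⟩ = (I.ideal ⟨⊤, hY⟩).map (f.appTop).hom := by
  have key : ∀ K : Ideal Γ(X, ⊤), (I.comap f).ideal ⟨⊤, hX⟩ ≤ K ↔
      (I.ideal ⟨⊤, hY⟩).map (f.appTop).hom ≤ K := by
    intro K
    obtain ⟨J, rfl⟩ : ∃ J : X.IdealSheafData, J.ideal ⟨⊤, hX⟩ = K :=
      IdealSheafData.equivOfIsAffine.surjective K
    have h1 : (I.comap f).ideal ⟨⊤, hX⟩ ≤ J.ideal ⟨⊤, hX⟩ ↔ I.comap f ≤ J :=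
      ⟨IdealSheafData.le_of_isAffine, fun h => h _⟩
    have h2 : I ≤ J.map f ↔ I.ideal ⟨⊤, hY⟩ ≤ (J.map f).ideal ⟨⊤, hY⟩ :=
      ⟨fun h => h _, IdealSheafData.le_of_isAffine⟩
    rw [h1, ← IdealSheafData.le_map_iff_comap_le, h2, Ideal.map_le_iff_le_comap,
      J.ideal_map_of_isAffineHom f ⟨⊤, hY⟩]
    rfl
  exact le_antisymm ((key _).mpr le_rfl) ((key _).mp le_rfl)

/-- On affine opens, the pullback of an ideal sheaf is the extension of ideals. -/
theorem ideal_comap (f : X ⟶ Y) (I : Y.IdealSheafData) (U : Y.affineOpens) (W : X.affineOpens)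
    (h : W.1 ≤ f ⁻¹ᵁ U.1) :
    (I.comap f).ideal W = (I.ideal U).map (f.appLE U.1 W.1 h).hom := by
  have : IsAffine W.1 := W.2
  have : IsAffine U.1 := U.2
  have hWt : (⊤ : W.1.toScheme.Opens) ∈ W.1.toScheme.affineOpens := isAffineOpen_top _
  have hUt : (⊤ : U.1.toScheme.Opens) ∈ U.1.toScheme.affineOpens := isAffineOpen_top _
  have hW : (⊤ : W.1.toScheme.Opens) ≤ W.1.ι ⁻¹ᵁ W.1 := by simp
  have hU : (⊤ : U.1.toScheme.Opens) ≤ U.1.ι ⁻¹ᵁ U.1 := by simp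
  let g : W.1.toScheme ⟶ U.1.toScheme := IsOpenImmersion.lift U.1.ι (W.1.ι ≫ f) (by
    rintro _ ⟨x, rfl⟩
    simp only [Opens.range_ι]
    exact h x.2)
  have hg : g ≫ U.1.ι = W.1.ι ≫ f := IsOpenImmersion.lift_fac _ _ _
  have h1 := ideal_comap_openImmersion W.1.ι (I.comap f) W ⟨⊤, hWt⟩ hW
  have h2 := ideal_comap_openImmersion U.1.ι I U ⟨⊤, hUt⟩ hU
  have h3 := ideal_comap_of_isAffine g (I.comap U.1.ι) hWt hUt
  have h4 : W.1.ι.appLE W.1 ⊤ hW = W.1.topIso.inv := by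
    rw [Opens.ι_appLE]; rfl
  have h5 : U.1.ι.appLE U.1 ⊤ hU ≫ g.appTop = f.appLE U.1 W.1 h ≫ W.1.ι.appLE W.1 ⊤ hW := by
    have h7 : (⊤ : W.1.toScheme.Opens) ≤ g ⁻¹ᵁ ⊤ := le_rfl
    have h6 : g.appTop = g.appLE ⊤ ⊤ h7 := (Hom.appLE_eq_app g).symm
    rw [h6, Hom.appLE_comp_appLE, Hom.appLE_comp_appLE]
    congr 1
  rw [← IdealSheafData.comap_comp, ← hg, IdealSheafData.comap_comp, h3, h2, Ideal.map_map,
    ← CommRingCat.hom_comp, h5, CommRingCat.hom_comp, ← Ideal.map_map, h4] at h1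
  have hinj : Function.Injective (Ideal.map W.1.topIso.inv.hom) :=
    Function.HasLeftInverse.injective ⟨Ideal.map W.1.topIso.hom.hom, fun K => by
      rw [Ideal.map_map, ← CommRingCat.hom_comp, Iso.inv_hom_id, CommRingCat.hom_id, Ideal.map_id]⟩
  exact hinj h1.symm

theorem stalkIdeal_eq (I : X.IdealSheafData) {x : X} (U : X.affineOpens) (hx : x ∈ U.1) :
    stalkIdeal I x = (I.ideal U).map (X.presheaf.germ U.1 x hx).hom := by
  refine le_antisymm (iSup₂_le fun V hV => ?_) (le_iSup₂_of_le U hx le_rfl)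
  obtain ⟨W, hxW, hW⟩ := exists_affineOpens_mem_le (x := x) (O := U.1 ⊓ V.1) ⟨hx, hV⟩
  have hWU : W ≤ U := hW.trans inf_le_left
  have hWV : W ≤ V := hW.trans inf_le_right
  have h1 : ∀ (V : X.affineOpens) (hV : x ∈ V.1) (hWV : W ≤ V),
      (I.ideal V).map (X.presheaf.germ V.1 x hV).hom =
        (I.ideal W).map (X.presheaf.germ W.1 x hxW).hom := by
    intro V hV hWV
    have hg : X.presheaf.map (homOfLE hWV).op ≫ X.presheaf.germ W.1 x hxW =
        X.presheaf.germ V.1 x hV := X.presheaf.germ_res _ _ _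
    rw [← I.map_ideal hWV, Ideal.map_map, ← CommRingCat.hom_comp, hg]
  rw [h1 U hx hWU, h1 V hV hWV]

theorem mem_support_iff_stalkIdeal_le (I : X.IdealSheafData) (x : X) :
    x ∈ I.support ↔ stalkIdeal I x ≤ IsLocalRing.maximalIdeal (X.presheaf.stalk x) := by
  obtain ⟨U, hxU, -⟩ := exists_affineOpens_mem_le (x := x) (O := ⊤) trivial
  rw [stalkIdeal_eq I U hxU, Ideal.map_le_iff_le_comap, I.mem_support_iff_of_mem hxU,
    Scheme.mem_zeroLocus_iff]
  refine forall₂_congr fun f _ => ?_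
  rw [Ideal.mem_comap, IsLocalRing.mem_maximalIdeal, mem_nonunits_iff]
  exact not_congr (Scheme.mem_basicOpen ..)

theorem le_idealOrder_iff (I : X.IdealSheafData) (x : X) (n : ℕ) :
    (n : ℕ∞) ≤ idealOrder I x ↔
      stalkIdeal I x ≤ IsLocalRing.maximalIdeal (X.presheaf.stalk x) ^ n := by
  refine ⟨fun h => ?_, fun h => le_iSup₂_of_le n h le_rfl⟩
  by_contra hn
  have hn0 : n ≠ 0 := by rintro rfl; exact hn (by simp)
  have h1 : idealOrder I x ≤ ((n - 1 : ℕ) : ℕ∞) := by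
    refine iSup₂_le fun k hk => ?_
    rw [Nat.cast_le]
    by_contra hkn
    exact hn (hk.trans (Ideal.pow_le_pow_right (by omega)))
  have h2 := h.trans h1
  rw [Nat.cast_le] at h2
  omega

theorem le_eta_iff (q N : ℕ) (G : ℕ → X.IdealSheafData) (x : X) :
    (N : ℕ∞) ≤ eta q G x ↔ ∀ i ∈ Finset.Ico 1 q, stalkIdeal (G i) x ≤
      IsLocalRing.maximalIdeal (X.presheaf.stalk x) ^ (N - i) := by
  rw [eta, le_iInf₂_iff]
  refine forall₂_congr fun i _ => ?_
  rw [← tsub_le_iff_right, ← le_idealOrder_iff, ENat.natCast_sub]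

end IdealSheaf

/-! ### Points of affine opens and local rings -/

section Points

open Scheme Opposite

variable {X : Scheme.{u}}

/-- The restriction of sections between two opens. -/
abbrev resHom (X : Scheme.{u}) {U W : X.Opens} (h : W ≤ U) : Γ(X, U) →+* Γ(X, W) :=
  (X.presheaf.map (homOfLE h).op).hom

theorem resHom_resHom {U W W' : X.Opens} (h : W ≤ U) (h' : W' ≤ W) (s : Γ(X, U)) :
    resHom X h' (resHom X h s) = resHom X (h'.trans h) s := by
  change (X.presheaf.map _ ≫ X.presheaf.map _).hom s = _
  rw [← Functor.map_comp]
  rfl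

theorem resHom_self {U : X.Opens} (s : Γ(X, U)) : resHom X le_rfl s = s := by
  change (X.presheaf.map (𝟙 _)).hom s = _
  rw [X.presheaf.map_id]; rfl

/-- The prime ideal of `Γ(X, U)` of the sections which are not invertible at `x`. -/
noncomputable def pointIdeal (U : X.Opens) (x : X) (hx : x ∈ U) : Ideal Γ(X, U) :=
  (IsLocalRing.maximalIdeal (X.presheaf.stalk x)).comap (X.presheaf.germ U x hx).hom

instance (U : X.Opens) (x : X) (hx : x ∈ U) : (pointIdeal U x hx).IsPrime :=
  Ideal.comap_isPrime _ _

theorem mem_pointIdeal_iff {U : X.Opens} {x : X} {hx : x ∈ U} {f : Γ(X, U)} :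
    f ∈ pointIdeal U x hx ↔ x ∉ X.basicOpen f := by
  rw [pointIdeal, Ideal.mem_comap, IsLocalRing.mem_maximalIdeal, mem_nonunits_iff]
  exact not_congr (Scheme.mem_basicOpen ..).symm

theorem pointIdeal_eq_primeIdealOf {U : X.Opens} (hU : IsAffineOpen U) (x : X) (hx : x ∈ U) :
    pointIdeal U x hx = (hU.primeIdealOf ⟨x, hx⟩).asIdeal := by
  rw [IsAffineOpen.primeIdealOf_eq_map_closedPoint]
  rfl

theorem isLocalization_pointIdeal (U : X.affineOpens) (x : X) (hx : x ∈ U.1) :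
    letI := (X.presheaf.germ U.1 x hx).hom.toAlgebra
    IsLocalization.AtPrime (X.presheaf.stalk x) (pointIdeal U.1 x hx) := by
  have hU : IsAffineOpen U.1 := U.2
  have h := hU.isLocalization_stalk ⟨x, hx⟩
  have h2 := pointIdeal_eq_primeIdealOf hU x hx
  simp only [← h2] at h
  exact h

/-- Every prime ideal of the ring of sections over an affine open comes from a point. -/
theorem exists_pointIdeal_eq (U : X.affineOpens) (P : Ideal Γ(X, U.1)) [hP : P.IsPrime] :
    ∃ x, ∃ hx : x ∈ U.1, pointIdeal U.1 x hx = P := by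
  have hU : IsAffineOpen U.1 := U.2
  let y : Spec Γ(X, U.1) := ⟨P, hP⟩
  have hy : hU.fromSpec y ∈ U.1 := by
    have h := hU.range_fromSpec
    have h2 : hU.fromSpec y ∈ (U.1 : Set X) := h ▸ ⟨y, rfl⟩
    exact h2
  refine ⟨hU.fromSpec y, hy, ?_⟩
  have h1 : hU.primeIdealOf ⟨hU.fromSpec y, hy⟩ = y := by
    apply hU.fromSpec.isOpenEmbedding.injective
    exact hU.fromSpec_primeIdealOf _
  rw [pointIdeal_eq_primeIdealOf hU, h1]

/-- Membership of a germ in a power of the maximal ideal of the local ring. -/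
theorem germ_mem_maximalIdeal_pow_iff (U : X.affineOpens) {x : X} (hx : x ∈ U.1) (n : ℕ)
    (f : Γ(X, U.1)) :
    (X.presheaf.germ U.1 x hx).hom f ∈ IsLocalRing.maximalIdeal (X.presheaf.stalk x) ^ n ↔
      ∃ s ∉ pointIdeal U.1 x hx, s * f ∈ pointIdeal U.1 x hx ^ n := by
  let := (X.presheaf.germ U.1 x hx).hom.toAlgebra
  have := isLocalization_pointIdeal U x hx
  have h1 := IsLocalization.AtPrime.map_eq_maximalIdeal (pointIdeal U.1 x hx) (X.presheaf.stalk x)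
  rw [← h1, ← Ideal.map_pow]
  change algebraMap _ (X.presheaf.stalk x) f ∈ _ ↔ _
  rw [IsLocalization.algebraMap_mem_map_algebraMap_iff (pointIdeal U.1 x hx).primeCompl]
  rfl

theorem stalkIdeal_le_pow_iff (I : X.IdealSheafData) (U : X.affineOpens) {x : X} (hx : x ∈ U.1)
    (n : ℕ) :
    stalkIdeal I x ≤ IsLocalRing.maximalIdeal (X.presheaf.stalk x) ^ n ↔
      ∀ f ∈ I.ideal U, ∃ s ∉ pointIdeal U.1 x hx, s * f ∈ pointIdeal U.1 x hx ^ n := by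
  rw [stalkIdeal_eq I U hx, Ideal.map_le_iff_le_comap]
  exact forall₂_congr fun f _ => germ_mem_maximalIdeal_pow_iff U hx n f

theorem mem_support_iff_le_pointIdeal (I : X.IdealSheafData) (U : X.affineOpens) {x : X}
    (hx : x ∈ U.1) : x ∈ I.support ↔ I.ideal U ≤ pointIdeal U.1 x hx := by
  rw [mem_support_iff_stalkIdeal_le, stalkIdeal_eq I U hx, Ideal.map_le_iff_le_comap]
  rfl

theorem natCast_section_eq_zero {p : ℕ} (hp : (p : Γ(X, ⊤)) = 0) (U : X.Opens) :
    (p : Γ(X, U)) = 0 := by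
  rw [← map_natCast (resHom X (le_top : U ≤ ⊤)), hp, map_zero]

theorem natCast_stalk_eq_zero {p : ℕ} (hp : (p : Γ(X, ⊤)) = 0) (x : X) :
    (p : X.presheaf.stalk x) = 0 := by
  rw [← map_natCast (X.presheaf.germ ⊤ x trivial).hom, hp, map_zero]

theorem natCast_of_hom {Y : Scheme.{u}} (f : Y ⟶ X) {p : ℕ} (hX : (p : Γ(X, ⊤)) = 0) :
    (p : Γ(Y, ⊤)) = 0 := by
  rw [← map_natCast f.appTop.hom, hX, map_zero]

end Points

/-! ### Localization of modules over rings of powers -/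

section MapPow

variable {p e : ℕ} [hp : Fact p.Prime] {A B C : Type*} [CommRing A] [CommRing B] [CommRing C]

theorem mapPow_mapPow {q : ℕ} (φ : A →+* B) (ψ : B →+* C) (N : Submodule (powSubring A q) A) :
    mapPow ψ (mapPow φ N) = mapPow (ψ.comp φ) N := by
  rw [show mapPow φ N = Submodule.span (powSubring B q) (φ '' (N : Set A)) from rfl, mapPow_span,
    ← Set.image_comp]
  rfl

theorem mem_mapPow {q : ℕ} (φ : A →+* B) {N : Submodule (powSubring A q) A} {n : A} (hn : n ∈ N) :
    φ n ∈ mapPow φ N := Submodule.subset_span ⟨n, hn, rfl⟩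

theorem pow_mul_mem {q : ℕ} (N : Submodule (powSubring A q) A) (a : A) {n : A} (hn : n ∈ N) :
    a ^ q * n ∈ N :=
  N.smul_mem ⟨a ^ q, pow_mem_powSubring q a⟩ hn

/-- In characteristic `p`, the elements multiplying `s` into `N` after taking `q`-th powers form
an ideal. -/
def powColon (hA : (p : A) = 0) (N : Submodule (powSubring A (p ^ e)) A) (s : A) : Ideal A where
  carrier := {a | a ^ p ^ e * s ∈ N}
  zero_mem' := by
    have : p ^ e ≠ 0 := pow_ne_zero _ hp.out.ne_zero
    simp [zero_pow this]
  add_mem' {a b} ha hb := by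
    have h : (a + b) ^ p ^ e = a ^ p ^ e + b ^ p ^ e := map_add (frobPow p e hA) a b
    rw [Set.mem_ofPred_eq, h, add_mul]
    exact N.add_mem ha hb
  smul_mem' c a ha := by
    rw [Set.mem_ofPred_eq, smul_eq_mul, mul_pow, mul_assoc]
    exact pow_mul_mem N c ha

theorem mem_powColon {hA : (p : A) = 0} {N : Submodule (powSubring A (p ^ e)) A} {s a : A} :
    a ∈ powColon hA N s ↔ a ^ p ^ e * s ∈ N := Iff.rfl

theorem mem_of_powColon_eq_top {hA : (p : A) = 0} {N : Submodule (powSubring A (p ^ e)) A} {s : A}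
    (h : powColon hA N s = ⊤) : s ∈ N := by
  have h1 : (1 : A) ∈ powColon hA N s := h ▸ Submodule.mem_top
  rw [mem_powColon] at h1
  simpa using h1

theorem exists_pow_mul_mem_of_mem_mapPow [Algebra A B] (hB : (p : B) = 0) (f : A)
    [IsLocalization.Away f B] (N : Submodule (powSubring A (p ^ e)) A) {b : B}
    (hb : b ∈ mapPow (algebraMap A B) N) :
    ∃ k, ∃ n ∈ N, algebraMap A B (f ^ k) ^ p ^ e * b = algebraMap A B n := by
  induction hb using Submodule.span_induction with
  | mem x hx =>
    obtain ⟨n, hn, rfl⟩ := hx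
    exact ⟨0, n, hn, by simp⟩
  | zero => exact ⟨0, 0, zero_mem _, by simp⟩
  | add x y _ _ hx hy =>
    obtain ⟨k, n, hn, h⟩ := hx
    obtain ⟨l, m, hm, h'⟩ := hy
    refine ⟨k + l, _, N.add_mem (pow_mul_mem N (f ^ l) hn) (pow_mul_mem N (f ^ k) hm), ?_⟩
    rw [map_add, map_mul, map_mul, ← h, ← h', pow_add, map_mul, map_pow _ (f ^ l),
      map_pow _ (f ^ k)]
    ring
  | smul c x _ hx =>
    obtain ⟨k, n, hn, h⟩ := hx
    obtain ⟨c, hc⟩ := c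
    obtain ⟨d, rfl⟩ := (mem_powSubring_iff hB e c).mp hc
    obtain ⟨⟨a, ⟨_, l, rfl⟩⟩, hd⟩ := IsLocalization.surj (Submonoid.powers f) d
    dsimp only at hd
    refine ⟨l + k, a ^ p ^ e * n, pow_mul_mem N a hn, ?_⟩
    rw [Subring.smul_def, smul_eq_mul, map_mul, ← h, map_pow _ a, ← hd, pow_add, map_mul]
    ring

theorem mem_mapPow_of_pow_mul [Algebra A B] (f : A) [IsLocalization.Away f B] {q : ℕ}
    (N : Submodule (powSubring B q) B) {b : B} (k : ℕ)
    (h : algebraMap A B (f ^ k) ^ q * b ∈ N) : b ∈ N := by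
  obtain ⟨v, hv⟩ := (IsLocalization.Away.algebraMap_isUnit (S := B) f).pow k
  have h1 := pow_mul_mem N (↑v⁻¹ : B) h
  rwa [map_pow, ← hv, ← mul_assoc, ← mul_pow, Units.inv_mul, one_pow, one_mul] at h1

theorem exists_pow_mem_powColon [Algebra A B] (hA : (p : A) = 0) (f : A)
    [IsLocalization.Away f B] (N : Submodule (powSubring A (p ^ e)) A) {s : A}
    (hs : algebraMap A B s ∈ mapPow (algebraMap A B) N) : ∃ k, f ^ k ∈ powColon hA N s := by
  have hB : (p : B) = 0 := by rw [← map_natCast (algebraMap A B), hA, map_zero]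
  obtain ⟨k, n, hn, h⟩ := exists_pow_mul_mem_of_mem_mapPow hB f N hs
  rw [← map_pow, ← map_mul] at h
  obtain ⟨⟨_, l, rfl⟩, hl⟩ := (IsLocalization.eq_iff_exists (Submonoid.powers f) B).mp h
  dsimp only at hl
  refine ⟨l + k, ?_⟩
  have h0 : p ^ e ≠ 0 := pow_ne_zero _ hp.out.ne_zero
  obtain ⟨r, hr⟩ := Nat.exists_eq_succ_of_ne_zero h0
  have h2 := pow_mul_mem N (f ^ l) hn
  rw [mem_powColon]
  have h3 : (f ^ (l + k)) ^ p ^ e * s = (f ^ l) ^ p ^ e * n := by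
    rw [hr] at hl ⊢
    calc (f ^ (l + k)) ^ (r + 1) * s = (f ^ l) ^ r * (f ^ l * ((f ^ k) ^ (r + 1) * s)) := by
          rw [pow_add]; ring
      _ = _ := by rw [← Nat.succ_eq_add_one, hl, pow_succ]; ring
  rw [h3]; exact h2

/-- Membership in a module over `A ^ q` is a local question. -/
theorem mem_of_forall_away (hA : (p : A) = 0) (N : Submodule (powSubring A (p ^ e)) A) {s : A}
    (S : Set A) (hS : Ideal.span S = ⊤) (h : ∀ f ∈ S, ∃ k, f ^ k ∈ powColon hA N s) : s ∈ N := by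
  refine mem_of_powColon_eq_top (hA := hA) ?_
  rw [← Ideal.radical_eq_top, eq_top_iff, ← hS, Ideal.span_le]
  exact h

end MapPow

/-! ### Construction and locality of quasi-coherent modules over `q`-th powers -/

section PowModuleBasis

open Scheme Opposite

variable {X : Scheme.{u}} {p e : ℕ} [hp : Fact p.Prime]

/-- The points of two affine opens have a common basis of basic opens. -/
theorem exists_common_basicOpen {U W : X.affineOpens} {x : X} (hU : x ∈ U.1) (hW : x ∈ W.1) :
    ∃ (D : X.affineOpens) (f : Γ(X, U)) (g : Γ(X, W)), D.1 = X.basicOpen f ∧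
      D.1 = X.basicOpen g ∧ x ∈ D.1 ∧ D.1 ≤ U.1 ∧ D.1 ≤ W.1 := by
  have aU : IsAffineOpen U.1 := U.2
  have aW : IsAffineOpen W.1 := W.2
  obtain ⟨f, g, hfg, hx⟩ := exists_basicOpen_le_affine_inter aU aW x ⟨hU, hW⟩
  refine ⟨X.affineBasicOpen f, f, g, rfl, hfg, hx, X.basicOpen_le f, ?_⟩
  change X.basicOpen f ≤ _
  rw [hfg]
  exact X.basicOpen_le g

theorem isLocalization_resHom {U D : X.affineOpens} (f : Γ(X, U)) (hD : D.1 = X.basicOpen f)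
    (h : D.1 ≤ U.1) :
    letI := (resHom X h).toAlgebra
    IsLocalization.Away f Γ(X, D) := by
  obtain ⟨D, hD'⟩ := D
  dsimp only at hD
  subst hD
  exact IsAffineOpen.isLocalization_basicOpen U.2 f

theorem exists_pow_mem_powColon_resHom (hX : (p : Γ(X, ⊤)) = 0) {U D : X.affineOpens}
    (f : Γ(X, U)) (hD : D.1 = X.basicOpen f) (h : D.1 ≤ U.1)
    (N : Submodule (powSubring Γ(X, U) (p ^ e)) Γ(X, U)) {s : Γ(X, U)}
    (hs : resHom X h s ∈ mapPow (resHom X h) N) :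
    ∃ k, f ^ k ∈ powColon (natCast_section_eq_zero hX U.1) N s := by
  let := (resHom X h).toAlgebra
  have := isLocalization_resHom f hD h
  exact exists_pow_mem_powColon (B := Γ(X, D)) _ f N hs

/-- Membership in a module over `Γ(X, U) ^ q` is local for the Zariski topology. -/
theorem mem_of_forall_mem_mapPow (hX : (p : Γ(X, ⊤)) = 0) {U : X.affineOpens}
    (N : Submodule (powSubring Γ(X, U) (p ^ e)) Γ(X, U)) {s : Γ(X, U)}
    (H : ∀ x ∈ U.1, ∃ (f : Γ(X, U)) (D : X.affineOpens) (_ : D.1 = X.basicOpen f) (h : D.1 ≤ U.1),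
      x ∈ D.1 ∧ resHom X h s ∈ mapPow (resHom X h) N) : s ∈ N := by
  refine mem_of_forall_away (natCast_section_eq_zero hX U.1) N
    {f | ∃ k, f ^ k ∈ powColon (natCast_section_eq_zero hX U.1) N s} ?_ fun f hf => hf
  have hU : IsAffineOpen U.1 := U.2
  rw [← hU.self_le_iSup_basicOpen_iff]
  intro x hx
  obtain ⟨f, D, hD, h, hxD, hs⟩ := H x hx
  exact Opens.mem_iSup.mpr ⟨⟨f, exists_pow_mem_powColon_resHom hX f hD h N hs⟩, hD ▸ hxD⟩

/-- A basis of affine opens, stable under passing to basic opens, together with compatible modules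
over the rings of `q`-th powers on these opens. -/
structure PowBasisFamily (X : Scheme.{u}) (q : ℕ) where
  /-- The affine opens of the basis. -/
  opens : Set X.affineOpens
  exists_mem : ∀ (x : X) (U : X.affineOpens), x ∈ U.1 → ∃ W ∈ opens, x ∈ W.1 ∧ W.1 ≤ U.1
  basicOpen_mem : ∀ U ∈ opens, ∀ f : Γ(X, U), X.affineBasicOpen f ∈ opens
  /-- The module of sections; only its values on the basis matter. -/
  obj : ∀ U : X.affineOpens, Submodule (powSubring Γ(X, U) q) Γ(X, U)
  mapPow_obj : ∀ U ∈ opens, ∀ (f : Γ(X, U)) (D : X.affineOpens), D.1 = X.basicOpen f →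
    ∀ h : D.1 ≤ U.1, mapPow (resHom X h) (obj U) = obj D

namespace PowBasisFamily

theorem mem_opens {q : ℕ} (B : PowBasisFamily X q) {U D : X.affineOpens} (hU : U ∈ B.opens)
    (f : Γ(X, U)) (hD : D.1 = X.basicOpen f) : D ∈ B.opens := by
  have : D = X.affineBasicOpen f := Subtype.ext hD
  exact this ▸ B.basicOpen_mem U hU f

theorem exists_basicOpen {q : ℕ} (B : PowBasisFamily X q) {U W : X.affineOpens} {x : X}
    (hU : x ∈ U.1) (hW : x ∈ W.1) :
    ∃ D ∈ B.opens, x ∈ D.1 ∧ (∃ f : Γ(X, U), D.1 = X.basicOpen f) ∧ D.1 ≤ U.1 ∧ D.1 ≤ W.1 := by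
  obtain ⟨D, f, g, -, -, hx, hDU, hDW⟩ := exists_common_basicOpen hU hW
  obtain ⟨W', hW', hxW', hle⟩ := B.exists_mem x D hx
  obtain ⟨E, f', g', hf, hg, hxE, hEU, hEW⟩ := exists_common_basicOpen hU hxW'
  exact ⟨E, B.mem_opens hW' g' hg, hxE, ⟨f', hf⟩, hEU, (hEW.trans hle).trans hDW⟩

theorem mem_obj (B : PowBasisFamily X (p ^ e)) (hX : (p : Γ(X, ⊤)) = 0) {U : X.affineOpens}
    (hU : U ∈ B.opens) {s : Γ(X, U)}
    (H : ∀ x ∈ U.1, ∃ W ∈ B.opens, x ∈ W.1 ∧ ∃ h : W.1 ≤ U.1, resHom X h s ∈ B.obj W) :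
    s ∈ B.obj U := by
  refine mem_of_forall_mem_mapPow hX _ fun x hx => ?_
  obtain ⟨W, hW, hxW, h, hs⟩ := H x hx
  obtain ⟨D, f, g, hf, hg, hxD, hDU, hDW⟩ := exists_common_basicOpen hx hxW
  refine ⟨f, D, hf, hDU, hxD, ?_⟩
  rw [B.mapPow_obj _ hU f _ hf, ← B.mapPow_obj _ hW g _ hg hDW]
  have h2 := mem_mapPow (resHom X hDW) hs
  rwa [resHom_resHom] at h2

theorem resHom_mem (B : PowBasisFamily X (p ^ e)) (hX : (p : Γ(X, ⊤)) = 0) {U W : X.affineOpens}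
    (hU : U ∈ B.opens) (hW : W ∈ B.opens) (h : W.1 ≤ U.1) {s : Γ(X, U)} (hs : s ∈ B.obj U) :
    resHom X h s ∈ B.obj W := by
  refine B.mem_obj hX hW fun x hx => ?_
  obtain ⟨D, hD, hxD, ⟨f, hf⟩, h1, h2⟩ := B.exists_basicOpen (h hx) hx
  refine ⟨D, hD, hxD, h2, ?_⟩
  rw [resHom_resHom, ← B.mapPow_obj _ hU f _ hf h1]
  exact mem_mapPow _ hs

/-- The sections over `U` which locally belong to the given family. -/
def localObj (B : PowBasisFamily X (p ^ e)) (hX : (p : Γ(X, ⊤)) = 0) (U : X.affineOpens) :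
    Submodule (powSubring Γ(X, U) (p ^ e)) Γ(X, U) where
  carrier := {s | ∀ x ∈ U.1, ∃ W ∈ B.opens, x ∈ W.1 ∧ ∃ h : W.1 ≤ U.1, resHom X h s ∈ B.obj W}
  zero_mem' x hx := by
    obtain ⟨W, hW, hxW, h⟩ := B.exists_mem x U hx
    exact ⟨W, hW, hxW, h, by rw [map_zero]; exact zero_mem _⟩
  add_mem' {a b} ha hb x hx := by
    obtain ⟨W, hW, hxW, h, h1⟩ := ha x hx
    obtain ⟨W', hW', hxW', h', h2⟩ := hb x hx
    obtain ⟨D, hD, hxD, -, h3, h4⟩ := B.exists_basicOpen hxW hxW'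
    refine ⟨D, hD, hxD, h3.trans h, ?_⟩
    have h5 := B.resHom_mem hX hW hD h3 h1
    have h6 := B.resHom_mem hX hW' hD h4 h2
    rw [resHom_resHom] at h5 h6
    rw [map_add]
    exact add_mem h5 h6
  smul_mem' c a ha x hx := by
    obtain ⟨W, hW, hxW, h, h1⟩ := ha x hx
    refine ⟨W, hW, hxW, h, ?_⟩
    rw [Subring.smul_def, smul_eq_mul, map_mul]
    exact (B.obj W).smul_mem ⟨_, map_mem_powSubring (resHom X h) _ c.2⟩ h1

theorem resHom_mem_localObj (B : PowBasisFamily X (p ^ e)) (hX : (p : Γ(X, ⊤)) = 0)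
    {U W : X.affineOpens} (h : W.1 ≤ U.1) {s : Γ(X, U)} (hs : s ∈ B.localObj hX U) :
    resHom X h s ∈ B.localObj hX W := by
  intro x hx
  obtain ⟨W', hW', hxW', h', h1⟩ := hs x (h hx)
  obtain ⟨D, hD, hxD, -, h3, h4⟩ := B.exists_basicOpen hx hxW'
  refine ⟨D, hD, hxD, h3, ?_⟩
  have h5 := B.resHom_mem hX hW' hD h4 h1
  rw [resHom_resHom] at h5 ⊢
  exact h5

theorem localObj_eq (B : PowBasisFamily X (p ^ e)) (hX : (p : Γ(X, ⊤)) = 0) {U : X.affineOpens}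
    (hU : U ∈ B.opens) : B.localObj hX U = B.obj U :=
  le_antisymm (fun _ hs => B.mem_obj hX hU hs) fun s hs x hx =>
    ⟨U, hU, hx, le_rfl, by rwa [resHom_self]⟩

theorem exists_pow_mul_mem_localObj (B : PowBasisFamily X (p ^ e)) (hX : (p : Γ(X, ⊤)) = 0)
    {U V : X.affineOpens} (f s : Γ(X, U)) (hV : V.1 = X.basicOpen f) (hVU : V.1 ≤ U.1)
    (hs : resHom X hVU s ∈ B.localObj hX V) :
    ∃ K, (f ^ K) ^ p ^ e * s ∈ B.localObj hX U := by
  have hU : IsAffineOpen U.1 := U.2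
  let S : Set Γ(X, U) := {g | ∃ D ∈ B.opens, D.1 = X.basicOpen g ∧ ∃ h : D.1 ≤ U.1,
    ∃ k, ∀ l, k ≤ l → resHom X h ((f ^ l) ^ p ^ e * s) ∈ B.obj D}
  have hS : Ideal.span S = ⊤ := by
    rw [← hU.self_le_iSup_basicOpen_iff]
    intro x hx
    obtain ⟨D, hD, hxD, ⟨g, hg⟩, h1, -⟩ := B.exists_basicOpen hx hx
    refine Opens.mem_iSup.mpr ⟨⟨g, D, hD, hg, h1, ?_⟩, hg ▸ hxD⟩
    let f' : Γ(X, D) := resHom X h1 f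
    obtain ⟨E, hE⟩ : ∃ E : X.affineOpens, E.1 = X.basicOpen f' := ⟨X.affineBasicOpen f', rfl⟩
    have hED : E.1 ≤ D.1 := hE ▸ X.basicOpen_le f'
    have hEV : E.1 ≤ V.1 := by
      rw [hE, hV]
      exact (X.basicOpen_res (U := U.1) (V := D.1) f (homOfLE h1).op).le.trans inf_le_right
    have h2 := B.resHom_mem_localObj hX hEV hs
    rw [B.localObj_eq hX (B.mem_opens hD f' hE), resHom_resHom,
      ← resHom_resHom h1 hED, ← B.mapPow_obj _ hD f' _ hE hED] at h2
    obtain ⟨k, hk⟩ := exists_pow_mem_powColon_resHom hX f' hE hED _ h2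
    refine ⟨k, fun l hl => ?_⟩
    have h3 := Ideal.mul_mem_left _ (f' ^ (l - k)) hk
    rw [← pow_add, Nat.sub_add_cancel hl, mem_powColon] at h3
    rwa [map_mul, map_pow, map_pow]
  obtain ⟨T, hTS, hT⟩ := (Ideal.span_eq_top_iff_finite _).mp hS
  choose D hDB hD hDU k hk using fun g (hg : g ∈ T) => hTS hg
  refine ⟨T.attach.sup fun i => k i.1 i.2, fun x hx => ?_⟩
  rw [← hU.self_le_iSup_basicOpen_iff] at hT
  obtain ⟨⟨g, hg⟩, hxg⟩ := Opens.mem_iSup.mp (hT hx)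
  exact ⟨D g hg, hDB g hg, hD g hg ▸ hxg, hDU g hg, hk g hg _
    ((Finset.le_sup (f := fun i : T => k i.1 i.2) (Finset.mem_attach T ⟨g, hg⟩)))⟩

theorem localObj_le_mapPow (B : PowBasisFamily X (p ^ e)) (hX : (p : Γ(X, ⊤)) = 0)
    {U V : X.affineOpens} (f : Γ(X, U)) (hV : V.1 = X.basicOpen f) (hVU : V.1 ≤ U.1) :
    B.localObj hX V ≤ mapPow (resHom X hVU) (B.localObj hX U) := by
  intro s hs
  let := (resHom X hVU).toAlgebra
  have hloc : IsLocalization.Away f Γ(X, V) := isLocalization_resHom f hV hVU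
  obtain ⟨⟨a, ⟨_, l, rfl⟩⟩, hd⟩ := IsLocalization.surj (Submonoid.powers f) s
  dsimp only at hd
  have h1 : algebraMap Γ(X, U) Γ(X, V) ((f ^ l) ^ (p ^ e - 1) * a) =
      (algebraMap Γ(X, U) Γ(X, V) (f ^ l)) ^ p ^ e * s := by
    have h0 : p ^ e ≠ 0 := pow_ne_zero _ hp.out.ne_zero
    rw [map_mul, ← hd, map_pow _ (f ^ l), mul_comm s, ← mul_assoc, ← pow_succ,
      Nat.sub_add_cancel (Nat.one_le_iff_ne_zero.mpr h0)]
  have h2 : resHom X hVU ((f ^ l) ^ (p ^ e - 1) * a) ∈ B.localObj hX V := by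
    change algebraMap Γ(X, U) Γ(X, V) _ ∈ _
    rw [h1]
    exact pow_mul_mem (B.localObj hX V) _ hs
  obtain ⟨K, hK⟩ := B.exists_pow_mul_mem_localObj hX f _ hV hVU h2
  have h3 := mem_mapPow (resHom X hVU) hK
  refine mem_mapPow_of_pow_mul (A := Γ(X, U)) (B := Γ(X, V)) f _ (K + l) ?_
  have h4 : algebraMap Γ(X, U) Γ(X, V) (f ^ (K + l)) ^ p ^ e * s =
      resHom X hVU ((f ^ K) ^ p ^ e * ((f ^ l) ^ (p ^ e - 1) * a)) := by
    change _ = algebraMap Γ(X, U) Γ(X, V) _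
    rw [map_mul _ ((f ^ K) ^ p ^ e), h1, map_pow _ (f ^ K), ← mul_assoc, ← mul_pow, ← map_mul,
      pow_add]
  rw [h4]
  exact h3

/-- The quasi-coherent module generated by a compatible family on a basis. -/
def toPowModule (B : PowBasisFamily X (p ^ e)) (hX : (p : Γ(X, ⊤)) = 0) :
    PowModule X (p ^ e) where
  obj := B.localObj hX
  map_basicOpen U f := by
    apply le_antisymm
    · exact (mapPow_le_iff _ _ _).mpr fun r hr =>
        B.resHom_mem_localObj hX (W := X.affineBasicOpen f) (X.basicOpen_le f) hr
    · exact B.localObj_le_mapPow hX (V := X.affineBasicOpen f) f rfl (X.basicOpen_le f)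

theorem toPowModule_obj (B : PowBasisFamily X (p ^ e)) (hX : (p : Γ(X, ⊤)) = 0)
    {U : X.affineOpens} (hU : U ∈ B.opens) : (B.toPowModule hX).obj U = B.obj U :=
  B.localObj_eq hX hU

end PowBasisFamily

namespace PowModule

/-- The family of all modules of sections of a quasi-coherent module. -/
def toFamily {q : ℕ} (M : PowModule X q) : PowBasisFamily X q where
  opens := Set.univ
  exists_mem _ U hx := ⟨U, trivial, hx, le_rfl⟩
  basicOpen_mem _ _ _ := trivial
  obj := M.obj
  mapPow_obj U _ f D hD h := by
    obtain ⟨D, hD'⟩ := D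
    dsimp only at hD
    subst hD
    exact M.map_basicOpen U f

theorem mem_obj_of_locally (M : PowModule X (p ^ e)) (hX : (p : Γ(X, ⊤)) = 0) {U : X.affineOpens}
    {s : Γ(X, U)}
    (H : ∀ x ∈ U.1, ∃ W : X.affineOpens, x ∈ W.1 ∧ ∃ h : W.1 ≤ U.1, resHom X h s ∈ M.obj W) :
    s ∈ M.obj U :=
  M.toFamily.mem_obj hX trivial fun x hx =>
    let ⟨W, hxW, h, hs⟩ := H x hx
    ⟨W, trivial, hxW, h, hs⟩

theorem resHom_mem (M : PowModule X (p ^ e)) (hX : (p : Γ(X, ⊤)) = 0) {U W : X.affineOpens}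
    (h : W.1 ≤ U.1) {s : Γ(X, U)} (hs : s ∈ M.obj U) : resHom X h s ∈ M.obj W :=
  M.toFamily.resHom_mem hX trivial trivial h hs

/-- A section of a quasi-coherent module lies, after restriction to a smaller affine open, in the
module generated by the sections over a larger one. -/
theorem mapPow_resHom (M : PowModule X (p ^ e)) (hX : (p : Γ(X, ⊤)) = 0) {U W : X.affineOpens}
    (h : W.1 ≤ U.1) : mapPow (resHom X h) (M.obj U) = M.obj W := by
  refine le_antisymm ((mapPow_le_iff _ _ _).mpr fun r hr => M.resHom_mem hX h hr) fun s hs => ?_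
  refine mem_of_forall_mem_mapPow hX _ fun x hx => ?_
  obtain ⟨D, f, g, hf, hg, hxD, hDU, hDW⟩ := exists_common_basicOpen (h hx) hx
  refine ⟨g, D, hg, hDW, hxD, ?_⟩
  have h2 : (resHom X hDW).comp (resHom X h) = resHom X hDU :=
    RingHom.ext fun a => resHom_resHom h hDW a
  rw [mapPow_mapPow, h2, show mapPow (resHom X hDU) (M.obj U) = M.obj D from
    M.toFamily.mapPow_obj _ trivial f _ hf hDU]
  exact M.resHom_mem hX hDW hs

theorem le_of_basis (M N : PowModule X (p ^ e)) (hX : (p : Γ(X, ⊤)) = 0)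
    (H : ∀ (x : X) (U : X.affineOpens), x ∈ U.1 → ∃ W : X.affineOpens, x ∈ W.1 ∧ W.1 ≤ U.1 ∧
      M.obj W ≤ N.obj W) : M ≤ N := by
  intro U s hs
  refine N.mem_obj_of_locally hX fun x hx => ?_
  obtain ⟨W, hxW, h, hle⟩ := H x U hx
  exact ⟨W, hxW, h, hle (M.resHom_mem hX h hs)⟩

end PowModule

end PowModuleBasis

/-! ### Sections of transforms, colons and differential ideals -/

section Sections

open Scheme Opposite

variable {X Y : Scheme.{u}} {p e : ℕ} [hp : Fact p.Prime]

/-- The pullback of sections along a morphism, as a ring homomorphism. -/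
noncomputable abbrev appHom (f : Y ⟶ X) {U : X.Opens} {W : Y.Opens} (h : W ≤ f ⁻¹ᵁ U) :
    Γ(X, U) →+* Γ(Y, W) :=
  (f.appLE U W h).hom

theorem resHom_comp_appHom (f : Y ⟶ X) {U : X.Opens} {W W' : Y.Opens} (h : W ≤ f ⁻¹ᵁ U)
    (h' : W' ≤ W) : (resHom Y h').comp (appHom f h) = appHom f (h'.trans h) := by
  rw [appHom, appHom, ← CommRingCat.hom_comp, Hom.appLE_map]

theorem appHom_comp_resHom (f : Y ⟶ X) {U U' : X.Opens} {W : Y.Opens} (h : U' ≤ U)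
    (h' : W ≤ f ⁻¹ᵁ U') :
    (appHom f h').comp (resHom X h) = appHom f (h'.trans (fun _ hx => h hx)) := by
  rw [appHom, appHom, ← CommRingCat.hom_comp, Hom.map_appLE]

namespace PowModule

variable (M : PowModule X (p ^ e))

theorem mapPow_appHom_eq (hX : (p : Γ(X, ⊤)) = 0) (f : Y ⟶ X) {U U' : X.affineOpens}
    {W : Y.affineOpens} (h : W.1 ≤ f ⁻¹ᵁ U.1) (h' : W.1 ≤ f ⁻¹ᵁ U'.1) :
    mapPow (appHom f h) (M.obj U) = mapPow (appHom f h') (M.obj U') := by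
  have key : ∀ {U U' : X.affineOpens} (h : W.1 ≤ f ⁻¹ᵁ U.1) (h' : W.1 ≤ f ⁻¹ᵁ U'.1),
      mapPow (appHom f h) (M.obj U) ≤ mapPow (appHom f h') (M.obj U') := by
    intro U U' h h'
    refine (mapPow_le_iff _ _ _).mpr fun m hm => ?_
    refine mem_of_forall_mem_mapPow (natCast_of_hom f hX) _ fun y hy => ?_
    obtain ⟨U'', -, -, -, -, hyU, hU, hU'⟩ := exists_common_basicOpen (h hy) (h' hy)
    have aW : IsAffineOpen W.1 := W.2
    obtain ⟨W'', hyW'', hW''⟩ := exists_affineOpens_mem_le (x := y) (O := f ⁻¹ᵁ U''.1) hyU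
    obtain ⟨D, g, -, hg, -, hyD, hDW, hDW''⟩ := exists_common_basicOpen hy hyW''
    refine ⟨g, D, hg, hDW, hyD, ?_⟩
    have hD := hDW''.trans hW''
    rw [mapPow_mapPow, resHom_comp_appHom, ← appHom_comp_resHom f hU' hD, ← mapPow_mapPow,
      M.mapPow_resHom hX hU']
    have h1 : resHom Y hDW (appHom f h m) = appHom f hD (resHom X hU m) := by
      rw [← RingHom.comp_apply, ← RingHom.comp_apply, resHom_comp_appHom, appHom_comp_resHom]
    rw [h1]
    exact mem_mapPow _ (M.resHom_mem hX hU hm)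
  exact le_antisymm (key h h') (key h' h)

theorem iSup_mapPow_appHom (hX : (p : Γ(X, ⊤)) = 0) (f : Y ⟶ X) {U : X.affineOpens}
    {W : Y.affineOpens} (h : W.1 ≤ f ⁻¹ᵁ U.1) :
    ⨆ (U : X.affineOpens) (h : W.1 ≤ f ⁻¹ᵁ U.1), mapPow (appHom f h) (M.obj U) =
      mapPow (appHom f h) (M.obj U) :=
  le_antisymm (iSup₂_le fun _ h' => (M.mapPow_appHom_eq hX f h' h).le)
    (le_iSup₂ (f := fun (U : X.affineOpens) (h : W.1 ≤ f ⁻¹ᵁ U.1) => mapPow (appHom f h) (M.obj U))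
      U h)

/-- The sections of the total transform over the affine opens which map into some affine open. -/
noncomputable def pullbackFamily (hX : (p : Γ(X, ⊤)) = 0) (f : Y ⟶ X) :
    PowBasisFamily Y (p ^ e) where
  opens := {W | ∃ U : X.affineOpens, W.1 ≤ f ⁻¹ᵁ U.1}
  exists_mem y W hy := by
    obtain ⟨U, hU, -⟩ := exists_affineOpens_mem_le (x := f y) (O := ⊤) trivial
    obtain ⟨W', hyW', h⟩ := exists_affineOpens_mem_le (x := y) (O := f ⁻¹ᵁ U.1 ⊓ W.1) ⟨hU, hy⟩
    exact ⟨W', ⟨U, h.trans inf_le_left⟩, hyW', h.trans inf_le_right⟩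
  basicOpen_mem := fun W ⟨U, h⟩ g => ⟨U, (Y.basicOpen_le g).trans h⟩
  obj W := ⨆ (U : X.affineOpens) (h : W.1 ≤ f ⁻¹ᵁ U.1), mapPow (appHom f h) (M.obj U)
  mapPow_obj := by
    rintro W ⟨U, hU⟩ g D - h
    rw [M.iSup_mapPow_appHom hX f hU, M.iSup_mapPow_appHom hX f (h.trans hU), mapPow_mapPow,
      resHom_comp_appHom]

theorem pullbackFamily_obj (hX : (p : Γ(X, ⊤)) = 0) (f : Y ⟶ X) {U : X.affineOpens}
    {W : Y.affineOpens} (h : W.1 ≤ f ⁻¹ᵁ U.1) :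
    (M.pullbackFamily hX f).obj W = mapPow (appHom f h) (M.obj U) :=
  M.iSup_mapPow_appHom hX f h

/-- Over an affine open mapping into an affine open `U`, the total transform is generated by the
sections over `U`. -/
theorem totalTransform_obj (hX : (p : Γ(X, ⊤)) = 0) (f : Y ⟶ X) {U : X.affineOpens}
    {W : Y.affineOpens} (h : W.1 ≤ f ⁻¹ᵁ U.1) :
    (M.totalTransform f).obj W = mapPow (appHom f h) (M.obj U) := by
  have hY := natCast_of_hom f hX
  have hT : ∀ {U : X.affineOpens} {W : Y.affineOpens} (h : W.1 ≤ f ⁻¹ᵁ U.1),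
      ((M.pullbackFamily hX f).toPowModule hY).obj W = mapPow (appHom f h) (M.obj U) := by
    intro U W h
    rw [PowBasisFamily.toPowModule_obj _ hY (show W ∈ (M.pullbackFamily hX f).opens from ⟨U, h⟩),
      M.pullbackFamily_obj hX f h]
  rw [← hT h]
  congr 1
  apply le_antisymm
  · refine sInf_le fun U W h m hm => ?_
    rw [hT h]
    exact mem_mapPow _ hm
  · refine le_sInf fun N hN => le_of_basis _ _ hY fun y W hy => ?_
    obtain ⟨W', ⟨U, hU⟩, hyW', hle⟩ := (M.pullbackFamily hX f).exists_mem y W hy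
    refine ⟨W', hyW', hle, ?_⟩
    rw [hT hU]
    exact (mapPow_le_iff _ _ _).mpr fun m hm => hN U W' hU m hm

theorem sup_obj {q : ℕ} (M N : PowModule X q) (U : X.affineOpens) :
    (M ⊔ N).obj U = M.obj U ⊔ N.obj U := by
  apply le_antisymm
  · refine iSup_le ?_
    rintro ⟨P, rfl | rfl⟩
    · exact le_sup_left
    · exact le_sup_right
  · exact sup_le (le_def.mp (le_sup_left : M ≤ M ⊔ N) U) (le_def.mp (le_sup_right : N ≤ M ⊔ N) U)

theorem mem_powers_obj (hX : (p : Γ(X, ⊤)) = 0) (U : X.affineOpens) (s : Γ(X, U)) :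
    s ∈ (powers X (p ^ e)).obj U ↔ ∃ c, c ^ p ^ e = s := by
  rw [powers, Submodule.mem_span_singleton, ← mem_powSubring_iff (natCast_section_eq_zero hX U.1)]
  constructor
  · rintro ⟨c, rfl⟩
    rw [Subring.smul_def, smul_eq_mul, mul_one]
    exact c.2
  · exact fun h => ⟨⟨s, h⟩, by rw [Subring.smul_def, smul_eq_mul, mul_one]⟩

end PowModule

/-- `I` is locally generated by one section. -/
def IsLocallyPrincipal (I : X.IdealSheafData) : Prop :=
  ∀ (x : X) (O : X.Opens), x ∈ O → ∃ W : X.affineOpens, x ∈ W.1 ∧ W.1 ≤ O ∧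
    ∃ t, I.ideal W = Ideal.span {t}

theorem ideal_eq_span_of_le (I : X.IdealSheafData) {U W : X.affineOpens} (h : W.1 ≤ U.1)
    {t : Γ(X, U)} (ht : I.ideal U = Ideal.span {t}) :
    I.ideal W = Ideal.span {resHom X h t} := by
  rw [← I.map_ideal (U := W) (V := U) h, ht, Ideal.map_span, Set.image_singleton]
  rfl

theorem IsInvertibleIdeal.isLocallyPrincipal {I : X.IdealSheafData} (hI : IsInvertibleIdeal I) :
    IsLocallyPrincipal I := by
  intro x O hx
  obtain ⟨U, hxU, t, -, ht⟩ := hI x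
  obtain ⟨W, hxW, hW⟩ := exists_affineOpens_mem_le (x := x) (O := U.1 ⊓ O) ⟨hxU, hx⟩
  exact ⟨W, hxW, hW.trans inf_le_right, _, ideal_eq_span_of_le I (hW.trans inf_le_left) ht⟩

theorem ideal_pow_eq_span {I : X.IdealSheafData} {U : X.affineOpens} {t : Γ(X, U)}
    (ht : I.ideal U = Ideal.span {t}) (n : ℕ) : (I ^ n).ideal U = Ideal.span {t ^ n} := by
  rw [IdealSheafData.ideal_pow, Pi.pow_apply, ht, Ideal.span_singleton_pow]

theorem IsLocallyPrincipal.pow {I : X.IdealSheafData} (hI : IsLocallyPrincipal I) (n : ℕ) :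
    IsLocallyPrincipal (I ^ n) := by
  intro x O hx
  obtain ⟨W, hxW, hW, t, ht⟩ := hI x O hx
  exact ⟨W, hxW, hW, t ^ n, ideal_pow_eq_span ht n⟩

theorem mul_mem_ideal_of_mem_idealColon (J K : X.IdealSheafData) {U : X.affineOpens}
    {s t : Γ(X, U)} (hs : s ∈ (idealColon J K).ideal U) (ht : t ∈ K.ideal U) :
    s * t ∈ J.ideal U := by
  have h1 : (idealColon J K).ideal U ≤ (J.ideal U).colon (K.ideal U : Set Γ(X, U)) := by
    rw [idealColon, IdealSheafData.ideal_sSup, sSup_apply]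
    refine iSup_le ?_
    rintro ⟨_, N, hN, rfl⟩ a ha
    rw [Submodule.mem_colon]
    intro b hb
    have := hN U
    rw [IdealSheafData.ideal_mul] at this
    exact this (Ideal.mul_mem_mul ha hb)
  exact Submodule.mem_colon.mp (h1 hs) t ht

namespace PowModule

section Conductor

variable (M : PowModule X (p ^ e))

theorem pow_mul_mem_of_span (hX : (p : Γ(X, ⊤)) = 0) {U W : X.affineOpens} (h : W.1 ≤ U.1)
    (L : X.IdealSheafData) {s : Γ(X, U)} (hs : ∀ t ∈ L.ideal U, t ^ p ^ e * s ∈ M.obj U)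
    {t : Γ(X, W)} (ht : t ∈ L.ideal W) : t ^ p ^ e * resHom X h s ∈ M.obj W := by
  have h1 : L.ideal W ≤ powColon (natCast_section_eq_zero hX W.1) (M.obj W) (resHom X h s) := by
    rw [← L.map_ideal (U := W) (V := U) h, Ideal.map_le_iff_le_comap]
    intro a ha
    rw [Ideal.mem_comap, mem_powColon]
    have := M.resHom_mem hX h (hs a ha)
    rwa [map_mul, map_pow] at this
  exact h1 ht

theorem forall_pow_mul_mem_iff (hX : (p : Γ(X, ⊤)) = 0) {U : X.affineOpens}
    {L : X.IdealSheafData} {t : Γ(X, U)} (ht : L.ideal U = Ideal.span {t}) (s : Γ(X, U)) :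
    (∀ a ∈ L.ideal U, a ^ p ^ e * s ∈ M.obj U) ↔ t ^ p ^ e * s ∈ M.obj U := by
  have h1 : (∀ a ∈ L.ideal U, a ^ p ^ e * s ∈ M.obj U) ↔
      L.ideal U ≤ powColon (natCast_section_eq_zero hX U.1) (M.obj U) s := Iff.rfl
  rw [h1, ht, Ideal.span_le, Set.singleton_subset_iff]
  rfl

/-- The conductor `(M : F^e L)`, over the affine opens where `L` is principal. -/
def conductorFamily (hX : (p : Γ(X, ⊤)) = 0) {L : X.IdealSheafData} (hL : IsLocallyPrincipal L) :
    PowBasisFamily X (p ^ e) where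
  opens := {W | ∃ t, L.ideal W = Ideal.span {t}}
  exists_mem x U hx :=
    let ⟨W, hxW, h, ht⟩ := hL x U.1 hx
    ⟨W, ht, hxW, h⟩
  basicOpen_mem := fun U ⟨t, ht⟩ f =>
    ⟨_, ideal_eq_span_of_le L (W := X.affineBasicOpen f) (X.basicOpen_le f) ht⟩
  obj U :=
    { carrier := {s | ∀ t ∈ L.ideal U, t ^ p ^ e * s ∈ M.obj U}
      zero_mem' := fun t _ => by rw [mul_zero]; exact zero_mem _
      add_mem' := fun ha hb t ht => by rw [mul_add]; exact add_mem (ha t ht) (hb t ht)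
      smul_mem' := fun c a ha t ht => by
        have := (M.obj U).smul_mem c (ha t ht)
        rw [Subring.smul_def, smul_eq_mul] at this ⊢
        rwa [mul_left_comm] }
  mapPow_obj := by
    rintro U ⟨t, ht⟩ f D hD h
    apply le_antisymm
    · exact (mapPow_le_iff _ _ _).mpr fun r hr a ha => M.pow_mul_mem_of_span hX h L hr ha
    · intro s hs
      have h0 : p ^ e ≠ 0 := pow_ne_zero _ hp.out.ne_zero
      let := (resHom X h).toAlgebra
      have hloc : IsLocalization.Away f Γ(X, D) := isLocalization_resHom f hD h
      have h1 := hs (resHom X h t) (by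
        rw [ideal_eq_span_of_le L h ht]; exact Ideal.mem_span_singleton_self _)
      obtain ⟨⟨a, ⟨_, l, rfl⟩⟩, hd⟩ := IsLocalization.surj (Submonoid.powers f) s
      dsimp only at hd
      have h2 : resHom X h ((f ^ l) ^ (p ^ e - 1) * a) = resHom X h (f ^ l) ^ p ^ e * s := by
        change algebraMap Γ(X, U) Γ(X, D) _ = algebraMap Γ(X, U) Γ(X, D) _ ^ p ^ e * s
        rw [map_mul, ← hd, map_pow _ (f ^ l), mul_comm s, ← mul_assoc, ← pow_succ,
          Nat.sub_add_cancel (Nat.one_le_iff_ne_zero.mpr h0)]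
      have h3 : resHom X h (t ^ p ^ e * ((f ^ l) ^ (p ^ e - 1) * a)) ∈ M.obj D := by
        rw [map_mul, h2, map_pow, mul_left_comm]
        exact pow_mul_mem _ _ h1
      rw [← M.mapPow_resHom hX h] at h3
      obtain ⟨k, hk⟩ := exists_pow_mem_powColon_resHom hX f hD h _ h3
      refine mem_mapPow_of_pow_mul (A := Γ(X, U)) (B := Γ(X, D)) f _ (k + l) ?_
      have h4 : algebraMap Γ(X, U) Γ(X, D) (f ^ (k + l)) ^ p ^ e * s =
          resHom X h ((f ^ k) ^ p ^ e * ((f ^ l) ^ (p ^ e - 1) * a)) := by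
        rw [map_mul _ ((f ^ k) ^ p ^ e), h2, map_pow _ (f ^ k), ← mul_assoc, ← mul_pow, ← map_mul,
          ← pow_add]
        rfl
      rw [h4]
      refine mem_mapPow _ ((M.forall_pow_mul_mem_iff hX ht _).mpr ?_)
      rw [mem_powColon] at hk
      rwa [mul_left_comm]

/-- For a locally principal ideal `L`, the conductor `(M : F^e L)` is computed on affine opens. -/
theorem mem_conductor_iff (hX : (p : Γ(X, ⊤)) = 0) {L : X.IdealSheafData}
    (hL : IsLocallyPrincipal L) (U : X.affineOpens) (s : Γ(X, U)) :
    s ∈ (M.conductor L).obj U ↔ ∀ t ∈ L.ideal U, t ^ p ^ e * s ∈ M.obj U := by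
  let B := M.conductorFamily hX hL
  let P := B.toPowModule hX
  have hP : ∀ U : X.affineOpens, ∀ s ∈ P.obj U, ∀ t ∈ L.ideal U, t ^ p ^ e * s ∈ M.obj U := by
    intro U s hs t ht
    refine M.mem_obj_of_locally hX fun x hx => ?_
    obtain ⟨W, hW, hxW, h, h1⟩ := hs x hx
    refine ⟨W, hxW, h, ?_⟩
    rw [map_mul, map_pow]
    refine h1 _ ?_
    rw [← L.map_ideal (U := W) (V := U) h]
    exact Ideal.mem_map_of_mem _ ht
  have hP' : P ≤ M.conductor L := le_sSup fun U t ht s hs => hP U s hs t ht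
  constructor
  · intro hs
    have h1 : M.conductor L ≤ P := by
      refine sSup_le fun N hN => le_of_basis _ _ hX fun x U hx => ?_
      obtain ⟨W, hW, hxW, hle⟩ := B.exists_mem x U hx
      refine ⟨W, hxW, hle, fun s hs => ?_⟩
      rw [B.toPowModule_obj hX hW]
      exact fun t ht => hN W t ht s hs
    exact hP U s (le_def.mp h1 U hs)
  · intro hs
    refine le_def.mp hP' U ?_
    intro x hx
    obtain ⟨W, hW, hxW, hle⟩ := B.exists_mem x U hx
    exact ⟨W, hW, hxW, hle, fun t ht => M.pow_mul_mem_of_span hX hle L hs ht⟩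

end Conductor

section Transform

variable (M : PowModule X (p ^ e)) (hX : (p : Γ(X, ⊤)) = 0) (f : Y ⟶ X) {I : X.IdealSheafData}

theorem mem_sup_powers_iff (hX : (p : Γ(X, ⊤)) = 0) (U : X.affineOpens) (s : Γ(X, U)) :
    s ∈ (M ⊔ powers X (p ^ e)).obj U ↔ ∃ m ∈ M.obj U, ∃ c, m + c ^ p ^ e = s := by
  rw [sup_obj, Submodule.mem_sup]
  refine exists_congr fun m => and_congr_right fun _ => ?_
  constructor
  · rintro ⟨_, hz, rfl⟩
    obtain ⟨c, rfl⟩ := (mem_powers_obj hX U _).mp hz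
    exact ⟨c, rfl⟩
  · rintro ⟨c, rfl⟩
    exact ⟨_, (mem_powers_obj hX U _).mpr ⟨c, rfl⟩, rfl⟩

/-- The sections of the `a`-transform over affine opens where the exceptional ideal is principal. -/
theorem mem_transform_iff (hX : (p : Γ(X, ⊤)) = 0) (hI : IsInvertibleIdeal (I.comap f)) (a : ℕ)
    {U : X.affineOpens} {W : Y.affineOpens} (h : W.1 ≤ f ⁻¹ᵁ U.1) {t : Γ(Y, W)}
    (ht : (I.comap f).ideal W = Ideal.span {t}) (s : Γ(Y, W)) :
    s ∈ (M.transform f I a).obj W ↔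
      ∃ m ∈ mapPow (appHom f h) (M.obj U), ∃ c, m + c ^ p ^ e = (t ^ a) ^ p ^ e * s := by
  have hY := natCast_of_hom f hX
  rw [transform, mem_conductor_iff _ hY (hI.isLocallyPrincipal.pow a),
    forall_pow_mul_mem_iff _ hY (ideal_pow_eq_span ht a), mem_sup_powers_iff _ hY,
    M.totalTransform_obj hX f h]

end Transform

section Diff

/-- On a reduced scheme whose rings of sections are finite over their `q`-th powers, the ideals
`Diff_+^i`, `i < q`, are computed on affine opens. -/
theorem ideal_diffPlus [IsReduced X] (hX : (p : Γ(X, ⊤)) = 0)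
    (hfin : ∀ U : X.affineOpens, IsPowFinite (p ^ e) Γ(X, U)) (M : PowModule X (p ^ e)) {i : ℕ}
    (hi : i < p ^ e) (U : X.affineOpens) :
    (M.diffPlus i).ideal U = diffPlusIdeal ℤ i (M.obj U : Set Γ(X, U)) := by
  let J : X.IdealSheafData :=
    { ideal := fun U => diffPlusIdeal ℤ i (M.obj U : Set Γ(X, U))
      map_ideal_basicOpen := fun U f => by
        rw [← M.map_basicOpen U f]
        let := (resHom X (X.basicOpen_le f)).toAlgebra
        have hloc : IsLocalization.Away f Γ(X, X.basicOpen f) :=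
          isLocalization_resHom (D := X.affineBasicOpen f) f rfl (X.basicOpen_le f)
        exact map_diffPlusIdeal_away (B := Γ(X, X.basicOpen f))
          (natCast_section_eq_zero hX U.1) (hfin U) f hi (M.obj U) }
  have h1 : M.diffPlus i = J :=
    le_antisymm (sInf_le fun U => le_rfl) (le_sInf fun K hK U => hK U)
  rw [h1]

theorem diffPlus_zero {q : ℕ} (M : PowModule X q) : M.diffPlus 0 = ⊥ := by
  refine le_bot_iff.mp (sInf_le fun U => ?_)
  rw [diffPlusIdeal_zero]
  exact bot_le

end Diff

end PowModule

end Sections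

/-! ### Regular `F`-finite schemes -/

section Regular

open Scheme Opposite

variable {V : Scheme.{u}} {p : ℕ} [hp : Fact p.Prime]

theorem isIntegral_of_isRegularScheme [IrreducibleSpace V] [hV : IsRegularScheme V] :
    IsIntegral V := by
  have h1 : ∀ x : V, _root_.IsReduced (V.presheaf.stalk x) := fun x => by
    have := hV.stalk_regular x
    have := IsRegularLocalRing.isDomain (V.presheaf.stalk x)
    infer_instance
  have := isReduced_of_isReduced_stalk V
  exact isIntegral_of_irreducibleSpace_of_isReduced V

theorem isDomain_section [IsIntegral V] (U : V.affineOpens) {x : V} (hx : x ∈ U.1) :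
    IsDomain Γ(V, U) := by
  have : Nonempty U.1 := ⟨⟨x, hx⟩⟩
  infer_instance

theorem isNoetherianRing_section [IsNoetherian V] (U : V.affineOpens) :
    IsNoetherianRing Γ(V, U) :=
  IsLocallyNoetherian.component_noetherian U

theorem IsFFinite.isPowFinite (h : IsFFinite V p) (U : V.affineOpens) :
    IsPowFinite p Γ(V, U) := by
  have := h.finite U
  exact IsPowFinite.of_finite (natCast_section_eq_zero h.char_eq_zero U.1)

theorem map_pointIdeal_germ (U : V.affineOpens) {x : V} (hx : x ∈ U.1) :
    (pointIdeal U.1 x hx).map (V.presheaf.germ U.1 x hx).hom =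
      IsLocalRing.maximalIdeal (V.presheaf.stalk x) := by
  let := (V.presheaf.germ U.1 x hx).hom.toAlgebra
  have := isLocalization_pointIdeal U x hx
  exact IsLocalization.AtPrime.map_eq_maximalIdeal (pointIdeal U.1 x hx) (V.presheaf.stalk x)

theorem map_pointIdeal_resHom {U W : V.affineOpens} {x : V} (hxU : x ∈ U.1) (f : Γ(V, U))
    (hW : W.1 = V.basicOpen f) (h : W.1 ≤ U.1) (hxW : x ∈ W.1) :
    (pointIdeal U.1 x hxU).map (resHom V h) = pointIdeal W.1 x hxW := by
  let := (resHom V h).toAlgebra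
  have := isLocalization_resHom f hW h
  have h1 : (pointIdeal W.1 x hxW).comap (algebraMap Γ(V, U) Γ(V, W)) = pointIdeal U.1 x hxU := by
    change Ideal.comap _ (Ideal.comap _ _) = Ideal.comap _ _
    rw [Ideal.comap_comap]
    congr 1
    change ((V.presheaf.map (homOfLE h).op) ≫ V.presheaf.germ W.1 x hxW).hom = _
    have hg : V.presheaf.map (homOfLE h).op ≫ V.presheaf.germ W.1 x hxW =
        V.presheaf.germ U.1 x hxU := V.presheaf.germ_res _ _ _
    rw [hg]
  rw [← h1]
  exact IsLocalization.map_under (Submonoid.powers f) Γ(V, W) _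

/-- Around each point there are `p`-bases of the ring of sections, adapted to a given regular
quotient of the local ring. -/
theorem exists_isPowBasis_nbhd [IsNoetherian V] [IrreducibleSpace V] [hV : IsRegularScheme V]
    (hF : IsFFinite V p) (U : V.affineOpens) {x : V} (hx : x ∈ U.1) (I : Ideal Γ(V, U))
    (S : Type u) [CommRing S] [IsRegularLocalRing S] (φ : V.presheaf.stalk x →+* S)
    (hφ : Function.Surjective φ) (hI : RingHom.ker φ = I.map (V.presheaf.germ U.1 x hx).hom) :
    ∃ (W : V.affineOpens) (f : Γ(V, U)) (_ : W.1 = V.basicOpen f) (h : W.1 ≤ U.1) (n : ℕ)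
      (w : Fin n → Γ(V, W)) (J : Finset (Fin n)), x ∈ W.1 ∧ IsPowBasis p w ∧
        I.map (resHom V h) = Ideal.span (w '' J) := by
  have := hV.stalk_regular x
  have := isIntegral_of_isRegularScheme (V := V)
  have := isDomain_section U hx
  have := isNoetherianRing_section U
  have hU := natCast_section_eq_zero hF.char_eq_zero U.1
  let alg := (V.presheaf.germ U.1 x hx).hom.toAlgebra
  have hloc := isLocalization_pointIdeal U x hx
  have hfin : IsPowFinite p (V.presheaf.stalk x) :=
    (hF.isPowFinite U).localization hp.out.ne_zero (pointIdeal U.1 x hx).primeCompl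
  obtain ⟨n, w₀, J, hw₀, hJ⟩ := IsRegularLocalRing.exists_isPowBasis (V.presheaf.stalk x) S
    (natCast_stalk_eq_zero hF.char_eq_zero x) hfin φ hφ
  obtain ⟨f, hf, w, hw⟩ := IsPowBasis.spread_out (R := V.presheaf.stalk x) hU (hF.isPowFinite U)
    (pointIdeal U.1 x hx) hw₀ J I (hI ▸ hJ)
  obtain ⟨W, hW⟩ : ∃ W : V.affineOpens, W.1 = V.basicOpen f := ⟨V.affineBasicOpen f, rfl⟩
  have hWU : W.1 ≤ U.1 := hW ▸ V.basicOpen_le f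
  have hxW : x ∈ W.1 := by
    rw [hW]
    by_contra hxf
    exact hf (mem_pointIdeal_iff.mpr hxf)
  let alg' := (resHom V hWU).toAlgebra
  have hloc' : IsLocalization.Away f Γ(V, W) := isLocalization_resHom f hW hWU
  obtain ⟨h1, h2⟩ := hw Γ(V, W)
  exact ⟨W, f, hW, hWU, n, _, J, hxW, h1, h2⟩

/-- Around each point `x` there is a `p`-basis part of which generates the ideal of `x`. -/
theorem exists_isPowBasis_point [IsNoetherian V] [IrreducibleSpace V] [hV : IsRegularScheme V]
    (hF : IsFFinite V p) (U : V.affineOpens) {x : V} (hx : x ∈ U.1) :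
    ∃ (W : V.affineOpens) (_ : W.1 ≤ U.1) (n : ℕ) (w : Fin n → Γ(V, W)) (J : Finset (Fin n))
      (hxW : x ∈ W.1), IsPowBasis p w ∧ pointIdeal W.1 x hxW = Ideal.span (w '' J) := by
  have := hV.stalk_regular x
  obtain ⟨W, f, hW, h, n, w, J, hxW, h1, h2⟩ := exists_isPowBasis_nbhd hF U hx
    (pointIdeal U.1 x hx) (IsLocalRing.ResidueField (V.presheaf.stalk x))
    (IsLocalRing.residue _) IsLocalRing.residue_surjective (by
      rw [IsLocalRing.ker_residue, map_pointIdeal_germ])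
  exact ⟨W, h, n, w, J, hxW, h1, by rw [← h2, map_pointIdeal_resHom hx f hW h hxW]⟩

theorem ker_stalkMap_subschemeι (Z : V.IdealSheafData) (z : Z.subscheme) :
    RingHom.ker (Z.subschemeι.stalkMap z).hom = stalkIdeal Z (Z.subschemeι z) := by
  obtain ⟨U, hU, -⟩ := exists_affineOpens_mem_le (x := Z.subschemeι z) (O := ⊤) trivial
  have aU : IsAffineOpen U.1 := U.2
  let W : Z.subscheme.affineOpens := ⟨Z.subschemeι ⁻¹ᵁ U.1, aU.preimage Z.subschemeι⟩
  have hzW : z ∈ W.1 := hU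
  have hker := Z.ker_subschemeι_app U
  have hsurj := Z.subschemeι_app_surjective U
  have hcomm : ∀ a : Γ(V, U), (Z.subschemeι.stalkMap z).hom ((V.presheaf.germ U.1 _ hU).hom a) =
      (Z.subscheme.presheaf.germ W.1 z hzW).hom ((Z.subschemeι.app U.1).hom a) := by
    intro a
    exact Scheme.Hom.germ_stalkMap_apply Z.subschemeι U.1 z hU a
  have hpt : ∀ a : Γ(V, U), (Z.subschemeι.app U.1).hom a ∈ pointIdeal W.1 z hzW →
      a ∈ pointIdeal U.1 _ hU := by
    intro a ha
    rw [pointIdeal, Ideal.mem_comap] at ha ⊢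
    rw [← hcomm] at ha
    rw [IsLocalRing.mem_maximalIdeal, mem_nonunits_iff] at ha ⊢
    exact fun h => ha (h.map _)
  rw [stalkIdeal_eq Z U hU]
  apply le_antisymm
  · intro r hr
    let alg := (V.presheaf.germ U.1 _ hU).hom.toAlgebra
    have hloc := isLocalization_pointIdeal U _ hU
    obtain ⟨⟨a, s⟩, has⟩ := IsLocalization.surj (pointIdeal U.1 _ hU).primeCompl r
    dsimp only at has
    have hs := IsLocalization.map_units (V.presheaf.stalk (Z.subschemeι z)) s
    have h1 : (Z.subschemeι.stalkMap z).hom ((V.presheaf.germ U.1 _ hU).hom a) = 0 := by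
      change (Z.subschemeι.stalkMap z).hom (algebraMap _ _ a) = 0
      rw [← has, map_mul, show (Z.subschemeι.stalkMap z).hom r = 0 from hr, zero_mul]
    rw [hcomm] at h1
    let alg' := (Z.subscheme.presheaf.germ W.1 z hzW).hom.toAlgebra
    have hloc' := isLocalization_pointIdeal W z hzW
    obtain ⟨⟨c, hc⟩, hca⟩ := (IsLocalization.map_eq_zero_iff (pointIdeal W.1 z hzW).primeCompl
      (Z.subscheme.presheaf.stalk z) _).mp h1
    obtain ⟨c, rfl⟩ := hsurj c
    dsimp only at hca
    have h2 : c * a ∈ Z.ideal U := by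
      rw [← hker, RingHom.mem_ker, map_mul]
      exact hca
    have hc' : c ∈ (pointIdeal U.1 _ hU).primeCompl := by
      intro hcU
      apply hc
      rw [SetLike.mem_coe, pointIdeal, Ideal.mem_comap] at hcU ⊢
      have h3 := hcomm c
      change (Z.subscheme.presheaf.germ W.1 z hzW).hom ((Z.subschemeι.app U.1).hom c) ∈ _
      rw [← h3]
      rw [IsLocalRing.mem_maximalIdeal, mem_nonunits_iff] at hcU ⊢
      exact fun h => hcU (isUnit_of_map_unit _ _ h)
    have hcu := IsLocalization.map_units (V.presheaf.stalk (Z.subschemeι z))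
      (⟨c, hc'⟩ : (pointIdeal U.1 _ hU).primeCompl)
    have h3 := Ideal.mem_map_of_mem (algebraMap Γ(V, U) (V.presheaf.stalk (Z.subschemeι z))) h2
    rw [map_mul, ← has] at h3
    have h4 := (Ideal.unit_mul_mem_iff_mem _ hcu).mp h3
    exact (Ideal.mul_unit_mem_iff_mem _ hs).mp h4
  · rw [Ideal.map_le_iff_le_comap]
    intro a ha
    rw [Ideal.mem_comap, RingHom.mem_ker, hcomm]
    rw [← hker, RingHom.mem_ker] at ha
    have h5 : (Z.subschemeι.app U.1).hom a = 0 := ha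
    rw [h5, map_zero]

/-- Around each point of a regular closed subscheme there is a `p`-basis part of which generates the
ideal of the subscheme. -/
theorem exists_isPowBasis_subscheme [IsNoetherian V] [IrreducibleSpace V] [hV : IsRegularScheme V]
    (hF : IsFFinite V p) (Z : V.IdealSheafData) (hZ : IsRegularScheme Z.subscheme) {x : V}
    (hxZ : x ∈ Z.support) (O : V.Opens) (hx : x ∈ O) :
    ∃ (W : V.affineOpens) (_ : W.1 ≤ O) (n : ℕ) (w : Fin n → Γ(V, W)) (J : Finset (Fin n)),
      x ∈ W.1 ∧ IsPowBasis p w ∧ Z.ideal W = Ideal.span (w '' J) := by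
  obtain ⟨U, hxU, hUO⟩ := exists_affineOpens_mem_le hx
  have h0 : x ∈ Set.range Z.subschemeι := by
    rw [Z.range_subschemeι]; exact hxZ
  obtain ⟨z, rfl⟩ := h0
  have := hZ.stalk_regular z
  obtain ⟨W, f, hW, h, n, w, J, hxW, h1, h2⟩ := exists_isPowBasis_nbhd hF U hxU (Z.ideal U)
    (Z.subscheme.presheaf.stalk z) (Z.subschemeι.stalkMap z).hom
    (Z.subschemeι.stalkMap_surjective z) (by
      rw [ker_stalkMap_subschemeι, stalkIdeal_eq Z U hxU])
  refine ⟨W, h.trans hUO, n, w, J, hxW, h1, ?_⟩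
  rw [← h2, ← Z.map_ideal (U := W) (V := U) h]
  rfl

end Regular

/-! ### The singular locus and the orders of the differential ideals -/

section SingularLocus

open Scheme Opposite

variable {X V : Scheme.{u}} {p e : ℕ} [hp : Fact p.Prime]

theorem PowModule.mem_sing_of_le_eta {q : ℕ} (hq : q ≠ 0) (M : PowModule X q) {x : X}
    (hx : (q : ℕ∞) ≤ eta q M.diffPlus x) : x ∈ M.sing := by
  rcases Nat.eq_or_lt_of_le (Nat.one_le_iff_ne_zero.mpr hq) with rfl | h1
  · change x ∈ ((M.diffPlus 0).support : Set X)
    rw [M.diffPlus_zero, IdealSheafData.support_bot]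
    trivial
  · rw [le_eta_iff] at hx
    have h2 := hx (q - 1) (Finset.mem_Ico.mpr ⟨by omega, by omega⟩)
    rw [show q - (q - 1) = 1 by omega, pow_one] at h2
    exact (mem_support_iff_stalkIdeal_le _ _).mpr h2

theorem eta_mono {q : ℕ} {G G' : ℕ → X.IdealSheafData} (h : ∀ i ∈ Finset.Ico 1 q, G i ≤ G' i)
    (x : X) : eta q G' x ≤ eta q G x := by
  refine iInf₂_mono fun i hi => add_le_add_left ?_ _
  refine iSup₂_mono' fun n hn => ⟨n, le_trans ?_ hn, le_rfl⟩
  exact iSup₂_mono fun U hx => Ideal.map_mono (h i hi U)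

/-- On a reduced `F`-finite scheme the ideals `Diff_+^i`, `i < q`, are computed on affine opens. -/
theorem ideal_diffPlus_of_isFFinite [IsReduced V] (hF : IsFFinite V p) (M : PowModule V (p ^ e))
    {i : ℕ} (hi : i < p ^ e) (U : V.affineOpens) :
    (M.diffPlus i).ideal U = diffPlusIdeal ℤ i (M.obj U : Set Γ(V, U)) :=
  M.ideal_diffPlus hF.char_eq_zero (fun U => (hF.isPowFinite U).pow_prime
    (natCast_section_eq_zero hF.char_eq_zero U.1) e) hi U

theorem PowModule.le_eta_of_mem_sing [IsNoetherian V] [IrreducibleSpace V] [hV : IsRegularScheme V]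
    (hF : IsFFinite V p) (M : PowModule V (p ^ e)) {x : V} (hx : x ∈ M.sing) :
    ((p ^ e : ℕ) : ℕ∞) ≤ eta (p ^ e) M.diffPlus x := by
  have := isIntegral_of_isRegularScheme (V := V)
  rw [le_eta_iff]
  intro i hi
  rw [Finset.mem_Ico] at hi
  obtain ⟨U, hxU, -⟩ := exists_affineOpens_mem_le (x := x) (O := ⊤) trivial
  obtain ⟨W, -, n, w, J, hxW, hw, hJ⟩ := exists_isPowBasis_point hF U hxU
  have hW := natCast_section_eq_zero hF.char_eq_zero W.1
  have hx' : (M.diffPlus (p ^ e - 1)).ideal W ≤ pointIdeal W.1 x hxW :=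
    (mem_support_iff_le_pointIdeal _ W hxW).mp hx
  rw [ideal_diffPlus_of_isFFinite hF M (by omega)] at hx'
  rw [stalkIdeal_le_pow_iff _ W hxW]
  intro f hf
  rw [ideal_diffPlus_of_isFFinite hF M hi.2] at hf
  refine ⟨1, fun h1 => (Ideal.ne_top_iff_one _).mp (Ideal.IsPrime.ne_top inferInstance) h1, ?_⟩
  rw [one_mul, hJ]
  have hw' := hw.pow_prime hW e
  refine hw'.mem_span_pow_of_hasse hW J (by omega) fun β _ hβ => ?_
  rw [← hJ]
  apply hx'
  have h1 : DiffLT (RingHom.id Γ(V, W)) (∑ j, β j + 1) (hw'.hasse hW β) :=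
    IsPowBasis.diffLT_hasse hW hw' β fun j =>
      (Finset.single_le_sum (fun k _ => Nat.zero_le (β k)) (Finset.mem_univ j)).trans_lt (by omega)
  have h2 : DiffLT (RingHom.id Γ(V, W)) (p ^ e - 1 - i + 1) (hw'.hasse hW β) := h1.mono (by omega)
  have h3 := h2.map_diffPlusIdeal hf
  rwa [show i + (p ^ e - 1 - i) = p ^ e - 1 by omega] at h3

/-- `Sing(M, 1)` is the locus where the order of `M` is at least `q`. -/
theorem PowModule.sing_eq [IsNoetherian V] [IrreducibleSpace V] [hV : IsRegularScheme V]
    (hF : IsFFinite V p) (M : PowModule V (p ^ e)) :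
    M.sing = {x : V | ((p ^ e : ℕ) : ℕ∞) ≤ eta (p ^ e) M.diffPlus x} := by
  ext x
  exact ⟨fun h => M.le_eta_of_mem_sing hF h,
    fun h => M.mem_sing_of_le_eta (pow_ne_zero e hp.out.ne_zero) h⟩

end SingularLocus

/-! ### The affine charts of a blowup as open subschemes -/

/-- `α : A → B` is an affine chart of the blowup of `I` with exceptional ideal generated by `x ∈ I`:
`B` is a domain, `I B = (x)` with `x ≠ 0` in `B`, and `B` is universal for these properties, with
"nonzero" replaced by "nonzerodivisor". -/
structure IsBlowupChart {A B : Type u} [CommRing A] [CommRing B] (I : Ideal A) (x : A)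
    (α : A →+* B) : Prop where
  isDomain : IsDomain B
  ne_zero : α x ≠ 0
  map_eq : I.map α = Ideal.span {α x}
  exists_lift : ∀ {C : Type u} [CommRing C] (ψ : A →+* C), ψ x ∈ nonZeroDivisors C →
    I.map ψ = Ideal.span {ψ x} → ∃ θ : B →+* C, θ.comp α = ψ
  hom_ext : ∀ {C : Type u} [CommRing C] (θ₁ θ₂ : B →+* C), θ₁.comp α = θ₂.comp α →
    θ₁ (α x) ∈ nonZeroDivisors C → θ₁ = θ₂

theorem isBlowupChart_blowupChart {A K : Type u} [CommRing A] [Field K] [Algebra A K]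
    [IsFractionRing A K] {I : Ideal A} {x : A} (hx : x ∈ I) (hx0 : x ≠ 0) :
    IsBlowupChart I x (algebraMap A (blowupChart K I hx)) where
  isDomain := inferInstance
  ne_zero := by rwa [Ne, map_eq_zero_iff _ algebraMap_blowupChart_injective]
  map_eq := map_blowupChart hx0
  exists_lift ψ hψ h := exists_blowupChart_lift ψ hψ h.le
  hom_ext _ _ h hnz := blowupChart_hom_ext h hnz

section Charts

open Scheme Opposite

variable {V V₁ : Scheme.{u}}

theorem appLE_SpecMap_fromSpec {U : V.Opens} (hU : IsAffineOpen U) {C : Type u} [CommRing C]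
    (ψ : Γ(V, U) →+* C)
    (h : ⊤ ≤ (Spec.map (CommRingCat.ofHom ψ) ≫ hU.fromSpec) ⁻¹ᵁ U) :
    (Spec.map (CommRingCat.ofHom ψ) ≫ hU.fromSpec).appLE U ⊤ h =
      CommRingCat.ofHom ψ ≫ (ΓSpecIso (CommRingCat.of C)).inv := by
  have h1 : (⊤ : (Spec Γ(V, U)).Opens) ≤ hU.fromSpec ⁻¹ᵁ U := by
    rw [hU.fromSpec_preimage_self]
  have h2 : hU.fromSpec.appLE U ⊤ h1 = (ΓSpecIso Γ(V, U)).inv := by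
    rw [Hom.appLE, hU.fromSpec_app_self, Category.assoc, ← Functor.map_comp]
    exact (congrArg ((ΓSpecIso Γ(V, U)).inv ≫ ·) ((Spec Γ(V, U)).presheaf.map_id _)).trans
      (Category.comp_id _)
  have h3 : (⊤ : (Spec (CommRingCat.of C)).Opens) ≤ Spec.map (CommRingCat.ofHom ψ) ⁻¹ᵁ ⊤ := le_rfl
  rw [← Hom.appLE_comp_appLE _ _ U ⊤ ⊤ h1 h3, h2]
  have h4 := ΓSpecIso_inv_naturality (CommRingCat.ofHom ψ)
  rw [h4]
  congr 1

theorem le_preimage_SpecMap_fromSpec {U : V.Opens} (hU : IsAffineOpen U) {C : Type u} [CommRing C]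
    (ψ : Γ(V, U) →+* C) :
    (⊤ : (Spec (CommRingCat.of C)).Opens) ≤
      (Spec.map (CommRingCat.ofHom ψ) ≫ hU.fromSpec) ⁻¹ᵁ U := by
  intro t _
  have h := hU.range_fromSpec
  have h2 : hU.fromSpec (Spec.map (CommRingCat.ofHom ψ) t) ∈ (U : Set V) := h ▸ ⟨_, rfl⟩
  rw [Hom.mem_preimage, Hom.comp_apply]
  exact h2

theorem isInvertibleIdeal_comap_SpecMap (Z : V.IdealSheafData) (U : V.affineOpens)
    (hU : IsAffineOpen U.1) {C : Type u} [CommRing C] (ψ : Γ(V, U) →+* C) {c : C}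
    (hc : c ∈ nonZeroDivisors C) (hψ : (Z.ideal U).map ψ = Ideal.span {c}) :
    IsInvertibleIdeal (Z.comap (Spec.map (CommRingCat.ofHom ψ) ≫ hU.fromSpec)) := by
  intro t
  have hT : (⊤ : (Spec (CommRingCat.of C)).Opens) ∈ (Spec (CommRingCat.of C)).affineOpens :=
    isAffineOpen_top _
  have hle := le_preimage_SpecMap_fromSpec hU ψ
  let i := (ΓSpecIso (CommRingCat.of C)).symm.commRingCatIsoToRingEquiv
  refine ⟨⟨⊤, hT⟩, trivial, i c, ?_, ?_⟩
  · exact (MulEquivClass.map_nonZeroDivisors i) ▸ Submonoid.mem_map_of_mem _ hc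
  · have h1 := ideal_comap (Spec.map (CommRingCat.ofHom ψ) ≫ hU.fromSpec) Z U ⟨⊤, hT⟩ hle
    rw [h1, appLE_SpecMap_fromSpec hU ψ hle, CommRingCat.hom_comp, ← Ideal.map_map]
    change Ideal.map _ (Ideal.map ψ (Z.ideal U)) = _
    rw [hψ, Ideal.map_span, Set.image_singleton]
    rfl

theorem Spec_hom_ext {N : Scheme.{u}} {A B : Type u} [CommRing A] [CommRing B] (α : A →+* B)
    (a b : N ⟶ Spec (CommRingCat.of B))
    (h : a ≫ Spec.map (CommRingCat.ofHom α) = b ≫ Spec.map (CommRingCat.ofHom α))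
    (hext : ∀ θ₂ : B →+* Γ(N, ⊤),
      ((ΓSpecIso (CommRingCat.of B)).inv ≫ b.appTop).hom.comp α = θ₂.comp α →
      ((ΓSpecIso (CommRingCat.of B)).inv ≫ b.appTop).hom = θ₂) : a = b := by
  have key : ∀ c : N ⟶ Spec (CommRingCat.of B),
      ((ΓSpecIso (CommRingCat.of B)).inv ≫ c.appTop).hom.comp α =
        ((ΓSpecIso (CommRingCat.of A)).inv ≫ (c ≫ Spec.map (CommRingCat.ofHom α)).appTop).hom := by
    intro c
    rw [Hom.comp_appTop, ← Category.assoc, ← ΓSpecIso_inv_naturality, Category.assoc]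
    rfl
  have h1 := hext ((ΓSpecIso (CommRingCat.of B)).inv ≫ a.appTop).hom (by rw [key, key, h])
  have h2 : (ΓSpecIso (CommRingCat.of B)).inv ≫ b.appTop =
      (ΓSpecIso (CommRingCat.of B)).inv ≫ a.appTop := CommRingCat.hom_ext h1
  rw [cancel_epi] at h2
  exact ext_of_isAffine h2.symm

/-- The open subschemes of `V₁` over `U` on which `x` generates the exceptional ideal. -/
def IsChartOpen (Z : V.IdealSheafData) (π : V₁ ⟶ V) (U : V.affineOpens) (x : Γ(V, U))
    (W : V₁.affineOpens) : Prop :=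
  ∃ h : W.1 ≤ π ⁻¹ᵁ U.1, appHom π h x ∈ nonZeroDivisors Γ(V₁, W) ∧
    (Z.comap π).ideal W = Ideal.span {appHom π h x}

theorem resHom_mem_nonZeroDivisors {X : Scheme.{u}} {W D : X.affineOpens} (f : Γ(X, W))
    (hD : D.1 = X.basicOpen f) (h : D.1 ≤ W.1) {t : Γ(X, W)} (ht : t ∈ nonZeroDivisors Γ(X, W)) :
    resHom X h t ∈ nonZeroDivisors Γ(X, D) := by
  let := (resHom X h).toAlgebra
  have := isLocalization_resHom f hD h
  exact IsLocalization.nonZeroDivisors_le_comap (Submonoid.powers f) Γ(X, D) ht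

theorem isUnit_resHom {X : Scheme.{u}} {W D : X.affineOpens} (f : Γ(X, W))
    (hD : D.1 = X.basicOpen f) (h : D.1 ≤ W.1) : IsUnit (resHom X h f) := by
  let := (resHom X h).toAlgebra
  have := isLocalization_resHom f hD h
  exact IsLocalization.Away.algebraMap_isUnit f

theorem isChartOpen_of_eq_mul {Z : V.IdealSheafData} {π : V₁ ⟶ V} {U : V.affineOpens}
    {x : Γ(V, U)} {W D : V₁.affineOpens} (h : W.1 ≤ π ⁻¹ᵁ U.1) {t c : Γ(V₁, W)}
    (ht : t ∈ nonZeroDivisors Γ(V₁, W)) (hL : (Z.comap π).ideal W = Ideal.span {t})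
    (hx : appHom π h x = c * t) (hD : D.1 = V₁.basicOpen c) (hDW : D.1 ≤ W.1) :
    IsChartOpen Z π U x D := by
  have hu := isUnit_resHom c hD hDW
  have h1 : appHom π (hDW.trans h) x = resHom V₁ hDW c * resHom V₁ hDW t := by
    rw [← map_mul, ← hx, ← RingHom.comp_apply, resHom_comp_appHom]
  refine ⟨hDW.trans h, ?_, ?_⟩
  · rw [h1]
    exact mul_mem hu.mem_nonZeroDivisors (resHom_mem_nonZeroDivisors c hD hDW ht)
  · rw [ideal_eq_span_of_le _ hDW hL, h1, Ideal.span_singleton_mul_left_unit hu]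

/-- At each point of the blowup one of the generators of the center generates the exceptional
ideal. -/
theorem exists_isChartOpen {Z : V.IdealSheafData} {π : V₁ ⟶ V}
    (hinv : IsInvertibleIdeal (Z.comap π)) (U : V.affineOpens) {G : Finset Γ(V, U)}
    (hG : Z.ideal U = Ideal.span G) {y : V₁} (hy : π y ∈ U.1) :
    ∃ x ∈ G, ∃ W, IsChartOpen Z π U x W ∧ y ∈ W.1 := by
  classical
  obtain ⟨W₁, hyW₁, t₁, ht₁, hL₁⟩ := hinv y
  obtain ⟨W₂, hyW₂, hW₂⟩ := exists_affineOpens_mem_le (x := y) (O := π ⁻¹ᵁ U.1) hy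
  obtain ⟨W, f, -, hf, -, hyW, hWW₁, hWW₂⟩ := exists_common_basicOpen hyW₁ hyW₂
  have h := hWW₂.trans hW₂
  set t := resHom V₁ hWW₁ t₁ with ht
  have htn : t ∈ nonZeroDivisors Γ(V₁, W) := resHom_mem_nonZeroDivisors f hf hWW₁ ht₁
  have hL : (Z.comap π).ideal W = Ideal.span {t} := ideal_eq_span_of_le _ hWW₁ hL₁
  have hL' : Ideal.span {t} = Ideal.span ((appHom π h) '' (G : Set Γ(V, U))) := by
    rw [← hL, ideal_comap π Z U W h, hG, Ideal.map_span]
  have h1 : ∀ g ∈ G, ∃ c, appHom π h g = c * t := by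
    intro g hg
    have : appHom π h g ∈ Ideal.span {t} := hL' ▸ Ideal.subset_span ⟨g, hg, rfl⟩
    obtain ⟨c, hc⟩ := Ideal.mem_span_singleton'.mp this
    exact ⟨c, hc.symm⟩
  choose! c hc using h1
  have h2 : ∃ g ∈ G, c g ∉ pointIdeal W.1 y hyW := by
    by_contra! hcon
    have h3 : Ideal.span ((appHom π h) '' (G : Set Γ(V, U))) ≤
        pointIdeal W.1 y hyW * Ideal.span {t} := by
      rw [Ideal.span_le]
      rintro _ ⟨g, hg, rfl⟩
      rw [SetLike.mem_coe, hc g hg]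
      exact Ideal.mul_mem_mul (hcon g hg) (Ideal.mem_span_singleton_self t)
    have h4 : t ∈ pointIdeal W.1 y hyW * Ideal.span {t} :=
      h3 (hL' ▸ Ideal.mem_span_singleton_self t)
    obtain ⟨z, hz, hzt⟩ := Ideal.mem_mul_span_singleton.mp h4
    have h5 : z = 1 := by
      have : z * t = 1 * t := by rw [hzt, one_mul]
      exact (mul_cancel_right_mem_nonZeroDivisors htn).mp this
    exact (Ideal.ne_top_iff_one _).mp (Ideal.IsPrime.ne_top inferInstance) (h5 ▸ hz)
  obtain ⟨g, hg, hcg⟩ := h2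
  obtain ⟨D, hD⟩ : ∃ D : V₁.affineOpens, D.1 = V₁.basicOpen (c g) := ⟨V₁.affineBasicOpen _, rfl⟩
  refine ⟨g, hg, D, isChartOpen_of_eq_mul h htn hL (hc g hg) hD (hD ▸ V₁.basicOpen_le _), ?_⟩
  rw [hD]
  rw [mem_pointIdeal_iff, not_not] at hcg
  exact hcg

end Charts

section ChartImmersion

open Scheme Opposite

variable {V V₁ : Scheme.{u}}

theorem appTop_ι_mem_nonZeroDivisors {T : Scheme.{u}} [IsIntegral T] (N : T.Opens) {b : Γ(T, ⊤)}
    (hb : b ≠ 0) : N.ι.appTop.hom b ∈ nonZeroDivisors Γ(N.toScheme, ⊤) := by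
  by_cases hN : Nonempty N
  · have : IsIntegral N.toScheme := isIntegral_of_isOpenImmersion N.ι
    have hne : Nonempty (N.ι ''ᵁ ⊤ : T.Opens) := by
      obtain ⟨x⟩ := hN
      exact ⟨⟨x.1, x, trivial, rfl⟩⟩
    refine mem_nonZeroDivisors_of_ne_zero fun h0 => hb ?_
    have h1 := map_injective_of_isIntegral T (homOfLE (le_top : N.ι ''ᵁ ⊤ ≤ ⊤))
    apply h1
    rw [map_zero]
    rw [Opens.ι_appTop] at h0
    exact h0
  · have : IsEmpty N.toScheme := not_nonempty_iff.mp hN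
    have : Subsingleton Γ(N.toScheme, ⊤) := by infer_instance
    rw [mem_nonZeroDivisors_iff_right]
    exact fun _ _ => Subsingleton.elim _ _

/-- The universal property of the chart gives sections of the chart over the open subschemes on
which `x` generates the exceptional ideal. -/
theorem exists_section_chart {Z : V.IdealSheafData} {π : V₁ ⟶ V} (hπ : IsBlowup π Z)
    (U : V.affineOpens) (hU : IsAffineOpen U.1) {x : Γ(V, U)} {B : Type u} [CommRing B]
    {α : Γ(V, U) →+* B} (hα : IsBlowupChart (Z.ideal U) x α)
    (k : Spec (CommRingCat.of B) ⟶ V₁)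
    (hk : k ≫ π = Spec.map (CommRingCat.ofHom α) ≫ hU.fromSpec) (W : V₁.affineOpens)
    (hW : IsChartOpen Z π U x W) : ∃ h : W.1.toScheme ⟶ Spec (CommRingCat.of B), h ≫ k = W.1.ι := by
  obtain ⟨hWU, hnz, hL⟩ := hW
  have aW : IsAffineOpen W.1 := W.2
  have hmap : (Z.ideal U).map (appHom π hWU) = Ideal.span {appHom π hWU x} := by
    rw [← hL, ideal_comap π Z U W hWU]
  obtain ⟨θ, hθ⟩ := hα.exists_lift (appHom π hWU) hnz hmap
  have hinv := isInvertibleIdeal_comap_SpecMap Z U hU (appHom π hWU) hnz hmap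
  obtain ⟨_, -, huniq⟩ := hπ.universal _ hinv
  have h1 : (Spec.map (CommRingCat.ofHom θ) ≫ k) ≫ π =
      Spec.map (CommRingCat.ofHom (appHom π hWU)) ≫ hU.fromSpec := by
    rw [Category.assoc, hk, ← Category.assoc, ← Spec.map_comp, ← CommRingCat.ofHom_comp, hθ]
  have h2 : aW.fromSpec ≫ π = Spec.map (CommRingCat.ofHom (appHom π hWU)) ≫ hU.fromSpec :=
    (IsAffineOpen.SpecMap_appLE_fromSpec π hU aW hWU).symm
  have h3 : Spec.map (CommRingCat.ofHom θ) ≫ k = aW.fromSpec :=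
    (huniq _ h1).trans (huniq _ h2).symm
  refine ⟨aW.isoSpec.hom ≫ Spec.map (CommRingCat.ofHom θ), ?_⟩
  rw [Category.assoc, h3, aW.isoSpec_hom_fromSpec]

/-- The chart `Spec B` of the blowup maps isomorphically onto the open subschemes of `V₁` on which
`x` generates the exceptional ideal. -/
theorem isIso_morphismRestrict_chart {Z : V.IdealSheafData} {π : V₁ ⟶ V} (hπ : IsBlowup π Z)
    (U : V.affineOpens) (hU : IsAffineOpen U.1) {x : Γ(V, U)} {B : Type u} [CommRing B]
    {α : Γ(V, U) →+* B} (hα : IsBlowupChart (Z.ideal U) x α)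
    (k : Spec (CommRingCat.of B) ⟶ V₁)
    (hk : k ≫ π = Spec.map (CommRingCat.ofHom α) ≫ hU.fromSpec) (W : V₁.affineOpens)
    (hW : IsChartOpen Z π U x W) : IsIso (k ∣_ W.1) := by
  have := hα.isDomain
  have : IsIntegral (Spec (CommRingCat.of B)) := inferInstance
  obtain ⟨h, hh⟩ := exists_section_chart hπ U hU hα k hk W hW
  have hrange : Set.range h ⊆ Set.range (k ⁻¹ᵁ W.1).ι := by
    rw [Opens.range_ι]
    rintro _ ⟨y, rfl⟩
    have h1 : k (h y) = y.1 := by rw [← Hom.comp_apply, hh]; rfl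
    change k (h y) ∈ W.1
    rw [h1]
    exact y.2
  let s : W.1.toScheme ⟶ (k ⁻¹ᵁ W.1).toScheme := IsOpenImmersion.lift (k ⁻¹ᵁ W.1).ι h hrange
  have hs : s ≫ (k ⁻¹ᵁ W.1).ι = h := IsOpenImmersion.lift_fac _ _ _
  have hkh : (k ∣_ W.1) ≫ h = (k ⁻¹ᵁ W.1).ι := by
    refine Spec_hom_ext α _ _ ?_ fun θ₂ hθ₂ => hα.hom_ext _ _ hθ₂ ?_
    · rw [← cancel_mono hU.fromSpec, Category.assoc, Category.assoc, Category.assoc, ← hk,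
        reassoc_of% hh, morphismRestrict_ι_assoc]
    · have h2 : (ΓSpecIso (CommRingCat.of B)).inv.hom (α x) ≠ 0 := by
        intro h0
        apply hα.ne_zero
        have := congrArg (ΓSpecIso (CommRingCat.of B)).hom.hom h0
        rw [map_zero] at this
        rwa [← CommRingCat.comp_apply, Iso.inv_hom_id] at this
      exact appTop_ι_mem_nonZeroDivisors (k ⁻¹ᵁ W.1) h2
  refine ⟨s, ?_, ?_⟩
  · rw [← cancel_mono (k ⁻¹ᵁ W.1).ι, Category.assoc, hs, hkh, Category.id_comp]
  · rw [← cancel_mono W.1.ι, Category.assoc, morphismRestrict_ι, reassoc_of% hs, hh,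
      Category.id_comp]

/-- The image of the chart is covered by opens on which `x` generates the exceptional ideal. -/
theorem exists_isChartOpen_of_chart {Z : V.IdealSheafData} {π : V₁ ⟶ V} (hπ : IsBlowup π Z)
    (U : V.affineOpens) (hU : IsAffineOpen U.1) {x : Γ(V, U)} (hx : x ∈ Z.ideal U) {B : Type u}
    [CommRing B] {α : Γ(V, U) →+* B} (hα : IsBlowupChart (Z.ideal U) x α)
    (k : Spec (CommRingCat.of B) ⟶ V₁)
    (hk : k ≫ π = Spec.map (CommRingCat.ofHom α) ≫ hU.fromSpec) (t : Spec (CommRingCat.of B)) :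
    ∃ W, IsChartOpen Z π U x W ∧ k t ∈ W.1 := by
  have := hα.isDomain
  have : IsIntegral (Spec (CommRingCat.of B)) := inferInstance
  have hkU : ∀ t, π (k t) ∈ U.1 := by
    intro t
    rw [← Hom.comp_apply, hk]
    exact le_preimage_SpecMap_fromSpec hU α
      (show t ∈ (⊤ : (Spec (CommRingCat.of B)).Opens) from trivial)
  -- a generator `t₀` of the exceptional ideal near `k t`
  obtain ⟨W₁, hyW₁, t₁, ht₁, hL₁⟩ := hπ.invertible (k t)
  obtain ⟨W₂, hyW₂, hW₂⟩ := exists_affineOpens_mem_le (x := k t) (O := π ⁻¹ᵁ U.1) (hkU t)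
  obtain ⟨W, f, -, hf, -, hyW, hWW₁, hWW₂⟩ := exists_common_basicOpen hyW₁ hyW₂
  have h := hWW₂.trans hW₂
  set t₀ := resHom V₁ hWW₁ t₁ with ht
  have htn : t₀ ∈ nonZeroDivisors Γ(V₁, W) := resHom_mem_nonZeroDivisors f hf hWW₁ ht₁
  have hL : (Z.comap π).ideal W = Ideal.span {t₀} := ideal_eq_span_of_le _ hWW₁ hL₁
  obtain ⟨c, hc⟩ : ∃ c, c * t₀ = appHom π h x := by
    apply Ideal.mem_span_singleton'.mp
    rw [← hL, ideal_comap π Z U W h]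
    exact Ideal.mem_map_of_mem _ hx
  -- the pullbacks of `t₀` and `x` generate the same ideal near `t`, so that `c` is a unit there
  obtain ⟨N, htN, hNW⟩ := exists_affineOpens_mem_le (x := t) (O := k ⁻¹ᵁ W.1) hyW
  have hNT : N.1 ≤ k ⁻¹ᵁ W.1 := hNW
  have hT : (⊤ : (Spec (CommRingCat.of B)).Opens) ∈ (Spec (CommRingCat.of B)).affineOpens :=
    isAffineOpen_top _
  have hle := le_preimage_SpecMap_fromSpec hU α
  have hNle : N.1 ≤ (Spec.map (CommRingCat.ofHom α) ≫ hU.fromSpec) ⁻¹ᵁ U.1 := le_top.trans hle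
  let ρ : B →+* Γ(Spec (CommRingCat.of B), N) :=
    (resHom _ (le_top : N.1 ≤ ⊤)).comp (ΓSpecIso (CommRingCat.of B)).inv.hom
  have hρ : appHom (Spec.map (CommRingCat.ofHom α) ≫ hU.fromSpec) hNle = ρ.comp α := by
    have h1 := resHom_comp_appHom (Spec.map (CommRingCat.ofHom α) ≫ hU.fromSpec) hle
      (le_top : N.1 ≤ ⊤)
    rw [← h1, appHom, appLE_SpecMap_fromSpec hU α hle]
    rfl
  have hkN : appHom (Spec.map (CommRingCat.ofHom α) ≫ hU.fromSpec) hNle =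
      (appHom k hNT).comp (appHom π h) := by
    rw [appHom, appHom, appHom, ← CommRingCat.hom_comp, Hom.appLE_comp_appLE]
    congr 2
    exact hk.symm
  have hI1 : (Z.comap (k ≫ π)).ideal N = Ideal.span {ρ (α x)} := by
    rw [hk, ideal_comap _ Z U N hNle]
    change (Z.ideal U).map (appHom _ hNle) = _
    rw [hρ, ← Ideal.map_map, hα.map_eq, Ideal.map_span, Set.image_singleton]
  have hI2 : (Z.comap (k ≫ π)).ideal N = Ideal.span {appHom k hNT t₀} := by
    rw [IdealSheafData.comap_comp, ideal_comap k _ W N hNT, hL, Ideal.map_span,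
      Set.image_singleton]
  have hNn : Nonempty N.1 := ⟨⟨t, htN⟩⟩
  have hdom : IsDomain Γ(Spec (CommRingCat.of B), N) := inferInstance
  have hρ0 : ρ (α x) ≠ 0 := by
    intro h0
    apply hα.ne_zero
    have hinj : Function.Injective ρ := by
      have h1 : Function.Injective (resHom (Spec (CommRingCat.of B)) (le_top : N.1 ≤ ⊤)) :=
        map_injective_of_isIntegral _ (homOfLE (le_top : N.1 ≤ ⊤))
      have h2 : Function.Injective (ΓSpecIso (CommRingCat.of B)).inv.hom :=
        (ΓSpecIso (CommRingCat.of B)).symm.commRingCatIsoToRingEquiv.injective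
      exact h1.comp h2
    exact hinj (h0.trans (map_zero ρ).symm)
  have hxc : ρ (α x) = appHom k hNT c * appHom k hNT t₀ := by
    rw [← map_mul, hc, ← RingHom.comp_apply, ← RingHom.comp_apply, ← hρ, hkN]
  have hcu : IsUnit (appHom k hNT c) := by
    have h2 : appHom k hNT t₀ ∈ Ideal.span {ρ (α x)} := by
      rw [← hI1, hI2]; exact Ideal.mem_span_singleton_self _
    obtain ⟨d, hd⟩ := Ideal.mem_span_singleton'.mp h2
    rw [hxc, ← mul_assoc] at hd
    have ht0 : appHom k hNT t₀ ≠ 0 := by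
      intro h0
      rw [hxc, h0, mul_zero] at hρ0
      exact hρ0 rfl
    exact IsUnit.of_mul_eq_one d (by
      rw [mul_comm]
      exact mul_right_cancel₀ ht0 (hd.trans (one_mul _).symm))
  obtain ⟨D, hD⟩ : ∃ D : V₁.affineOpens, D.1 = V₁.basicOpen c := ⟨V₁.affineBasicOpen c, rfl⟩
  refine ⟨D, isChartOpen_of_eq_mul h htn hL hc.symm hD (hD ▸ V₁.basicOpen_le c), ?_⟩
  rw [hD]
  have h3 : t ∈ (Spec (CommRingCat.of B)).basicOpen (appHom k hNT c) := by
    rw [basicOpen_of_isUnit _ hcu]; exact htN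
  have h4 : (Spec (CommRingCat.of B)).basicOpen (appHom k hNT c) ≤ k ⁻¹ᵁ V₁.basicOpen c := by
    rw [Hom.preimage_basicOpen]
    have h5 : appHom k hNT c = resHom _ hNT ((k.app W.1).hom c) := rfl
    rw [h5]
    exact (basicOpen_res _ _ (homOfLE hNT).op).le.trans inf_le_right
  exact h4 h3

/-- An affine chart of the blowup is an affine open subscheme of the blowup, and contains all
opens on which `x` generates the exceptional ideal. -/
theorem exists_affineOpens_chart {Z : V.IdealSheafData} {π : V₁ ⟶ V} (hπ : IsBlowup π Z)
    (U : V.affineOpens) {x : Γ(V, U)} (hx : x ∈ Z.ideal U) {B : Type u} [CommRing B]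
    {α : Γ(V, U) →+* B} (hα : IsBlowupChart (Z.ideal U) x α) :
    ∃ (W : V₁.affineOpens) (h : W.1 ≤ π ⁻¹ᵁ U.1) (Φ : B ≃+* Γ(V₁, W)),
      (∀ a, Φ (α a) = appHom π h a) ∧ ∀ W', IsChartOpen Z π U x W' → W'.1 ≤ W.1 := by
  have hU : IsAffineOpen U.1 := U.2
  have hdom := hα.isDomain
  obtain ⟨k, hk, -⟩ := hπ.universal _ (isInvertibleIdeal_comap_SpecMap Z U hU α
    (mem_nonZeroDivisors_of_ne_zero hα.ne_zero) hα.map_eq)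
  replace hk : k ≫ π = Spec.map (CommRingCat.ofHom α) ≫ hU.fromSpec := hk
  have hki : IsOpenImmersion k := by
    refine IsZariskiLocalAtTarget.of_range_subset_iSup (P := @IsOpenImmersion)
      (fun W : {W : V₁.affineOpens // IsChartOpen Z π U x W} => W.1.1) ?_ fun W => ?_
    · rintro _ ⟨t, rfl⟩
      obtain ⟨W, hW, htW⟩ := exists_isChartOpen_of_chart hπ U hU hx hα k hk t
      exact Opens.mem_iSup.mpr ⟨⟨W, hW⟩, htW⟩
    · have := isIso_morphismRestrict_chart hπ U hU hα k hk W.1 W.2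
      infer_instance
  have hW : IsAffineOpen (k ''ᵁ ⊤) := (isAffineOpen_top _).image_of_isOpenImmersion k
  have hle : k ''ᵁ ⊤ ≤ π ⁻¹ᵁ U.1 := by
    rintro _ ⟨t, -, rfl⟩
    change π (k t) ∈ U.1
    rw [← Hom.comp_apply, hk]
    exact le_preimage_SpecMap_fromSpec hU α
      (show t ∈ (⊤ : (Spec (CommRingCat.of B)).Opens) from trivial)
  let Φ := ((ΓSpecIso (CommRingCat.of B)).symm ≪≫ (k.appIso ⊤).symm).commRingCatIsoToRingEquiv
  refine ⟨⟨k ''ᵁ ⊤, hW⟩, hle, Φ, fun a => ?_, ?_⟩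
  · have hcomp : π.appLE U.1 (k ''ᵁ ⊤) hle ≫ (k.appIso ⊤).hom =
        CommRingCat.ofHom α ≫ (ΓSpecIso (CommRingCat.of B)).inv := by
      rw [Hom.appIso_hom', Hom.appLE_comp_appLE, ← appLE_SpecMap_fromSpec hU α
        (le_preimage_SpecMap_fromSpec hU α)]
      congr 1
    rw [← Iso.eq_comp_inv, Category.assoc] at hcomp
    rw [appHom, hcomp]
    rfl
  · intro W' hW' y hy
    obtain ⟨h, hh⟩ := exists_section_chart hπ U hU hα k hk W' hW'
    let z : W'.1.toScheme := ⟨y, hy⟩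
    have hz : k (h z) = y := by
      rw [← Hom.comp_apply, hh]
      rfl
    exact ⟨h z, trivial, hz⟩

end ChartImmersion

/-! ### Local structure of the blowup along a regular center -/

section Blowup

open Scheme Opposite

theorem IsPowBasis.map_of_bijective {A B : Type*} [CommRing A] [CommRing B] {ι : Type*} [Fintype ι]
    [DecidableEq ι] {q : ℕ} {w : ι → A} (h : IsPowBasis q w) (Φ : A ≃+* B) :
    IsPowBasis q (Φ ∘ w) := by
  have key : ∀ c : (ι → Fin q) → B, powExpand q (Φ ∘ w) c = Φ (powExpand q w (Φ.symm ∘ c)) := by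
    intro c
    have h1 := powExpand_map (Φ : A →+* B) q w (Φ.symm ∘ c)
    have h2 : (Φ : A →+* B) ∘ (Φ.symm ∘ c) = c := by funext γ; simp
    rw [h2] at h1
    exact h1
  have h1 : powExpand q (Φ ∘ w) = Φ ∘ powExpand q w ∘ (Φ.symm ∘ ·) := funext key
  rw [IsPowBasis, h1]
  exact Φ.bijective.comp (h.comp (Φ.symm.bijective.comp_left))

theorem IsPowBasis.isPowFinite {A : Type*} [CommRing A] {ι : Type*} [Fintype ι]
    [DecidableEq ι] {q : ℕ} {w : ι → A} (h : IsPowBasis q w) : IsPowFinite q A := by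
  let E := Fintype.equivFin (ι → Fin q)
  refine ⟨Fintype.card (ι → Fin q), fun k => ∏ i, w i ^ (E.symm k i : ℕ), fun a => ?_⟩
  obtain ⟨c, rfl⟩ := h.2 a
  refine ⟨c ∘ E.symm, ?_⟩
  rw [powExpand]
  exact (E.symm.sum_comp fun γ => c γ ^ q * ∏ i, w i ^ (γ i : ℕ)).symm

theorem isBlowupChart_id {A : Type u} [CommRing A] [IsDomain A] {I : Ideal A} (hI : I = ⊤) :
    IsBlowupChart I 1 (RingHom.id A) where
  isDomain := inferInstance
  ne_zero := one_ne_zero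
  map_eq := by rw [Ideal.map_id, hI, map_one, Ideal.span_singleton_one]
  exists_lift ψ _ _ := ⟨ψ, RingHom.comp_id ψ⟩
  hom_ext θ₁ θ₂ h _ := by simpa using h

variable {V V₁ : Scheme.{u}} {p : ℕ} [hp : Fact p.Prime]

theorem ideal_eq_top_of_disjoint {X : Scheme.{u}} (Z : X.IdealSheafData) (U : X.affineOpens)
    (h : ∀ x ∈ U.1, x ∉ Z.support) : Z.ideal U = ⊤ := by
  by_contra hne
  obtain ⟨P, hP, hle⟩ := Ideal.exists_le_maximal _ hne
  have := hP.isPrime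
  obtain ⟨x, hx, rfl⟩ := exists_pointIdeal_eq U P
  exact h x hx ((mem_support_iff_le_pointIdeal Z U hx).mpr hle)

/-- Every point of the blowup of a regular scheme along a regular closed subscheme has an affine
open neighbourhood whose ring of sections is a domain with a `p`-basis. -/
theorem exists_isPowBasis_blowup [IsNoetherian V] [IrreducibleSpace V] [hV : IsRegularScheme V]
    (hF : IsFFinite V p) {Z : V.IdealSheafData} (hZ : IsRegularScheme Z.subscheme) {π : V₁ ⟶ V}
    (hπ : IsBlowup π Z) (y : V₁) :
    ∃ W : V₁.affineOpens, y ∈ W.1 ∧ IsDomain Γ(V₁, W) ∧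
      ∃ (n : ℕ) (w : Fin n → Γ(V₁, W)), IsPowBasis p w := by
  classical
  have := isIntegral_of_isRegularScheme (V := V)
  by_cases hy : π y ∈ Z.support
  · obtain ⟨U, -, n, w, J, hyU, hw, hJ⟩ := exists_isPowBasis_subscheme hF Z hZ hy ⊤ trivial
    have := isDomain_section U hyU
    obtain ⟨_, hx, W', hW', hyW'⟩ := exists_isChartOpen hπ.invertible U (G := J.image w)
      (by rw [hJ, Finset.coe_image]) hyU
    obtain ⟨j, hj, rfl⟩ := Finset.mem_image.mp hx
    have hU := natCast_section_eq_zero hF.char_eq_zero U.1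
    have hj0 : w j ≠ 0 := by
      intro h0
      obtain ⟨h, hnz, -⟩ := hW'
      have : Nonempty W'.1 := ⟨⟨y, hyW'⟩⟩
      rw [h0, map_zero] at hnz
      exact zero_notMem_nonZeroDivisors hnz
    have hα : IsBlowupChart (Z.ideal U) (w j) (algebraMap Γ(V, U)
        (blowupChart (FractionRing Γ(V, U)) (Ideal.span (w '' J)) (mem_span_image w hj))) := by
      rw [hJ]
      exact isBlowupChart_blowupChart _ hj0
    obtain ⟨W, h, Φ, -, hW⟩ := exists_affineOpens_chart hπ U
      (hJ ▸ mem_span_image w hj) hα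
    obtain ⟨w', -, hw'⟩ := hw.blowupChart (K := FractionRing Γ(V, U)) hU J hj hj0
    have := hα.isDomain
    exact ⟨W, hW W' hW' hyW', Φ.toMulEquiv.isDomain_iff.mp inferInstance, n, _,
      hw'.map_of_bijective Φ⟩
  · obtain ⟨U, hyU, hUZ⟩ := exists_affineOpens_mem_le (x := π y)
      (O := ⟨(Z.support : Set V)ᶜ, Z.support.isClosed.isOpen_compl⟩) hy
    obtain ⟨U', hU', n, w, J, hyU', hw, -⟩ := exists_isPowBasis_point hF U hyU
    have := isDomain_section U' hyU'
    have hI : Z.ideal U' = ⊤ := ideal_eq_top_of_disjoint Z U' fun x hx => hUZ (hU' hx)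
    obtain ⟨_, hx, W', hW', hyW'⟩ := exists_isChartOpen hπ.invertible U' (G := {1})
      (by rw [hI, Finset.coe_singleton, Ideal.span_singleton_one]) hyU'
    rw [Finset.mem_singleton] at hx
    subst hx
    obtain ⟨W, h, Φ, -, hW⟩ := exists_affineOpens_chart hπ U' (hI ▸ Submodule.mem_top)
      (isBlowupChart_id hI)
    exact ⟨W, hW W' hW' hyW', Φ.toMulEquiv.isDomain_iff.mp inferInstance, n, _,
      hw.map_of_bijective Φ⟩

theorem isReduced_blowup [IsNoetherian V] [IrreducibleSpace V] [hV : IsRegularScheme V]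
    (hF : IsFFinite V p) {Z : V.IdealSheafData} (hZ : IsRegularScheme Z.subscheme) {π : V₁ ⟶ V}
    (hπ : IsBlowup π Z) : IsReduced V₁ := by
  have h1 : ∀ y : V₁, _root_.IsReduced (V₁.presheaf.stalk y) := fun y => by
    obtain ⟨W, hy, hdom, -⟩ := exists_isPowBasis_blowup hF hZ hπ y
    let := (V₁.presheaf.germ W.1 y hy).hom.toAlgebra
    have := isLocalization_pointIdeal W y hy
    have := IsLocalization.isDomain_of_atPrime (V₁.presheaf.stalk y) (pointIdeal W.1 y hy)
    infer_instance
  exact isReduced_of_isReduced_stalk V₁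

theorem isPowFinite_blowup [IsNoetherian V] [IrreducibleSpace V] [hV : IsRegularScheme V]
    (hF : IsFFinite V p) {Z : V.IdealSheafData} (hZ : IsRegularScheme Z.subscheme) {π : V₁ ⟶ V}
    (hπ : IsBlowup π Z) (e : ℕ) (W : V₁.affineOpens) : IsPowFinite (p ^ e) Γ(V₁, W) := by
  classical
  have hV₁ := natCast_of_hom π hF.char_eq_zero
  have hWp := natCast_section_eq_zero hV₁ W.1
  refine IsPowFinite.pow_prime hWp ?_ e
  have aW : IsAffineOpen W.1 := W.2
  let S : Set Γ(V₁, W) := {f | IsPowFinite p Γ(V₁, V₁.basicOpen f)}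
  have hS : Ideal.span S = ⊤ := by
    rw [← aW.self_le_iSup_basicOpen_iff]
    intro y hy
    obtain ⟨W', hy', -, n, w, hw⟩ := exists_isPowBasis_blowup hF hZ hπ y
    obtain ⟨D, f, g, hf, hg, hyD, hDW, hDW'⟩ := exists_common_basicOpen hy hy'
    refine Opens.mem_iSup.mpr ⟨⟨f, ?_⟩, hf ▸ hyD⟩
    let := (resHom V₁ hDW').toAlgebra
    have := isLocalization_resHom g hg hDW'
    have h1 : IsPowFinite p Γ(V₁, D) :=
      hw.isPowFinite.localization hp.out.ne_zero (Submonoid.powers g)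
    change IsPowFinite p Γ(V₁, V₁.basicOpen f)
    rw [← hf]
    exact h1
  obtain ⟨T, hTS, hT⟩ := (Ideal.span_eq_top_iff_finite _).mp hS
  have halg : ∀ f : Γ(V₁, W), IsLocalization.Away f Γ(V₁, V₁.basicOpen f) := fun f =>
    aW.isLocalization_basicOpen f
  refine IsPowFinite.of_away_cover (κ := Γ(V₁, W)) hp.out.ne_zero T (fun f => f)
    (by simpa using hT) (fun f => Γ(V₁, V₁.basicOpen f)) (fun f hf => hTS hf) fun x y => ?_
  have := map_add (frobPow p 1 hWp) x y
  simpa using this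

end Blowup

/-! ### Transforms of modules and of collections of ideals -/

section Transforms

open Scheme Opposite

variable {V V₁ : Scheme.{u}} {p e : ℕ} [hp : Fact p.Prime]

theorem ideal_diffPlus_blowup [IsNoetherian V] [IrreducibleSpace V] [hV : IsRegularScheme V]
    (hF : IsFFinite V p) {Z : V.IdealSheafData} (hZ : IsRegularScheme Z.subscheme) {π : V₁ ⟶ V}
    (hπ : IsBlowup π Z) (N : PowModule V₁ (p ^ e)) {i : ℕ} (hi : i < p ^ e) (W : V₁.affineOpens) :
    (N.diffPlus i).ideal W = diffPlusIdeal ℤ i (N.obj W : Set Γ(V₁, W)) := by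
  have := isReduced_blowup hF hZ hπ
  exact N.ideal_diffPlus (natCast_of_hom π hF.char_eq_zero)
    (isPowFinite_blowup hF hZ hπ e) hi W

/-- The differential ideals of the `a`-transform are contained in the `a`-transforms of the
differential ideals. If `t` generates the exceptional ideal, `s` is a section of the transform and
`D` an operator of order less than `q`, then `t ^ (q * a) * D s = D (t ^ (q * a) * s)`, and `D`
composed with the pullback of sections is a differential operator on `V` with values in `𝒪_{V₁}`. -/
theorem diffPlus_transform_le [IsNoetherian V] [IrreducibleSpace V] [hV : IsRegularScheme V]
    (hF : IsFFinite V p) {Z : V.IdealSheafData} (hZ : IsRegularScheme Z.subscheme) {π : V₁ ⟶ V}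
    (hπ : IsBlowup π Z) (M : PowModule V (p ^ e)) (a : ℕ) {i : ℕ} (hi : i < p ^ e) :
    (M.transform π Z a).diffPlus i ≤ collectionTransform (p ^ e) M.diffPlus π Z a i := by
  have := isIntegral_of_isRegularScheme (V := V)
  refine le_sSup ?_
  have hcover : ∀ y : V₁, ∃ (W : V₁.affineOpens) (U : V.affineOpens), y ∈ W.1 ∧
      ∃ (_ : W.1 ≤ π ⁻¹ᵁ U.1) (n : ℕ) (w : Fin n → Γ(V, U)) (t : Γ(V₁, W)), IsPowBasis p w ∧
        (Z.comap π).ideal W = Ideal.span {t} := by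
    intro y
    obtain ⟨U₀, hyU₀, -⟩ := exists_affineOpens_mem_le (x := π y) (O := ⊤) trivial
    obtain ⟨U, -, n, w, J, hyU, hw, -⟩ := exists_isPowBasis_point hF U₀ hyU₀
    obtain ⟨W, hyW, hWU, t, ht⟩ := hπ.invertible.isLocallyPrincipal y (π ⁻¹ᵁ U.1) hyU
    exact ⟨W, U, hyW, hWU, n, w, t, hw, ht⟩
  choose W U hyW hWU n w t hw ht using hcover
  refine IdealSheafData.le_of_iSup_eq_top W ?_ fun y => ?_
  · rw [eq_top_iff]
    exact fun y _ => Opens.mem_iSup.mpr ⟨y, hyW y⟩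
  · have hU := natCast_section_eq_zero hF.char_eq_zero (U y).1
    have hW := natCast_section_eq_zero (natCast_of_hom π hF.char_eq_zero) (W y).1
    rw [IdealSheafData.ideal_mul, Pi.mul_apply, ideal_diffPlus_blowup hF hZ hπ _ hi,
      ideal_pow_eq_span (ht y), ideal_comap π _ (U y) (W y) (hWU y),
      ideal_diffPlus_of_isFFinite hF M hi, Ideal.mul_le]
    intro r hr c hc
    obtain ⟨c, rfl⟩ := Ideal.mem_span_singleton'.mp hc
    rw [mul_left_comm]
    refine Ideal.mul_mem_left _ c ?_
    have hle : diffPlusIdeal ℤ i ((M.transform π Z a).obj (W y) : Set Γ(V₁, W y)) ≤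
        ((diffPlusIdeal ℤ i (M.obj (U y) : Set Γ(V, U y))).map (appHom π (hWU y))).colon
          (({t y ^ (p ^ e * a)} : Set Γ(V₁, W y))) := by
      rw [diffPlusIdeal_le_iff]
      intro D hD h1 s hs
      rw [Submodule.mem_colon_singleton, smul_eq_mul]
      obtain ⟨m, hm, c, hmc⟩ := (M.mem_transform_iff π hF.char_eq_zero hπ.invertible a (hWU y)
        (ht y) s).mp hs
      have h2 := hD.map_pow_mul hW (by omega : i + 1 ≤ p ^ e) (t y ^ a) s
      have h3 := hD.map_pow_mul hW (by omega : i + 1 ≤ p ^ e) c 1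
      rw [RingHom.id_apply, h1, mul_zero, mul_one] at h3
      rw [RingHom.id_apply, ← hmc, map_add, h3, add_zero] at h2
      rw [mul_comm, mul_comm (p ^ e) a, pow_mul, ← h2]
      refine hD.mem_of_mem_mapPow (appHom π (hWU y)) hW (by omega) (fun m hm => ?_) hm
      have hδ : DiffLT (appHom π (hWU y)) (i + 1) (D.comp (appHom π (hWU y)).toAddMonoidHom) := by
        have := hD.comp_ringHom (φ := appHom π (hWU y))
        rwa [RingHom.id_comp] at this
      refine hδ.map_mem_map_diffPlusIdeal hU ((hw y).pow_prime hU e) hi ?_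
        (SetLike.mem_coe.mpr hm)
      change D (appHom π (hWU y) 1) = 0
      rw [map_one, h1]
    have := hle hr
    rwa [Submodule.mem_colon_singleton, smul_eq_mul] at this

/-- If the order of `M` is at least `N` along the regular center `Z`, then its differential ideals
are contained in powers of the ideal of `Z`. -/
theorem diffPlus_le_pow [IsNoetherian V] [IrreducibleSpace V] [IsRegularScheme V]
    (hF : IsFFinite V p) {Z : V.IdealSheafData} (M : PowModule V (p ^ e)) {N : ℕ}
    (hN : ∀ z ∈ Z.support, (N : ℕ∞) ≤ eta (p ^ e) M.diffPlus z) {j : ℕ}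
    (hj : j ∈ Finset.Ico 1 (p ^ e)) {U : V.affineOpens} {n : ℕ} {w : Fin n → Γ(V, U)}
    {J : Finset (Fin n)} (hw : IsPowBasis p w) (hJ : Z.ideal U = Ideal.span (w '' J)) :
    (M.diffPlus j).ideal U ≤ Z.ideal U ^ (N - j) := by
  intro f hf
  rw [hJ]
  refine hw.mem_span_pow_of_forall_prime (natCast_section_eq_zero hF.char_eq_zero U.1) J
    fun P hP hle => ?_
  obtain ⟨z, hz, rfl⟩ := exists_pointIdeal_eq U P
  have hzZ : z ∈ Z.support := (mem_support_iff_le_pointIdeal Z U hz).mpr (hJ ▸ hle)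
  have h1 := (le_eta_iff _ _ _ _).mp (hN z hzZ) j hj
  exact (stalkIdeal_le_pow_iff _ U hz _).mp h1 f hf

theorem mem_support_comap {X Y : Scheme.{u}} (f : Y ⟶ X) (I : X.IdealSheafData) (y : Y) :
    y ∈ (I.comap f).support ↔ f y ∈ I.support := by
  rw [IdealSheafData.support_comap]
  rfl

/-- If the order of `M` is at least `(i + 1) q` along the center, then the order of the
`i`-transform of its differential ideals is at least `q` along the exceptional divisor. -/
theorem le_eta_collectionTransform [IsNoetherian V] [IrreducibleSpace V] [hV : IsRegularScheme V]
    (hF : IsFFinite V p) {Z : V.IdealSheafData} (hZ : IsRegularScheme Z.subscheme) {π : V₁ ⟶ V}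
    (hπ : IsBlowup π Z) (M : PowModule V (p ^ e)) {N i : ℕ} (hi : (i + 1) * p ^ e ≤ N)
    (hN : ∀ z ∈ Z.support, (N : ℕ∞) ≤ eta (p ^ e) M.diffPlus z) {y : V₁}
    (hy : y ∈ (Z.comap π).support) :
    ((p ^ e : ℕ) : ℕ∞) ≤ eta (p ^ e) (collectionTransform (p ^ e) M.diffPlus π Z i) y := by
  rw [le_eta_iff]
  intro j hj
  have hjq := Finset.mem_Ico.mp hj
  rw [mem_support_comap] at hy
  obtain ⟨U, -, n, w, J, hyU, hw, hJ⟩ := exists_isPowBasis_subscheme hF Z hZ hy ⊤ trivial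
  obtain ⟨W₁, hyW₁, t₁, ht₁, hL₁⟩ := hπ.invertible y
  obtain ⟨W₂, hyW₂, hW₂⟩ := exists_affineOpens_mem_le (x := y) (O := π ⁻¹ᵁ U.1) hyU
  obtain ⟨W, f, -, hf, -, hyW, hWW₁, hWW₂⟩ := exists_common_basicOpen hyW₁ hyW₂
  have hWU := hWW₂.trans hW₂
  set t := resHom V₁ hWW₁ t₁ with ht
  have htn : t ∈ nonZeroDivisors Γ(V₁, W) := resHom_mem_nonZeroDivisors f hf hWW₁ ht₁
  have hL : (Z.comap π).ideal W = Ideal.span {t} := ideal_eq_span_of_le _ hWW₁ hL₁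
  have htP : t ∈ pointIdeal W.1 y hyW := by
    have h1 := (mem_support_iff_le_pointIdeal (Z.comap π) W hyW).mp
      ((mem_support_comap π Z y).mpr hy)
    exact h1 (hL ▸ Ideal.mem_span_singleton_self t)
  rw [stalkIdeal_le_pow_iff _ W hyW]
  intro s hs
  refine ⟨1, fun h1 => (Ideal.ne_top_iff_one _).mp (Ideal.IsPrime.ne_top inferInstance) h1, ?_⟩
  rw [one_mul]
  have h1 := mul_mem_ideal_of_mem_idealColon _ _ hs (t := t ^ (p ^ e * i))
    (by rw [ideal_pow_eq_span hL]; exact Ideal.mem_span_singleton_self _)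
  have h2 : (Z.ideal U ^ (N - j)).map (appHom π hWU) = Ideal.span {t ^ (N - j)} := by
    rw [Ideal.map_pow, ← Ideal.span_singleton_pow, ← hL, ideal_comap π Z U W hWU]
  rw [ideal_comap π _ U W hWU] at h1
  have h3 := Ideal.map_mono (f := appHom π hWU) (diffPlus_le_pow hF M hN hj hw hJ) h1
  rw [h2] at h3
  obtain ⟨r, hr⟩ := Ideal.mem_span_singleton'.mp h3
  have hNj : N - j = (N - j - p ^ e * i) + p ^ e * i := by
    have : (i + 1) * p ^ e = p ^ e * i + p ^ e := by ring
    omega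
  rw [hNj, pow_add, ← mul_assoc] at hr
  have h4 := (mul_cancel_right_mem_nonZeroDivisors (pow_mem htn (p ^ e * i))).mp hr
  rw [← h4]
  refine Ideal.mul_mem_left _ _ (Ideal.pow_le_pow_right ?_ (Ideal.pow_mem_pow htP _))
  have : (i + 1) * p ^ e = p ^ e * i + p ^ e := by ring
  omega

theorem mapPow_id {A : Type*} [CommRing A] {q : ℕ} (N : Submodule (powSubring A q) A) :
    mapPow (RingHom.id A) N = N := by
  rw [mapPow]
  simp

theorem appHom_id {X : Scheme.{u}} {W : X.Opens} (h : W ≤ (𝟙 X : X ⟶ X) ⁻¹ᵁ W) :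
    appHom (𝟙 X) h = RingHom.id Γ(X, W) := by
  ext a
  have h1 : (X.presheaf.map (𝟙 (op W))).hom a = a := by rw [X.presheaf.map_id]; rfl
  exact h1

/-- An invertible ideal is the exceptional ideal of the identity, as a blowup. -/
theorem isBlowup_id {X : Scheme.{u}} {I : X.IdealSheafData} (hI : IsInvertibleIdeal I) :
    IsBlowup (𝟙 X) I where
  invertible := by rwa [IdealSheafData.comap_id]
  universal g _ := ⟨g, Category.comp_id g,
    fun h hh => by rw [← hh]; exact (Category.comp_id h).symm⟩

/-- The `(i + 1)`-transform is the `1`-transform of the `i`-transform along the exceptional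
divisor. -/
theorem PowModule.transform_succ {X Y : Scheme.{u}} (hX : (p : Γ(X, ⊤)) = 0)
    (M : PowModule X (p ^ e)) (f : Y ⟶ X) {I : X.IdealSheafData}
    (hI : IsInvertibleIdeal (I.comap f)) (i : ℕ) :
    M.transform f I (i + 1) = (M.transform f I i).transform (𝟙 Y) (I.comap f) 1 := by
  have hY := natCast_of_hom f hX
  have hI' : IsInvertibleIdeal ((I.comap f).comap (𝟙 Y)) := by rwa [IdealSheafData.comap_id]
  have key : ∀ (y : Y) (O : Y.affineOpens), y ∈ O.1 → ∃ W : Y.affineOpens, y ∈ W.1 ∧ W.1 ≤ O.1 ∧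
      (M.transform f I (i + 1)).obj W =
        ((M.transform f I i).transform (𝟙 Y) (I.comap f) 1).obj W := by
    intro y O hy
    obtain ⟨U, hU, -⟩ := exists_affineOpens_mem_le (x := f y) (O := ⊤) trivial
    obtain ⟨W, hyW, hWO, t, ht⟩ := hI.isLocallyPrincipal y (f ⁻¹ᵁ U.1 ⊓ O.1) ⟨hU, hy⟩
    have hWU : W.1 ≤ f ⁻¹ᵁ U.1 := hWO.trans inf_le_left
    refine ⟨W, hyW, hWO.trans inf_le_right, ?_⟩
    have hWW : W.1 ≤ (𝟙 Y : Y ⟶ Y) ⁻¹ᵁ W.1 := le_rfl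
    have ht' : ((I.comap f).comap (𝟙 Y)).ideal W = Ideal.span {t} := by
      rwa [IdealSheafData.comap_id]
    ext s
    rw [M.mem_transform_iff f hX hI (i + 1) hWU ht,
      PowModule.mem_transform_iff _ (𝟙 Y) hY hI' 1 hWW ht', appHom_id, mapPow_id]
    have hWp := natCast_section_eq_zero hY W.1
    have hadd : ∀ a b : Γ(Y, W), (a + b) ^ p ^ e = a ^ p ^ e + b ^ p ^ e :=
      map_add (frobPow p e hWp)
    constructor
    · rintro ⟨m, hm, c, hc⟩
      refine ⟨t ^ p ^ e * s, ?_, 0, ?_⟩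
      · rw [M.mem_transform_iff f hX hI i hWU ht]
        exact ⟨m, hm, c, by rw [hc, pow_succ, mul_pow, mul_assoc]⟩
      · rw [zero_pow (pow_ne_zero _ hp.out.ne_zero), add_zero, pow_one]
    · rintro ⟨m', hm', c', hc'⟩
      obtain ⟨m, hm, c, hc⟩ := (M.mem_transform_iff f hX hI i hWU ht m').mp hm'
      refine ⟨m, hm, c + t ^ i * c', ?_⟩
      rw [pow_one] at hc'
      rw [hadd, ← add_assoc, hc, mul_pow _ c', ← mul_add, hc', pow_succ, mul_pow, mul_assoc]
  apply le_antisymm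
  · refine PowModule.le_of_basis _ _ hY fun y O hy => ?_
    obtain ⟨W, h1, h2, h3⟩ := key y O hy
    exact ⟨W, h1, h2, h3.le⟩
  · refine PowModule.le_of_basis _ _ hY fun y O hy => ?_
    obtain ⟨W, h1, h2, h3⟩ := key y O hy
    exact ⟨W, h1, h2, h3.ge⟩

end Transforms

/-! ### The last transform is not singular along the exceptional divisor -/

section LastTransform

open Scheme Opposite

variable {V V₁ : Scheme.{u}} {p e : ℕ} [hp : Fact p.Prime]

theorem IsPowBasis.ne_zero {A : Type*} [CommRing A] [Nontrivial A] {ι : Type*} [Fintype ι]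
    [DecidableEq ι] {w : ι → A} (h : IsPowBasis p w) (j : ι) : w j ≠ 0 := by
  intro hj
  have hp0 : p ≠ 0 := hp.out.ne_zero
  let γ : ι → Fin p := fun _ => ⟨1, hp.out.one_lt⟩
  have h1 : powExpand p w (Pi.single γ 1) = powExpand p w 0 := by
    rw [powExpand_single hp0, powExpand_zero hp0,
      Finset.prod_eq_zero (Finset.mem_univ j) (by rw [hj]; exact pow_one 0), mul_zero]
  have h2 := congrFun (h.1 h1) γ
  rw [Pi.single_eq_same, Pi.zero_apply] at h2
  exact one_ne_zero h2

theorem RingEquiv.eq_symm_pow_add {A B C : Type*} [CommRing A] [CommRing B] [CommRing C]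
    (Φ : B ≃+* C) {α : A →+* B} {φ : A →+* C} (hΦ : ∀ a, Φ (α a) = φ a) {f x : A} {m n : ℕ}
    {G k : C} (h : φ f = G ^ m + φ x ^ n * k) :
    α f = Φ.symm G ^ m + α x ^ n * Φ.symm k := by
  apply Φ.injective
  simp [hΦ, h]

/-- If the exceptional divisor is contained in the singular locus of the `a`-transform, then the
sections of `M` are, up to `q`-th powers, divisible by the `(a + 1) q`-th power of the equation `t`
of the exceptional divisor in each chart. -/
theorem exists_eq_pow_add_of_le_sing [IsNoetherian V] [IrreducibleSpace V] [hV : IsRegularScheme V]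
    (hF : IsFFinite V p) {Z : V.IdealSheafData} (hZ : IsRegularScheme Z.subscheme) {π : V₁ ⟶ V}
    (hπ : IsBlowup π Z) (M : PowModule V (p ^ e)) {N a : ℕ} (ha : a * p ^ e ≤ N)
    (hN : ∀ z ∈ Z.support, (N : ℕ∞) ≤ eta (p ^ e) M.diffPlus z)
    (hsing : ((Z.comap π).support : Set V₁) ⊆ (M.transform π Z a).sing)
    {U : V.affineOpens} {n : ℕ} {w : Fin n → Γ(V, U)} {J : Finset (Fin n)} (hw : IsPowBasis p w)
    (hJ : Z.ideal U = Ideal.span (w '' J)) {W : V₁.affineOpens} (h : W.1 ≤ π ⁻¹ᵁ U.1)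
    {w' : Fin n → Γ(V₁, W)} (hw' : IsPowBasis p w') {j : Fin n}
    (hnz : w' j ∈ nonZeroDivisors Γ(V₁, W))
    (ht : (Z.comap π).ideal W = Ideal.span {w' j}) {f : Γ(V, U)} (hf : f ∈ M.obj U) :
    ∃ G k, appHom π h f = G ^ p ^ e + w' j ^ (p ^ e * (a + 1)) * k := by
  have := isIntegral_of_isRegularScheme (V := V)
  have hq : p ^ e ≠ 0 := pow_ne_zero _ hp.out.ne_zero
  have hU := natCast_section_eq_zero hF.char_eq_zero U.1
  have hW := natCast_section_eq_zero (natCast_of_hom π hF.char_eq_zero) W.1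
  have hadd : ∀ a b : Γ(V₁, W), (a + b) ^ p ^ e = a ^ p ^ e + b ^ p ^ e :=
    map_add (frobPow p e hW)
  have hneg : ∀ a : Γ(V₁, W), (-a) ^ p ^ e = -a ^ p ^ e := map_neg (frobPow p e hW)
  have hwq := hw'.pow_prime hW e
  have hδ : ∀ {i : ℕ} {D : Γ(V₁, W) →+ Γ(V₁, W)}, DiffLT (RingHom.id _) (i + 1) D →
      DiffLT (appHom π h) (i + 1) (D.comp (appHom π h).toAddMonoidHom) := by
    intro i D hD
    have := hD.comp_ringHom (φ := appHom π h)
    rwa [RingHom.id_comp] at this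
  -- the order of `M` along `Z` bounds the divisibility of the `D f` by `t`
  have h1 : ∀ i < p ^ e, ∀ D : Γ(V₁, W) →+ Γ(V₁, W), DiffLT (RingHom.id _) (i + 1) D → D 1 = 0 →
      w' j ^ (p ^ e * a - i) ∣ D (appHom π h f) := by
    intro i hi D hD h1
    have h2 : D (appHom π h f) ∈ (diffPlusIdeal ℤ i (M.obj U : Set Γ(V, U))).map (appHom π h) := by
      refine (hδ hD).map_mem_map_diffPlusIdeal hU (hw.pow_prime hU e) hi ?_ (SetLike.mem_coe.mpr hf)
      change D (appHom π h 1) = 0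
      rw [map_one, h1]
    rcases Nat.eq_zero_or_pos i with rfl | hi0
    · rw [diffPlusIdeal_zero, Ideal.map_bot, Ideal.mem_bot] at h2
      rw [h2]
      exact dvd_zero _
    · rw [← ideal_diffPlus_of_isFFinite hF M hi] at h2
      have h3 := Ideal.map_mono (f := appHom π h)
        (diffPlus_le_pow hF M hN (Finset.mem_Ico.mpr ⟨hi0, hi⟩) hw hJ) h2
      have h4 : (Z.ideal U ^ (N - i)).map (appHom π h) = Ideal.span {w' j ^ (N - i)} := by
        rw [Ideal.map_pow, ← Ideal.span_singleton_pow, ← ht, ideal_comap π Z U W h]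
      rw [h4, Ideal.mem_span_singleton] at h3
      refine (pow_dvd_pow _ ?_).trans h3
      rw [mul_comm]
      omega
  obtain ⟨G, g, hGg⟩ := hwq.exists_pow_add_of_diff_mem_pow hW j hnz a h1
  -- `g` is a section of the `a`-transform, so that its derivatives vanish on the divisor
  have hg : g ∈ (M.transform π Z a).obj W := by
    rw [M.mem_transform_iff π hF.char_eq_zero hπ.invertible a h ht]
    refine ⟨_, mem_mapPow (appHom π h) hf, -G, ?_⟩
    rw [hneg, hGg, ← pow_mul, mul_comm a]
    ring
  have h2 : diffPlusIdeal ℤ (p ^ e - 1) ((M.transform π Z a).obj W : Set Γ(V₁, W)) ≤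
      Ideal.span {w' j} := by
    have h3 : (Ideal.span {w' j}).IsRadical := by
      have := hw'.isRadical_span hW {j}
      simpa using this
    rw [← h3.radical, Ideal.radical_eq_sInf]
    refine le_sInf ?_
    rintro P ⟨hle, hP⟩
    obtain ⟨y, hy, rfl⟩ := exists_pointIdeal_eq W P
    have hyH : y ∈ (Z.comap π).support :=
      (mem_support_iff_le_pointIdeal _ W hy).mpr (ht ▸ hle)
    have hys : y ∈ ((M.transform π Z a).diffPlus (p ^ e - 1)).support := hsing hyH
    rw [mem_support_iff_le_pointIdeal _ W hy,
      ideal_diffPlus_blowup hF hZ hπ _ (by omega)] at hys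
    exact hys
  obtain ⟨G', k, hk⟩ := hwq.exists_pow_add_of_diff_mem hW j (f := g) fun D hD h1 =>
    h2 (mem_diffPlusIdeal (hD.mono (by omega)) h1 (SetLike.mem_coe.mpr hg))
  refine ⟨G + w' j ^ a * G', k, ?_⟩
  rw [hGg, hk, hadd, mul_pow, ← pow_mul, mul_comm a, mul_add, mul_add, pow_add, mul_one]
  ring

/-- If `a` is the largest integer such that the order of `M` along the center `Z` is at least `a q`,
then the `a`-transform is not singular along the exceptional divisor. -/
theorem not_le_sing_transform [IsNoetherian V] [IrreducibleSpace V] [hV : IsRegularScheme V]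
    (hF : IsFFinite V p) {Z : V.IdealSheafData} (hZ : IsRegularScheme Z.subscheme) {π : V₁ ⟶ V}
    (hπ : IsBlowup π Z) (M : PowModule V (p ^ e)) (hne : (Z.support : Set V).Nonempty) {a b : ℕ}
    (ha : 1 ≤ a) (hb : b < p ^ e)
    (hN : ∀ z ∈ Z.support, eta (p ^ e) M.diffPlus z = ((a * p ^ e + b : ℕ) : ℕ∞)) :
    ¬ ((Z.comap π).support : Set V₁) ⊆ (M.transform π Z a).sing := by
  classical
  intro hsing
  have := isIntegral_of_isRegularScheme (V := V)
  obtain ⟨z, hz⟩ := hne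
  obtain ⟨U, -, n, w, J, hzU, hw, hJ⟩ := exists_isPowBasis_subscheme hF Z hZ hz ⊤ trivial
  have := isDomain_section U hzU
  have hU := natCast_section_eq_zero hF.char_eq_zero U.1
  have hN' : ∀ z ∈ Z.support, ((a * p ^ e + b : ℕ) : ℕ∞) ≤ eta (p ^ e) M.diffPlus z :=
    fun z hz => (hN z hz).ge
  have hlt : ((a * p ^ e + b : ℕ) : ℕ∞) < ((p ^ e * (a + 1) : ℕ) : ℕ∞) := by
    rw [Nat.cast_lt]
    have : p ^ e * (a + 1) = a * p ^ e + p ^ e := by ring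
    omega
  refine hlt.not_ge ?_
  rw [← hN z hz, le_eta_iff]
  intro i hi
  have hiq := Finset.mem_Ico.mp hi
  have hle : Z.ideal U ≤ pointIdeal U.1 z hzU := (mem_support_iff_le_pointIdeal Z U hzU).mp hz
  suffices h : (M.diffPlus i).ideal U ≤ Z.ideal U ^ (p ^ e * (a + 1) - i) by
    rw [stalkIdeal_le_pow_iff _ U hzU]
    intro f hf
    refine ⟨1, fun h1 => (Ideal.ne_top_iff_one _).mp (Ideal.IsPrime.ne_top inferInstance) h1, ?_⟩
    rw [one_mul]
    exact Ideal.pow_right_mono hle _ (h hf)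
  rcases J.eq_empty_or_nonempty with rfl | ⟨j, hj⟩
  · -- the center is all of `V`, and the differential ideals vanish
    have h0 : 0 < a * p ^ e + b - i := by
      have := Nat.le_mul_of_pos_left (p ^ e) ha
      omega
    refine (diffPlus_le_pow hF M hN' hi hw hJ).trans ?_
    rw [hJ, Finset.coe_empty, Set.image_empty, Ideal.span_empty, ← Ideal.zero_eq_bot,
      zero_pow h0.ne']
    exact bot_le
  · have hj0 : w j ≠ 0 := hw.ne_zero j
    have hα : IsBlowupChart (Z.ideal U) (w j) (algebraMap Γ(V, U)
        (blowupChart (FractionRing Γ(V, U)) (Ideal.span (w '' J)) (mem_span_image w hj))) := by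
      rw [hJ]
      exact isBlowupChart_blowupChart _ hj0
    obtain ⟨W, h, Φ, hΦ, -⟩ := exists_affineOpens_chart hπ U (hJ ▸ mem_span_image w hj) hα
    obtain ⟨w', hw'j, hw'⟩ := hw.blowupChart (K := FractionRing Γ(V, U)) hU J hj hj0
    have := hα.isDomain
    have hΦj : (Φ ∘ w') j = appHom π h (w j) := by rw [Function.comp_apply, hw'j, hΦ]
    have hWdom : IsDomain Γ(V₁, W) := Φ.toMulEquiv.isDomain_iff.mp inferInstance
    have hnz : (Φ ∘ w') j ∈ nonZeroDivisors Γ(V₁, W) := by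
      refine mem_nonZeroDivisors_of_ne_zero ?_
      rw [Function.comp_apply, hw'j, Ne, map_eq_zero_iff _ Φ.injective]
      exact hα.ne_zero
    have hcomp : appHom π h = Φ.toRingHom.comp (algebraMap Γ(V, U)
        (blowupChart (FractionRing Γ(V, U)) (Ideal.span (w '' J)) (mem_span_image w hj))) :=
      RingHom.ext fun a => (hΦ a).symm
    have ht : (Z.comap π).ideal W = Ideal.span {(Φ ∘ w') j} := by
      rw [ideal_comap π Z U W h]
      change (Z.ideal U).map (appHom π h) = _
      rw [hcomp, ← Ideal.map_map, hα.map_eq, Ideal.map_span, Set.image_singleton, hΦj, hcomp]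
      rfl
    rw [ideal_diffPlus_of_isFFinite hF M hiq.2, diffPlusIdeal_le_iff]
    intro D hD h1 f hf
    obtain ⟨G, k, hGk⟩ := exists_eq_pow_add_of_le_sing hF hZ hπ M (Nat.le_add_right _ b) hN' hsing
      hw hJ h (hw'.map_of_bijective Φ) hnz ht hf
    rw [hJ]
    refine DiffLT.mem_span_pow_of_blowupChart (K := FractionRing Γ(V, U)) hU hw J hj
      (G := Φ.symm G) (k := Φ.symm k) ?_ hiq.2 hD h1
    exact Φ.eq_symm_pow_add hΦ (by rw [hGk, hΦj])

end LastTransform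

theorem theorem1p8 {V : Scheme.{u}} [IsNoetherian V] [IrreducibleSpace V] [IsRegularScheme V]
    (p e q : ℕ) [Fact p.Prime] (hq : q = p ^ e) [IsFFinite V p] (M : PowModule V q) :
    -- (1)
    M.sing = {x : V | (q : ℕ∞) ≤ eta q M.diffPlus x} ∧
    -- `Z` is the ideal of a regular closed subscheme, `V₁` the blowup, `H₁` the exceptional divisor
    ∀ (Z : V.IdealSheafData), IsRegularScheme Z.subscheme →
    ∀ (V₁ : Scheme.{u}) (π : V₁ ⟶ V), IsBlowup π Z →
    ∀ (H₁ : Set V₁), H₁ = ((Z.comap π).support : Set V₁) →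
      -- (2)
      (M.sing.Nonempty → (Z.support : Set V).Nonempty → ∀ a b : ℕ, b < q →
        IsGreatest (Set.range fun x : V => eta q M.diffPlus x) ((a * q + b : ℕ) : ℕ∞) →
        (∀ z ∈ Z.support, eta q M.diffPlus z = ((a * q + b : ℕ) : ℕ∞)) →
          1 ≤ a ∧
          -- (a)
          (Z.support : Set V) ⊆ M.sing ∧
          -- (b)
          (∀ i : ℕ, 1 ≤ i → i < a →
            H₁ ⊆ (M.transform π Z i).sing ∧
            IsBlowup (𝟙 V₁) (Z.comap π) ∧
            M.transform π Z (i + 1) =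
              (M.transform π Z i).transform (𝟙 V₁) (Z.comap π) 1) ∧
          -- (c)
          ¬ H₁ ⊆ (M.transform π Z a).sing) ∧
      -- (3)
      (∀ a : ℕ, 1 ≤ a →
        (∀ i ∈ Finset.Ico 1 q,
          (M.transform π Z a).diffPlus i ≤ collectionTransform q M.diffPlus π Z a i) ∧
        (∀ x₁ : V₁, eta q (collectionTransform q M.diffPlus π Z a) x₁ ≤
          eta q (M.transform π Z a).diffPlus x₁) ∧
        {x₁ : V₁ | (q : ℕ∞) ≤ eta q (collectionTransform q M.diffPlus π Z a) x₁} ⊆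
          (M.transform π Z a).sing) := by
  subst hq
  have hF : IsFFinite V p := inferInstance
  have hq0 : p ^ e ≠ 0 := pow_ne_zero _ (Fact.out : p.Prime).ne_zero
  refine ⟨M.sing_eq hF, ?_⟩
  rintro Z hZ V₁ π hπ H₁ rfl
  refine ⟨?_, fun a _ => ?_⟩
  · intro ⟨x, hx⟩ hne a b hb hmax hN
    have ha : 1 ≤ a := by
      rw [M.sing_eq hF] at hx
      have h1 : ((p ^ e : ℕ) : ℕ∞) ≤ ((a * p ^ e + b : ℕ) : ℕ∞) := le_trans hx (hmax.2 ⟨x, rfl⟩)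
      rw [Nat.cast_le] at h1
      -- for `a = 0` the order would be at most `b < q` everywhere
      by_contra h0
      obtain rfl : a = 0 := by omega
      omega
    refine ⟨ha, fun z hz => ?_, fun i _ hia => ⟨fun y hy => ?_, isBlowup_id hπ.invertible,
      M.transform_succ hF.char_eq_zero π hπ.invertible i⟩,
      not_le_sing_transform hF hZ hπ M hne ha hb hN⟩
    · rw [M.sing_eq hF, Set.mem_ofPred_eq, hN z hz, Nat.cast_le]
      exact (Nat.le_mul_of_pos_left _ ha).trans (Nat.le_add_right _ _)
    · have hi : (i + 1) * p ^ e ≤ a * p ^ e + b :=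
        (Nat.mul_le_mul_right _ hia).trans (Nat.le_add_right _ _)
      exact PowModule.mem_sing_of_le_eta hq0 _
        ((le_eta_collectionTransform hF hZ hπ M hi (fun z hz => (hN z hz).ge) hy).trans
          (eta_mono (fun j hj => diffPlus_transform_le hF hZ hπ M i (Finset.mem_Ico.mp hj).2) y))
  · have hle : ∀ i ∈ Finset.Ico 1 (p ^ e),
        (M.transform π Z a).diffPlus i ≤ collectionTransform (p ^ e) M.diffPlus π Z a i :=
      fun i hi => diffPlus_transform_le hF hZ hπ M a (Finset.mem_Ico.mp hi).2
    exact ⟨hle, eta_mono hle, fun x₁ hx₁ =>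
      PowModule.mem_sing_of_le_eta hq0 _ (le_trans hx₁ (eta_mono hle x₁))⟩
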